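/- Let $\Sigma$ be a finite alphabet. An enumeration problem is a map $x \mapsto A(x)$ that associates to each word $x \in \Sigma^*$ (the instance) a set $A(x) \subseteq \Sigma^*$ (the solutions). It is in $\mathrm{EnumP}$ if there is a polynomial $q$ with $|y| \le q(|x|)$ for all $x$ and all $y \in A(x)$, and if deciding, given $x$ and $y$, whether $y \in A(x)$ can be done in polynomial time. The machine model is the random access machine: finite program, integer registers initialized to zero, input read from a one-way tape, indirect addressing, addition, subtraction, multiplication, comparison, and an $\mathtt{Output}(i,j)$ instruction that outputs the word stored in a range of consecutive registers. On inputs of length $n$, an arithmetic operation or comparison costs the sum of the sizes of its arguments divided by $\log n$ (rounded up, with $\log n$ replaced by the binary length of $n$, at least $1$), every other instruction costs $1$, and the space used in a configuration is the sum of the sizes of the integers in the registers, up to the register of largest index accessed so far. A machine $M$ solves $A$ if on every input $x$ it halts, the words it outputs are exactly the elements of $A(x)$, none of them is output twice, and, if there is an output, $M$ stops right after its last output. Let $T_M(x,i)$ be the time taken by $M$ on input $x$ before its $i$-th output instruction is executed. A machine uses polynomial space if there is a polynomial $r$ such that on every input $x$ it uses space at most $r(|x|)$ in every configuration it reaches.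 * $\mathrm{IncP}_1^{\mathrm{poly}}$ is the class of problems $A \in \mathrm{EnumP}$ that are solved by a machine $M$ using polynomial space for which there are constants $C, b \in \mathbb{N}$ such that $T_M(x,i) \le C\, i\, (|x|+1)^b$ for all $x$ and all $1 \le i \le \sharp A(x)$. * $\mathrm{DelayP}^{\mathrm{poly}}$ is the class of problems $A \in \mathrm{EnumP}$ that are solved by a machine $M$ using polynomial space for which there is a polynomial $p$ such that, for all $x$, $T_M(x,1) < p(|x|)$ (if $A(x) = \emptyset$, this means that $M$ halts in time less than $p(|x|)$), and $T_M(x,i) - T_M(x,i-1) < p(|x|)$ for all $1 < i \le \sharp A(x)$. Then $$\mathrm{IncP}_1^{\mathrm{poly}} = \mathrm{DelayP}^{\mathrm{poly}}.$$ -/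

import Mathlib

namespace EnumRAM

/-! ## Random access machines

Registers `R_0, R_1, ...` hold integers and are initially zero. The input is a finite sequence of
integers on a read-only one-way tape. -/

/-- The arithmetic operations with an integer result. -/
inductive ArithOp where
  | add
  | sub
  | mul

/-- The value of an arithmetic operation. -/
def ArithOp.eval : ArithOp → ℤ → ℤ → ℤ
  | .add, a, b => a + b
  | .sub, a, b => a - b
  | .mul, a, b => a * b

/-- The instructions of a random access machine. -/
inductive Instr where
  /-- `R_d := c` -/
  | const (d : ℕ) (c : ℤ)
  /-- `R_d := R_i op R_j` -/
  | arith (op : ArithOp) (d i j : ℕ)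
  /-- `R_d := R_{R_i}` -/
  | load (d i : ℕ)
  /-- `R_{R_i} := R_j` -/
  | store (i j : ℕ)
  /-- go to instruction `l` -/
  | jump (l : ℕ)
  /-- go to instruction `l` if `R_i < R_j` -/
  | jumpLt (i j l : ℕ)
  /-- `R_d :=` next integer of the input tape (`0` once the input is exhausted) -/
  | read (d : ℕ)
  /-- output, as one solution, the concatenation of the values of the registers of index
  `R_i, R_i + 1, ..., R_j` (the empty word if `R_j < R_i`) -/
  | output (i j : ℕ)
  /-- stop -/
  | halt

/-- A machine is given by its program, a finite sequence of instructions. -/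
abbrev Machine := List Instr

/-- A configuration of a machine. -/
structure Config where
  /-- index of the current instruction -/
  pc : ℕ
  /-- contents of the registers -/
  reg : ℕ → ℤ
  /-- number of `read` instructions executed so far -/
  pos : ℕ
  /-- largest index of a register accessed so far -/
  top : ℕ

/-- The initial configuration. -/
def Config.init : Config := ⟨0, fun _ => 0, 0, 0⟩

/-- The largest index of a register that the instruction accesses, given the register contents. -/
def Instr.maxIndex (reg : ℕ → ℤ) : Instr → ℕ
  | .const d _ => d
  | .arith _ d i j => max d (max i j)
  | .load d i => max (max d i) (reg i).toNat
  | .store i j => max (max i j) (reg i).toNat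
  | .jump _ => 0
  | .jumpLt i j _ => max i j
  | .read d => d
  | .output i j => max (max i j) (if reg i ≤ reg j then (reg j).toNat else 0)
  | .halt => 0

/-- The effect of an instruction on program counter, registers and input position; `none` means that
the machine stops. An indirect access through a negative address stops the machine. The field `top`
is updated in `step`. -/
def Instr.exec (w : List ℤ) (c : Config) : Instr → Option Config
  | .const d a => some { c with pc := c.pc + 1, reg := Function.update c.reg d a }
  | .arith op d i j =>
      some { c with
        pc := c.pc + 1
        reg := Function.update c.reg d (op.eval (c.reg i) (c.reg j)) }
  | .load d i =>
      if 0 ≤ c.reg i then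
        some { c with
          pc := c.pc + 1
          reg := Function.update c.reg d (c.reg (c.reg i).toNat) }
      else none
  | .store i j =>
      if 0 ≤ c.reg i then
        some { c with
          pc := c.pc + 1
          reg := Function.update c.reg (c.reg i).toNat (c.reg j) }
      else none
  | .jump l => some { c with pc := l }
  | .jumpLt i j l => some { c with pc := if c.reg i < c.reg j then l else c.pc + 1 }
  | .read d =>
      some { c with
        pc := c.pc + 1
        reg := Function.update c.reg d (w.getD c.pos 0)
        pos := c.pos + 1 }
  | .output i j =>
      if 0 ≤ c.reg i ∧ 0 ≤ c.reg j then some { c with pc := c.pc + 1 } else none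
  | .halt => none

/-- One step of the machine `M` on input tape `w`; `none` if the machine has stopped (by `halt`, by
leaving its program, or by a negative address). -/
def step (M : Machine) (w : List ℤ) (c : Config) : Option Config :=
  match M[c.pc]? with
  | none => none
  | some ins =>
      (ins.exec w c).map fun c' => { c' with top := max c.top (ins.maxIndex c.reg) }

/-- The configuration of `M` on input tape `w` after `t` steps (a stopped machine stays put). -/
def run (M : Machine) (w : List ℤ) : ℕ → Config
  | 0 => Config.init
  | t + 1 => (step M w (run M w t)).getD (run M w t)

/-- `M` on input tape `w` has stopped after at most `t` steps. -/
def Halted (M : Machine) (w : List ℤ) (t : ℕ) : Prop :=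
  step M w (run M w t) = none

/-- What the machine outputs in its step number `t` (steps are numbered from `0`); `none` if that
step does not execute an output instruction. -/
def outputAt (M : Machine) (w : List ℤ) (t : ℕ) : Option (List ℤ) :=
  let c := run M w t
  match M[c.pc]? with
  | some (.output i j) =>
      if 0 ≤ c.reg i ∧ 0 ≤ c.reg j then
        some ((List.range' (c.reg i).toNat ((c.reg j).toNat + 1 - (c.reg i).toNat)).map c.reg)
      else none
  | _ => none

/-- Step number `t` executes an output instruction. -/
def IsOutputStep (M : Machine) (w : List ℤ) (t : ℕ) : Prop :=
  (outputAt M w t).isSome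

/-! ## Time and space -/

/-- The size of an integer: the length of the binary notation of its absolute value, `0` having
size `1`. -/
def intSize (z : ℤ) : ℕ := max 1 z.natAbs.size

/-- The cost of an arithmetic operation or a comparison with arguments `a` and `b` on an input of
length `n`: the sum of the sizes of its arguments divided by (the size of) `n`, rounded up. -/
def arithCost (n : ℕ) (a b : ℤ) : ℕ :=
  (intSize a + intSize b) ⌈/⌉ intSize n

/-- The cost of an instruction on an input of length `n`; all the instructions other than arithmetic
operations and comparisons have unit cost. -/
def Instr.cost (n : ℕ) (reg : ℕ → ℤ) : Instr → ℕ
  | .arith _ _ i j => arithCost n (reg i) (reg j)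
  | .jumpLt i j _ => arithCost n (reg i) (reg j)
  | _ => 1

/-- The cost of step number `t` (`0` if the program has been left). -/
def stepCost (M : Machine) (w : List ℤ) (t : ℕ) : ℕ :=
  match M[(run M w t).pc]? with
  | none => 0
  | some ins => ins.cost w.length (run M w t).reg

/-- The time taken by the first `t` steps of `M` on input tape `w`. -/
def time (M : Machine) (w : List ℤ) (t : ℕ) : ℕ :=
  ∑ s ∈ Finset.range t, stepCost M w s

/-- `T_M(w, i)`: the time taken before the `i`-th output instruction is executed (`i ≥ 1`; this is
meaningful only if there are at least `i` outputs). -/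
noncomputable def outputTime (M : Machine) (w : List ℤ) (i : ℕ) : ℕ :=
  time M w (Nat.nth (IsOutputStep M w) (i - 1))

/-- The space used in a configuration: the sum of the sizes of the integers stored in the registers,
up to the register of largest index accessed so far. -/
def Config.space (c : Config) : ℕ :=
  ∑ r ∈ Finset.range (c.top + 1), intSize (c.reg r)

/-! ## Enumeration problems

The alphabet is `{0, ..., k - 1}`. On tapes and in registers, the letter `a` is represented by the
integer `a + 1` (so that `0` can mark the end of the input). -/

/-- Words over an alphabet with `k` letters. -/
abbrev Word (k : ℕ) := List (Fin k)

/-- The sequence of integers that represents a word. -/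
def code {k : ℕ} (x : Word k) : List ℤ :=
  x.map fun a => ((a : ℕ) : ℤ) + 1

/-- The sequence of integers that represents a pair of words, with `k + 1` as the separator. -/
def codePair {k : ℕ} (x y : Word k) : List ℤ :=
  code x ++ ((k : ℤ) + 1) :: code y

/-- An enumeration problem: it associates to an instance `x` the set `A x` of its solutions. -/
abbrev EnumProblem (k : ℕ) := Word k → Set (Word k)

/-- The lengths of the solutions are polynomially bounded in the length of the instance. -/
def PolyBalanced {k : ℕ} (A : EnumProblem k) : Prop :=
  ∃ q : Polynomial ℕ, ∀ x, ∀ y ∈ A x, y.length ≤ q.eval x.length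

/-- Deciding, given `x` and `y`, whether `y ∈ A x` is possible in polynomial time. A deciding machine
accepts if `R_0 > 0` when it stops. -/
def TestInP {k : ℕ} (A : EnumProblem k) : Prop :=
  ∃ (M : Machine) (p : Polynomial ℕ), ∀ x y : Word k, ∃ t,
    Halted M (codePair x y) t ∧
    time M (codePair x y) t ≤ p.eval (x.length + y.length) ∧
    (0 < (run M (codePair x y) t).reg 0 ↔ y ∈ A x)

/-- The class `EnumP`. -/
def EnumP (k : ℕ) : Set (EnumProblem k) :=
  {A | PolyBalanced A ∧ TestInP A}

/-- The machine `M` solves the enumeration problem `A`. -/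
structure Solves {k : ℕ} (M : Machine) (A : EnumProblem k) : Prop where
  /-- the outputs are exactly the solutions -/
  outputs : ∀ (x : Word k) (v : List ℤ),
    (∃ t, outputAt M (code x) t = some v) ↔ ∃ y ∈ A x, code y = v
  /-- no solution is repeated -/
  no_repetition : ∀ (x : Word k) (v : List ℤ) (s t : ℕ),
    outputAt M (code x) s = some v → outputAt M (code x) t = some v → s = t
  /-- the machine stops -/
  halts : ∀ x : Word k, ∃ t, Halted M (code x) t
  /-- there is no postprocessing: the machine stops right after its last output -/
  no_postprocessing : ∀ (x : Word k) (t : ℕ), IsOutputStep M (code x) t →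
    (∀ s, t < s → ¬ IsOutputStep M (code x) s) → Halted M (code x) (t + 1)

/-- `M` solves `A` in incremental time `O(i ^ a * n ^ b)` for some constant `b`; the length `n` is
replaced by `n + 1` because of the empty input. -/
def IsIncEnumerator {k : ℕ} (a : ℕ) (M : Machine) (A : EnumProblem k) : Prop :=
  Solves M A ∧
  ∃ C b : ℕ, ∀ (x : Word k) (i : ℕ), 1 ≤ i → i ≤ (A x).ncard →
    outputTime M (code x) i ≤ C * i ^ a * (x.length + 1) ^ b

/-- `M` solves `A` with polynomial delay: less than `p(|x|)` time is spent before the first output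
(before stopping, if there is no output) and between consecutive outputs. -/
def IsDelayPEnumerator {k : ℕ} (M : Machine) (A : EnumProblem k) : Prop :=
  Solves M A ∧
  ∃ p : Polynomial ℕ, ∀ x : Word k,
    ((A x).Nonempty → outputTime M (code x) 1 < p.eval x.length) ∧
    (A x = ∅ → ∃ t, Halted M (code x) t ∧ time M (code x) t < p.eval x.length) ∧
    ∀ i : ℕ, 1 < i → i ≤ (A x).ncard →
      outputTime M (code x) i < outputTime M (code x) (i - 1) + p.eval x.length

/-- `M` uses polynomial space on the words over an alphabet with `k` letters. -/
def UsesPolySpace (k : ℕ) (M : Machine) : Prop :=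
  ∃ q : Polynomial ℕ, ∀ (x : Word k) (t : ℕ), (run M (code x) t).space ≤ q.eval x.length

/-- The class `IncP_a^poly`. -/
def IncPPoly (k a : ℕ) : Set (EnumProblem k) :=
  {A | A ∈ EnumP k ∧ ∃ M : Machine, IsIncEnumerator a M A ∧ UsesPolySpace k M}

/-- The class `DelayP^poly`. -/
def DelayPPoly (k : ℕ) : Set (EnumProblem k) :=
  {A | A ∈ EnumP k ∧ ∃ M : Machine, IsDelayPEnumerator M A ∧ UsesPolySpace k M}

end EnumRAM

/-! A machine with delay `p` reaches its `i`-th output in time at most `i * p(n)`, so it is itself a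
witness for incremental time; this is `delayPPoly_subset`.

The converse is geometric amortization. Given `M` with incremental linear time and polynomial space,
choose `H = (n + c) ^ c` so large that the first `i * H` steps of `M` contain at least `i` outputs
(for `i` up to the number of solutions), that a configuration of `M` fits into `H` cells with values
below `2 ^ H`, and that there are at most `2 ^ (H - 1)` solutions. Cut the time axis into the zones
`[0, H)`, `[H, 2H)`, `[2H, 4H)`, ... and simulate `H` independent copies of `M`, where copy `j`
emits only the outputs of `M` that fall into zone `j`. Disjoint zones exclude repetitions. To find
the next solution, a round lets the copies move in the order `H - 1, ..., 0`, each for `2 * H` steps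
or until its zone ends; an emission ends the round.

When a copy below `j` emits, copy `j` has already had its `2 * H` steps in that round. So copy `j`
has made at least `2 * H` steps per solution emitted from lower zones, or has reached the end of its
zone. Suppose that a round fails and let `t` be the first missing output time, in zone `j + 1`.
Everything before that zone has been emitted, which is at least `2 ^ j` solutions; so copy `j + 1`
has made `2 * H * 2 ^ j` steps, has reached the end of its zone, and has passed `t`, a
contradiction. Zone `0` is exhausted by a single budget. Hence a failed round proves that nothing is
left (`Amortized.emit`, `Amortized.complete`). A round simulates at most `2 * H * H` steps, and
there are `H` copies, so delay and space are polynomial.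

Since the machine has to stop right after its last output, a solution found waits in a buffer until
the next round has succeeded or failed.

The machine is written in a small structured language. Its weakest precondition also bounds values,
addresses and loop iterations, so that `Cmd.sound` yields correctness, time and space together. The
carriers on this side are `simStep_spec` (one step of `M`), `round_spec` and `emits_amortize`. -/

namespace EnumRAM

/-! ## Silent runs -/

/-- The word output by the instruction about to be executed. -/
def outOf (M : Machine) (c : Config) : Option (List ℤ) :=
  match M[c.pc]? with
  | some (.output i j) =>
      if 0 ≤ c.reg i ∧ 0 ≤ c.reg j then
        some ((List.range' (c.reg i).toNat ((c.reg j).toNat + 1 - (c.reg i).toNat)).map c.reg)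
      else none
  | _ => none

theorem outputAt_eq (M : Machine) (w : List ℤ) (t : ℕ) :
    outputAt M w t = outOf M (run M w t) := rfl

/-- All register contents are bounded by `V` and all accessed indices by `T`. -/
def Config.Bounded (V : ℤ) (T : ℕ) (c : Config) : Prop :=
  (∀ r, |c.reg r| ≤ V) ∧ c.top ≤ T

/-- `n` steps without output between bounded configurations. -/
inductive Silent (P : Machine) (w : List ℤ) (V : ℤ) (T : ℕ) : ℕ → Config → Config → Prop
  | refl (c : Config) : Silent P w V T 0 c c
  | step {n : ℕ} {c c' c'' : Config} : c.Bounded V T → outOf P c = none →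
      EnumRAM.step P w c = some c' → Silent P w V T n c' c'' → Silent P w V T (n + 1) c c''

theorem Silent.trans {P : Machine} {w : List ℤ} {V : ℤ} {T m n : ℕ} {a b c : Config}
    (h₁ : Silent P w V T m a b) (h₂ : Silent P w V T n b c) : Silent P w V T (m + n) a c := by
  induction h₁ with
  | refl => simpa using h₂
  | @step k _ _ _ hb ho hs _ ih =>
    have := Silent.step hb ho hs (ih h₂)
    rwa [show k + 1 + n = k + n + 1 by omega]

/-! ## A structured language -/

/-- Structured programs without output. -/
inductive Cmd where
  | skip
  | const (d : ℕ) (a : ℤ)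
  | arith (op : ArithOp) (d i j : ℕ)
  | load (d i : ℕ)
  | store (i j : ℕ)
  | read (d : ℕ)
  | seq (a b : Cmd)
  /-- if `R_i < R_j` then `a` else `b` -/
  | ite (i j : ℕ) (a b : Cmd)
  /-- while `R_i < R_j` do `a` -/
  | loop (i j : ℕ) (a : Cmd)

infixr:60 " ;; " => Cmd.seq

namespace Cmd

/-- The number of instructions of the compiled program. -/
def size : Cmd → ℕ
  | skip => 0
  | seq a b => a.size + b.size
  | ite _ _ a b => b.size + a.size + 2
  | loop _ _ a => a.size + 3
  | _ => 1

/-- The machine code of a structured program placed at position `o`. -/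
def compile : Cmd → ℕ → List Instr
  | skip, _ => []
  | const d a, _ => [.const d a]
  | arith op d i j, _ => [.arith op d i j]
  | load d i, _ => [.load d i]
  | store i j, _ => [.store i j]
  | read d, _ => [.read d]
  | seq a b, o => a.compile o ++ b.compile (o + a.size)
  | ite i j a b, o =>
      .jumpLt i j (o + b.size + 2) ::
        (b.compile (o + 1) ++ .jump (o + b.size + a.size + 2) :: a.compile (o + b.size + 2))
  | loop i j a, o =>
      .jumpLt i j (o + 2) :: .jump (o + a.size + 3) :: (a.compile (o + 2) ++ [.jump o])

theorem length_compile (c : Cmd) (o : ℕ) : (c.compile o).length = c.size := by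
  induction c generalizing o <;> simp_all [compile, size]; omega

/-- All directly addressed registers have index less than `K`. -/
def VarsLt (K : ℕ) : Cmd → Prop
  | skip => True
  | const d _ => d < K
  | arith _ d i j => d < K ∧ i < K ∧ j < K
  | load d i => d < K ∧ i < K
  | store i j => i < K ∧ j < K
  | read d => d < K
  | seq a b => a.VarsLt K ∧ b.VarsLt K
  | ite i j a b => i < K ∧ j < K ∧ a.VarsLt K ∧ b.VarsLt K
  | loop i j a => i < K ∧ j < K ∧ a.VarsLt K

/-- A bound on the number of steps, as a polynomial in the maximal number of iterations of a
loop. -/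
noncomputable def timeBound : Cmd → Polynomial ℕ
  | skip => 0
  | seq a b => a.timeBound + b.timeBound
  | ite _ _ a b => a.timeBound + b.timeBound + 2
  | loop _ _ a => (Polynomial.X + 1) * (a.timeBound + 2)
  | _ => 1

end Cmd

/-- Registers and input position. -/
@[ext]
structure St where
  /-- contents of the registers -/
  reg : ℕ → ℤ
  /-- number of letters read -/
  pos : ℕ

/-- Assign a value to a register. -/
def St.set (s : St) (d : ℕ) (a : ℤ) : St := ⟨Function.update s.reg d a, s.pos⟩

theorem St.set_reg (s : St) (d : ℕ) (a : ℤ) (r : ℕ) :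
    (s.set d a).reg r = if r = d then a else s.reg r := by
  simp [St.set, Function.update_apply]

@[simp] theorem St.set_pos (s : St) (d : ℕ) (a : ℤ) : (s.set d a).pos = s.pos := rfl

@[simp] theorem St.set_set (s : St) (d : ℕ) (a b : ℤ) : (s.set d a).set d b = s.set d b := by
  simp [St.set]

/-- The state of a configuration. -/
def Config.st (c : Config) : St := ⟨c.reg, c.pos⟩

/-- The weakest precondition of a loop with at most the given number of iterations. -/
def iterWp (W : (St → Prop) → St → Prop) (i j : ℕ) (Q : St → Prop) : ℕ → St → Prop
  | 0, s => ¬ s.reg i < s.reg j ∧ Q s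
  | n + 1, s => (s.reg i < s.reg j → W (iterWp W i j Q n) s) ∧ (¬ s.reg i < s.reg j → Q s)

/-- The weakest precondition on input tape `w`, where moreover the values computed are at most `V`
in absolute value, indirect accesses have index at most `T`, and each loop has at most `L`
iterations. -/
def Cmd.wp (w : List ℤ) (V : ℤ) (T L : ℕ) : Cmd → (St → Prop) → St → Prop
  | .skip, Q, s => Q s
  | .const d a, Q, s => |a| ≤ V ∧ Q (s.set d a)
  | .arith op d i j, Q, s =>
      |op.eval (s.reg i) (s.reg j)| ≤ V ∧ Q (s.set d (op.eval (s.reg i) (s.reg j)))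
  | .load d i, Q, s => ∃ a : ℕ, s.reg i = a ∧ a ≤ T ∧ Q (s.set d (s.reg a))
  | .store i j, Q, s => ∃ a : ℕ, s.reg i = a ∧ a ≤ T ∧ Q (s.set a (s.reg j))
  | .read d, Q, s =>
      |w.getD s.pos 0| ≤ V ∧ Q ⟨Function.update s.reg d (w.getD s.pos 0), s.pos + 1⟩
  | .seq a b, Q, s => a.wp w V T L (b.wp w V T L Q) s
  | .ite i j a b, Q, s =>
      (s.reg i < s.reg j → a.wp w V T L Q s) ∧ (¬ s.reg i < s.reg j → b.wp w V T L Q s)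
  | .loop i j a, Q, s => iterWp (a.wp w V T L) i j Q L s

/-! ### Monotonicity and the invariant rule for loops -/

section Rules

variable {w : List ℤ} {V : ℤ} {T L : ℕ}

theorem Cmd.wp_mono (c : Cmd) {Q Q' : St → Prop} (h : ∀ s, Q s → Q' s) :
    ∀ s, c.wp w V T L Q s → c.wp w V T L Q' s := by
  induction c generalizing Q Q' with
  | skip => exact h
  | const d a => exact fun s hs => ⟨hs.1, h _ hs.2⟩
  | arith op d i j => exact fun s hs => ⟨hs.1, h _ hs.2⟩
  | load d i => exact fun s ⟨a, h1, h2, h3⟩ => ⟨a, h1, h2, h _ h3⟩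
  | store d i => exact fun s ⟨a, h1, h2, h3⟩ => ⟨a, h1, h2, h _ h3⟩
  | read d => exact fun s hs => ⟨hs.1, h _ hs.2⟩
  | seq a b iha ihb => exact iha (ihb h)
  | ite i j a b iha ihb => exact fun s hs => ⟨fun q => iha h s (hs.1 q), fun q => ihb h s (hs.2 q)⟩
  | loop i j a iha =>
    -- The number of iterations left must vary in the induction, whereas the `L` inside the
    -- precondition of the body, which limits nested loops, stays fixed.
    suffices hn : ∀ n s, iterWp (a.wp w V T L) i j Q n s → iterWp (a.wp w V T L) i j Q' n s from
      hn L
    intro n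
    induction n with
    | zero => exact fun s hs => ⟨hs.1, h _ hs.2⟩
    | succ n ih =>
      exact fun s hs => ⟨fun q => iha ih s (hs.1 q), fun q => h _ (hs.2 q)⟩

/-- The rule for loops, with an invariant indexed by a bound on the number of iterations left. -/
theorem Cmd.wp_loop {i j : ℕ} {a : Cmd} {Q : St → Prop} (I : ℕ → St → Prop)
    (hI : ∀ m s, I m s → (s.reg i < s.reg j → ∃ m' < m, a.wp w V T L (I m') s) ∧
      (¬ s.reg i < s.reg j → Q s))
    {m : ℕ} (hm : m ≤ L) {s : St} (hs : I m s) : (Cmd.loop i j a).wp w V T L Q s := by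
  -- The invariant counts the iterations needed, `iterWp` those allowed; only `m ≤ l` is kept.
  suffices h : ∀ l m s, I m s → m ≤ l → iterWp (a.wp w V T L) i j Q l s from h L m s hs hm
  intro l
  induction l with
  | zero =>
    intro m s hs hm
    have hlt : ¬ s.reg i < s.reg j := fun hlt => by
      obtain ⟨m', hm', -⟩ := (hI m s hs).1 hlt
      omega
    exact ⟨hlt, (hI m s hs).2 hlt⟩
  | succ l ih =>
    intro m s hs hm
    refine ⟨fun hlt => ?_, (hI m s hs).2⟩
    obtain ⟨m', hm', hw⟩ := (hI m s hs).1 hlt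
    exact a.wp_mono (fun s hs => ih m' s hs (by omega)) s hw

end Rules

/-! ## Correctness of the compilation -/

/-- The program `P` contains the code `l` at position `o`. -/
def CodeAt (P : Machine) (o : ℕ) (l : List Instr) : Prop :=
  ∃ p q, P = p ++ l ++ q ∧ p.length = o

theorem CodeAt.left {P : Machine} {o : ℕ} {a b : List Instr} (h : CodeAt P o (a ++ b)) :
    CodeAt P o a := by
  obtain ⟨p, q, rfl, rfl⟩ := h
  exact ⟨p, b ++ q, by simp, rfl⟩

theorem CodeAt.right {P : Machine} {o : ℕ} {a b : List Instr} (h : CodeAt P o (a ++ b)) :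
    CodeAt P (o + a.length) b := by
  obtain ⟨p, q, rfl, rfl⟩ := h
  exact ⟨p ++ a, q, by simp, by simp⟩

theorem CodeAt.tail {P : Machine} {o : ℕ} {a : Instr} {b : List Instr} (h : CodeAt P o (a :: b)) :
    CodeAt P (o + 1) b :=
  CodeAt.right (a := [a]) h

theorem CodeAt.head {P : Machine} {o : ℕ} {a : Instr} {b : List Instr} (h : CodeAt P o (a :: b)) :
    P[o]? = some a := by
  obtain ⟨p, q, rfl, rfl⟩ := h
  simp

theorem Silent.single {P : Machine} {w : List ℤ} {V : ℤ} {T : ℕ} {c c' : Config} {i : Instr}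
    (hc : c.Bounded V T) (hi : P[c.pc]? = some i) (ho : ∀ a b, i ≠ .output a b)
    (he : i.exec w c = some c') :
    Silent P w V T 1 c { c' with top := max c.top (i.maxIndex c.reg) } := by
  refine .step hc ?_ ?_ (.refl _)
  · unfold outOf
    rw [hi]
    cases i <;> first | rfl | exact absurd rfl (ho _ _)
  · simp [EnumRAM.step, hi, he]

theorem Config.Bounded.update {V : ℤ} {T : ℕ} {c : Config} (hc : c.Bounded V T) {d : ℕ} {a : ℤ}
    (ha : |a| ≤ V) (pc pos : ℕ) {top : ℕ} (ht : top ≤ T) :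
    (Config.mk pc (Function.update c.reg d a) pos (max c.top top)).Bounded V T := by
  refine ⟨fun r => ?_, max_le hc.2 ht⟩
  change |Function.update c.reg d a r| ≤ V
  rw [Function.update_apply]
  split
  · exact ha
  · exact hc.1 r

theorem Config.Bounded.goto {V : ℤ} {T : ℕ} {c : Config} (hc : c.Bounded V T)
    (pc pos : ℕ) {top : ℕ} (ht : top ≤ T) :
    (Config.mk pc c.reg pos (max c.top top)).Bounded V T :=
  ⟨hc.1, max_le hc.2 ht⟩

/-- A compiled program does what its weakest precondition promises. -/
theorem Cmd.sound {P : Machine} {w : List ℤ} {V : ℤ} {T L K : ℕ} (hK : K ≤ T + 1) (a : Cmd) :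
    ∀ (o : ℕ) (Q : St → Prop) (c : Config), a.VarsLt K → CodeAt P o (a.compile o) →
      c.Bounded V T → c.pc = o → a.wp w V T L Q c.st →
      ∃ n ≤ a.timeBound.eval L, ∃ c', Silent P w V T n c c' ∧ c'.pc = o + a.size ∧
        c'.Bounded V T ∧ Q c'.st := by
  induction a with
  | skip => exact fun o Q c _ _ hb hpc hw => ⟨0, by simp, c, .refl c, by simp [hpc, size], hb, hw⟩
  | const d a =>
    intro o Q c hv hc hb hpc hw
    simp only [VarsLt] at hv
    have h1 := Silent.single (w := w) hb (hpc ▸ hc.head) (by simp) rfl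
    exact ⟨1, by simp [timeBound], _, h1, by simp [hpc, size],
      hb.update hw.1 _ _ (by simp [Instr.maxIndex]; omega), hw.2⟩
  | arith op d i j =>
    intro o Q c hv hc hb hpc hw
    simp only [VarsLt] at hv
    have h1 := Silent.single (w := w) hb (hpc ▸ hc.head) (by simp) rfl
    exact ⟨1, by simp [timeBound], _, h1, by simp [hpc, size],
      hb.update hw.1 _ _ (by simp [Instr.maxIndex]; omega), hw.2⟩
  | load d i =>
    intro o Q c hv hc hb hpc ⟨a, h1, h2, h3⟩
    simp only [VarsLt] at hv
    simp only [Config.st] at h1 h3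
    have he : (Instr.load d i).exec w c =
        some { c with pc := c.pc + 1, reg := Function.update c.reg d (c.reg a) } := by
      simp [Instr.exec, h1]
    refine ⟨1, by simp [timeBound], _, .single hb (hpc ▸ hc.head) (by simp) he, by simp [hpc, size],
      hb.update (hb.1 a) _ _ ?_, h3⟩
    simp [Instr.maxIndex, h1]; omega
  | store i j =>
    intro o Q c hv hc hb hpc ⟨a, h1, h2, h3⟩
    simp only [VarsLt] at hv
    simp only [Config.st] at h1 h3
    have he : (Instr.store i j).exec w c =
        some { c with pc := c.pc + 1, reg := Function.update c.reg a (c.reg j) } := by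
      simp [Instr.exec, h1]
    refine ⟨1, by simp [timeBound], _, .single hb (hpc ▸ hc.head) (by simp) he, by simp [hpc, size],
      hb.update (hb.1 j) _ _ ?_, h3⟩
    simp [Instr.maxIndex, h1]; omega
  | read d =>
    intro o Q c hv hc hb hpc hw
    simp only [VarsLt] at hv
    have h1 := Silent.single (w := w) hb (hpc ▸ hc.head) (by simp) rfl
    exact ⟨1, by simp [timeBound], _, h1, by simp [hpc, size],
      hb.update hw.1 _ _ (by simp [Instr.maxIndex]; omega), hw.2⟩
  | seq a b iha ihb =>
    intro o Q c hv hc hb hpc hw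
    obtain ⟨n, hn, c1, hs, hpc1, hb1, hw1⟩ := iha o _ c hv.1 hc.left hb hpc hw
    have hcb := hc.right
    rw [length_compile] at hcb
    obtain ⟨m, hm, c2, hs2, hpc2, hb2, hw2⟩ := ihb _ Q c1 hv.2 hcb hb1 hpc1 hw1
    refine ⟨n + m, ?_, c2, hs.trans hs2, ?_, hb2, hw2⟩
    · simp only [timeBound, Polynomial.eval_add]; omega
    · simp only [size]; omega
  | ite i j a b iha ihb =>
    intro o Q c hv hc hb hpc hw
    simp only [VarsLt] at hv
    have hmax : (Instr.jumpLt i j (o + b.size + 2)).maxIndex c.reg ≤ T := by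
      simp [Instr.maxIndex]; omega
    have h1 := Silent.single (w := w) hb (hpc ▸ hc.head) (by simp) rfl
    have hcb := hc.tail.left
    have hcj := hc.tail.right
    rw [length_compile] at hcj
    have hca := hcj.tail
    rw [show o + 1 + b.size + 1 = o + b.size + 2 by omega] at hca
    rw [hpc] at h1
    by_cases hlt : c.reg i < c.reg j
    · simp only [hlt, if_true] at h1
      obtain ⟨n, hn, c1, hs, hpc1, hb1, hw1⟩ := iha _ Q _ hv.2.2.1 hca
        (hb.goto (o + b.size + 2) c.pos hmax) rfl (hw.1 hlt)
      refine ⟨1 + n, ?_, c1, h1.trans hs, ?_, hb1, hw1⟩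
      · simp [timeBound]; omega
      · simp only [size]; omega
    · simp only [hlt, if_false] at h1
      obtain ⟨n, hn, c1, hs, hpc1, hb1, hw1⟩ := ihb _ Q _ hv.2.2.2 hcb
        (hb.goto (o + 1) c.pos hmax) rfl (hw.2 hlt)
      have h2 := Silent.single (w := w) hb1 (hpc1 ▸ hcj.head) (by simp) rfl
      refine ⟨1 + n + 1, ?_, _, (h1.trans hs).trans h2, ?_, hb1.goto _ _ (by simp [Instr.maxIndex]),
        hw1⟩
      · simp [timeBound]; omega
      · simp only [size]; omega
  | loop i j a iha =>
    intro o Q c hv hc hb hpc hw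
    simp only [VarsLt] at hv
    simp only [wp] at hw
    -- The iterations left, `k`, are separated from `L`, which still governs the loops inside the
    -- body.
    obtain ⟨k, hk, hw'⟩ : ∃ k ≤ L, iterWp (a.wp w V T L) i j Q k c.st := ⟨L, le_rfl, hw⟩
    clear hw
    rename' hw' => hw
    -- An iteration costs the body plus two jumps (the test and the way back); leaving the loop
    -- costs two jumps, which the extra `1` in `k + 1` pays for.
    suffices h : ∃ n ≤ (k + 1) * (a.timeBound.eval L + 2), ∃ c', Silent P w V T n c c' ∧
        c'.pc = o + (a.size + 3) ∧ c'.Bounded V T ∧ Q c'.st by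
      obtain ⟨n, hn, h⟩ := h
      refine ⟨n, hn.trans ?_, h⟩
      simp only [timeBound, Polynomial.eval_mul, Polynomial.eval_add, Polynomial.eval_X,
        Polynomial.eval_one, Polynomial.eval_ofNat]
      gcongr
    clear hk
    have hmax : max i j ≤ T := by simp; omega
    have hexit : ∀ c : Config, c.Bounded V T → c.pc = o → ¬ c.reg i < c.reg j → Q c.st →
        ∃ c', Silent P w V T (1 + 1) c c' ∧ c'.pc = o + (a.size + 3) ∧ c'.Bounded V T ∧
          Q c'.st := by
      intro c hb hpc hlt hQ
      have h1 := Silent.single (w := w) hb (hpc ▸ hc.head) (by simp) rfl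
      simp only [hlt, if_false] at h1
      rw [hpc] at h1
      have hb1 := hb.goto (o + 1) c.pos hmax
      have h2 := Silent.single (w := w) hb1 (hc.tail.head) (by simp) rfl
      exact ⟨_, h1.trans h2, by simp; omega, hb1.goto _ _ (by simp [Instr.maxIndex]), hQ⟩
    induction k generalizing c with
    | zero =>
      obtain ⟨c', h⟩ := hexit c hb hpc hw.1 hw.2
      exact ⟨1 + 1, by omega, c', h⟩
    | succ k ih =>
      by_cases hlt : c.reg i < c.reg j
      · have h1 := Silent.single (w := w) hb (hpc ▸ hc.head) (by simp) rfl
        simp only [hlt, if_true] at h1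
        rw [hpc] at h1
        have hb1 := hb.goto (o + 2) c.pos hmax
        have hcj := hc.tail.tail.right
        rw [length_compile] at hcj
        obtain ⟨n, hn, c1, hs, hpc1, hb2, hw1⟩ :=
          iha _ _ _ hv.2.2 hc.tail.tail.left hb1 rfl (hw.1 hlt)
        have h2 := Silent.single (w := w) hb2 (hpc1 ▸ hcj.head) (by simp) rfl
        have hb3 := hb2.goto o c1.pos (top := 0) (by simp)
        obtain ⟨m, hm, c2, hs2, hpc2, hb4, hw2⟩ := ih _ hb3 rfl hw1
        refine ⟨1 + n + 1 + m, ?_, c2, ((h1.trans hs).trans h2).trans hs2, hpc2, hb4, hw2⟩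
        rw [add_mul (k + 1)]
        omega
      · obtain ⟨c', h⟩ := hexit c hb hpc hlt (hw.2 hlt)
        refine ⟨1 + 1, ?_, c', h⟩
        rw [add_mul (k + 1)]
        omega

/-! ## Geometric amortization

The time steps `0, 1, ...` are divided into zones `[zoneLo H j, zoneHi H j)` of geometrically growing
lengths. Process `j` walks through the time steps, and emits those in its zone that satisfy `p`. -/

/-- The end of zone `j`. -/
def zoneHi (H j : ℕ) : ℕ := 2 ^ j * H

/-- The beginning of zone `j`. -/
def zoneLo (H : ℕ) : ℕ → ℕ
  | 0 => 0
  | j + 1 => zoneHi H j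

theorem zoneHi_mono (H : ℕ) {i j : ℕ} (h : i ≤ j) : zoneHi H i ≤ zoneHi H j :=
  Nat.mul_le_mul_right _ (Nat.pow_le_pow_right (by norm_num) h)

theorem zoneHi_le_zoneLo (H : ℕ) {i j : ℕ} (h : i < j) : zoneHi H i ≤ zoneLo H j := by
  obtain ⟨j, rfl⟩ : ∃ k, j = k + 1 := ⟨j - 1, by omega⟩
  exact zoneHi_mono H (by omega)

theorem exists_zone (H t N : ℕ) (h : t < zoneLo H N) : ∃ j < N, zoneLo H j ≤ t ∧ t < zoneHi H j := by
  induction N with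
  | zero => simp [zoneLo] at h
  | succ N ih =>
    by_cases h' : t < zoneLo H N
    · obtain ⟨j, hj, h⟩ := ih h'
      exact ⟨j, by omega, h⟩
    · exact ⟨N, by omega, by omega, h⟩

/-- What process `j` has gained in the current round, when the process to move is number `J - 1`,
with `b` steps left. -/
def gain (H J b j : ℕ) : ℕ := if J ≤ j then 2 * H else if J = j + 1 then 2 * H - b else 0

/-- The invariant of geometric amortization: process `j` has made `cnt j` steps, the time steps in
`es` have been emitted, and the process to move is number `J - 1`, with `b` steps left. -/
structure Amortized (H : ℕ) (p : ℕ → Prop) (cnt : ℕ → ℕ) (J b : ℕ) (es : List ℕ) : Prop where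
  nodup : es.Nodup
  mem_iff : ∀ t, t ∈ es ↔ p t ∧ ∃ j < H, zoneLo H j ≤ t ∧ t < cnt j
  cnt_le : ∀ j < H, cnt j ≤ zoneHi H j
  le_cnt : ∀ j < H,
    min (zoneHi H j) (2 * H * es.countP (· < zoneLo H j) + gain H J b j) ≤ cnt j
  b_le : b ≤ 2 * H
  J_le : J ≤ H

namespace Amortized

variable {H : ℕ} {p : ℕ → Prop} {cnt : ℕ → ℕ} {J b j : ℕ} {es : List ℕ}

theorem init (H : ℕ) (p : ℕ → Prop) : Amortized H p (fun _ => 0) H (2 * H) [] where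
  nodup := List.nodup_nil
  mem_iff := by simp
  cnt_le := by simp
  le_cnt j hj := by simp [gain, hj.not_ge]
  b_le := le_rfl
  J_le := le_rfl

/-- A process gives up its turn either with its budget used up, and then its gain is the full `2 *
H`, or at the end of its zone, where the minimum in `le_cnt` asks for nothing more. -/
theorem next (h : Amortized H p cnt (j + 1) b es) (hb : b = 0 ∨ zoneHi H j ≤ cnt j) :
    Amortized H p cnt j (2 * H) es where
  nodup := h.nodup
  mem_iff := h.mem_iff
  cnt_le := h.cnt_le
  le_cnt i hi := by
    have h1 := h.le_cnt i hi
    by_cases hij : i = j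
    · subst hij
      rcases hb with rfl | hb
      · simpa [gain] using h1
      · exact (min_le_left _ _).trans hb
    · refine le_trans ?_ h1
      gcongr
      unfold gain
      split_ifs <;> omega
  b_le := le_rfl
  J_le := by have := h.J_le; omega

/-- A silent step, or an output outside the zone of the process, leaves the set of emitted times
alone and turns one unit of budget into one step. -/
theorem advance (h : Amortized H p cnt (j + 1) b es) (hlt : cnt j < zoneHi H j)
    (hp : ¬ (p (cnt j) ∧ zoneLo H j ≤ cnt j)) :
    Amortized H p (Function.update cnt j (cnt j + 1)) (j + 1) (b - 1) es where
  nodup := h.nodup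
  mem_iff t := by
    rw [h.mem_iff]
    refine and_congr_right fun ht => exists_congr fun i => and_congr_right fun _ => ?_
    rw [Function.update_apply]
    split_ifs with hij
    · subst hij
      refine and_congr_right fun hlo => ⟨fun h => by omega, fun h => ?_⟩
      by_contra hc
      have : t = cnt i := by omega
      subst this
      exact hp ⟨ht, hlo⟩
    · rfl
  cnt_le i hi := by
    rw [Function.update_apply]
    split_ifs with hij
    · subst hij; exact hlt
    · exact h.cnt_le i hi
  le_cnt i hi := by
    have h1 := h.le_cnt i hi
    have h2 := h.b_le
    rw [Function.update_apply]
    split_ifs with hij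
    · subst hij
      simp only [gain] at h1 ⊢
      rw [min_le_iff] at h1 ⊢
      simp only [show ¬ i + 1 ≤ i by omega, if_false, if_true] at h1 ⊢
      omega
    · refine le_trans ?_ h1
      gcongr
      unfold gain
      split_ifs <;> omega
  b_le := by have := h.b_le; omega
  J_le := h.J_le

/-- The core of the amortization. The emitted time lies below the zones of all processes above `j`,
so their gain `2 * H` of this round is absorbed by the count of emitted times, which grows by one
for them. For process `j` and those below the count is unchanged, and a new round may start with
gain zero. -/
theorem emit (h : Amortized H p cnt (j + 1) b es) (hlt : cnt j < zoneHi H j)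
    (hp : p (cnt j)) (hlo : zoneLo H j ≤ cnt j) :
    Amortized H p (Function.update cnt j (cnt j + 1)) H (2 * H) (cnt j :: es) where
  nodup := by
    refine List.nodup_cons.2 ⟨fun hmem => ?_, h.nodup⟩
    obtain ⟨-, i, hi, h1, h2⟩ := (h.mem_iff _).1 hmem
    -- Had the time been emitted before by another process, it would lie in two zones; process `j`
    -- itself has not yet passed it.
    rcases lt_trichotomy i j with hij | rfl | hij
    · have := h.cnt_le i hi
      have := zoneHi_le_zoneLo H hij
      omega
    · omega
    · have := zoneHi_le_zoneLo H hij
      omega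
  mem_iff t := by
    have hj : j < H := h.J_le
    rw [List.mem_cons, h.mem_iff]
    constructor
    · rintro (rfl | ⟨ht, i, hi, h1, h2⟩)
      · exact ⟨hp, j, hj, hlo, by simp⟩
      · refine ⟨ht, i, hi, h1, ?_⟩
        rw [Function.update_apply]
        split_ifs with hij
        · subst hij; omega
        · exact h2
    · rintro ⟨ht, i, hi, h1, h2⟩
      rw [Function.update_apply] at h2
      split_ifs at h2 with hij
      · subst hij
        by_cases htc : t = cnt i
        · exact .inl htc
        · exact .inr ⟨ht, i, hi, h1, by omega⟩
      · exact .inr ⟨ht, i, hi, h1, h2⟩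
  cnt_le i hi := by
    rw [Function.update_apply]
    split_ifs with hij
    · subst hij; exact hlt
    · exact h.cnt_le i hi
  le_cnt i hi := by
    have h1 := h.le_cnt i hi
    have h2 : gain H H (2 * H) i = 0 := by unfold gain; split_ifs <;> omega
    rw [Function.update_apply, h2, List.countP_cons]
    rcases lt_trichotomy i j with hij | rfl | hij
    · have h3 := zoneHi_le_zoneLo H hij
      have h4 : ¬ cnt j < zoneLo H i := by
        have : zoneLo H i ≤ zoneHi H i := by
          cases i with
          | zero => simp [zoneLo]
          | succ i => exact zoneHi_mono H (by omega)
        omega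
      simp only [hij.ne, if_false, h4, decide_false]
      refine le_trans ?_ h1
      gcongr
      · simp
      · omega
    · simp only [hlo.not_gt, decide_false, if_true]
      have := min_le_iff.1 h1
      rw [min_le_iff]
      simp only [Bool.false_eq_true, if_false, add_zero]
      omega
    -- Processes above `j`: their gain becomes one more term `2 * H` of the count.
    · have h3 := zoneHi_le_zoneLo H hij
      have h4 : cnt j < zoneLo H i := by omega
      have h5 : gain H (j + 1) b i = 2 * H := by unfold gain; split_ifs <;> omega
      simp only [hij.ne', if_false, h4, decide_true, if_true]
      rw [h5] at h1
      rw [mul_add]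
      simpa using h1
  b_le := le_rfl
  J_le := le_rfl

/-- If the first `i * H` time steps contain `i` of the `m` solutions, for all `i ≤ m`, then a round
without emission occurs only when everything has been emitted. -/
theorem complete [DecidablePred p] {m : ℕ} (h : Amortized H p cnt 0 b es)
    (hm : ∀ i ≤ m, i ≤ Nat.count p (i * H)) (hlast : ∀ t, p t → Nat.count p t < m)
    (hH : m ≤ 2 ^ (H - 1)) : ∀ t, p t → t ∈ es := by
  intro t
  induction t using Nat.strong_induction_on with
  | _ t ih =>
  intro ht
  by_contra hes
  -- With `H = 0` the first `1 * H` steps could not contain a solution.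
  have hHpos : 0 < H := by
    have h1 := hm 1 (by have := hlast t ht; omega)
    by_contra h0
    simp [show H = 0 by omega] at h1
  have htm : t < m * H := by
    by_contra hle
    have := Nat.count_monotone p (not_lt.1 hle)
    have := hm m le_rfl
    have := hlast t ht
    omega
  -- All solutions occur before `m * H`, which the `H` zones cover because `m ≤ 2 ^ (H - 1)`.
  obtain ⟨j, hj, h1, h2⟩ := exists_zone H t H (by
    obtain ⟨k, hk⟩ : ∃ k, H = k + 1 := ⟨H - 1, by omega⟩
    calc t < m * H := htm
      _ ≤ 2 ^ (H - 1) * H := Nat.mul_le_mul_right _ hH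
      _ = zoneLo H H := by conv_rhs => rw [hk, zoneLo, zoneHi, ← hk, show k = H - 1 by omega])
  have hct : cnt j ≤ t := by
    by_contra hc
    exact hes ((h.mem_iff t).2 ⟨ht, j, hj, h1, by omega⟩)
  have hle := h.le_cnt j hj
  have hg : gain H 0 b j = 2 * H := by simp [gain]
  rw [hg] at hle
  rcases j with _ | j
  · simp only [zoneHi, min_le_iff] at hle h2
    rcases hle with hle | hle
    · omega
    · have : 2 * H ≤ cnt 0 := le_trans (Nat.le_add_left _ _) hle
      omega
  · simp only [zoneLo] at h1 hle
    -- By minimality of `t`, every solution before its zone has been emitted.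
    have hcount : Nat.count p (zoneHi H j) ≤ es.countP (· < zoneHi H j) := by
      rw [Nat.count_eq_card_filter_range, List.countP_eq_length_filter,
        ← List.toFinset_card_of_nodup (h.nodup.filter _)]
      refine Finset.card_le_card fun s hs => ?_
      simp only [Finset.mem_filter, Finset.mem_range] at hs
      simp only [List.mem_toFinset, List.mem_filter, decide_eq_true_eq]
      exact ⟨ih s (by omega) hs.2, hs.1⟩
    have hlt := hlast t ht
    have hmono := Nat.count_monotone p h1
    -- If `2 ^ j` exceeds `m`, all `m` solutions lie before `m * H ≤ 2 ^ j * H`, and then `t` would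
    -- be one too many.
    have hpow : 2 ^ j ≤ Nat.count p (zoneHi H j) := by
      by_cases hjm : 2 ^ j ≤ m
      · exact hm _ hjm
      · have h3 := hm m le_rfl
        have h4 : m * H ≤ zoneHi H j := Nat.mul_le_mul_right _ (by omega)
        have := Nat.count_monotone p h4
        omega
    -- This fixes the budget: `2 ^ j` emissions at `2 * H` steps each lead exactly to the end of
    -- zone `j + 1`.
    have hbig : zoneHi H (j + 1) ≤ 2 * H * es.countP (· < zoneHi H j) :=
      calc zoneHi H (j + 1) = 2 * H * 2 ^ j := by rw [zoneHi]; ring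
        _ ≤ _ := Nat.mul_le_mul_left _ (hpow.trans hcount)
    rcases min_le_iff.1 hle with hle | hle
    · omega
    · have := hbig.trans ((Nat.le_add_right _ _).trans hle)
      omega

end Amortized

/-! ## Basic facts on runs -/

section Run

variable {M : Machine} {w : List ℤ}

theorem run_succ_of_some {t : ℕ} {c : Config} (h : step M w (run M w t) = some c) :
    run M w (t + 1) = c := by
  simp [run, h]

theorem run_add_of_none {t : ℕ} (h : step M w (run M w t) = none) (k : ℕ) :
    run M w (t + k) = run M w t := by
  induction k with
  | zero => rfl
  | succ k ih => rw [← add_assoc, run, ih, h]; rfl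

theorem isSome_outOf {c : Config} (h : (outOf M c).isSome) :
    ∃ i j, M[c.pc]? = some (.output i j) ∧ 0 ≤ c.reg i ∧ 0 ≤ c.reg j := by
  unfold outOf at h
  split at h
  · rename_i i j hij
    split at h
    · exact ⟨i, j, hij, by assumption⟩
    · simp at h
  · simp at h

theorem step_isSome_of_outOf {c : Config} (h : (outOf M c).isSome) : (step M w c).isSome := by
  obtain ⟨i, j, h1, h2, h3⟩ := isSome_outOf h
  simp [step, h1, Instr.exec, h2, h3]

theorem exec_reg_eq {ins : Instr} {c c' : Config} (h : ins.exec w c = some c') {r : ℕ}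
    (hr : ins.maxIndex c.reg < r) : c'.reg r = c.reg r := by
  cases ins <;> simp only [Instr.exec, Instr.maxIndex] at h hr <;> (try split_ifs at h) <;>
    simp only [Option.some.injEq, reduceCtorEq] at h <;> subst h <;>
    simp only [Function.update_apply] <;> first | rfl | (rw [if_neg]; omega)

theorem exec_pos_le {ins : Instr} {c c' : Config} (h : ins.exec w c = some c') :
    c'.pos ≤ c.pos + 1 := by
  cases ins <;> simp only [Instr.exec] at h <;> (try split_ifs at h) <;>
    simp only [Option.some.injEq, reduceCtorEq] at h <;> subst h <;> simp

theorem exec_of_step {c c' : Config} (h : step M w c = some c') :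
    ∃ ins c₁, M[c.pc]? = some ins ∧ ins.exec w c = some c₁ ∧
      c' = { c₁ with top := max c.top (ins.maxIndex c.reg) } := by
  unfold step at h
  split at h
  · simp at h
  · rename_i ins hins
    obtain ⟨c₁, h1, h2⟩ := Option.map_eq_some_iff.1 h
    exact ⟨ins, c₁, hins, h1, h2.symm⟩

/-- Space counts only registers up to `top`; the others must be known to be untouched before a space
bound can limit all register contents. -/
theorem reg_eq_zero (M : Machine) (w : List ℤ) (t : ℕ) {r : ℕ} (hr : (run M w t).top < r) :
    (run M w t).reg r = 0 := by
  induction t with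
  | zero => rfl
  | succ t ih =>
    rcases h : step M w (run M w t) with _ | c
    · rw [run_add_of_none h 1] at hr ⊢
      exact ih hr
    · rw [run_succ_of_some h] at hr ⊢
      obtain ⟨ins, c₁, -, h2, rfl⟩ := exec_of_step h
      simp only [max_lt_iff] at hr
      rw [← ih hr.1]
      exact exec_reg_eq h2 hr.2

/-- The input position may run past the end of the tape and is not part of the space; the number of
steps is what keeps its simulated counter small. -/
theorem pos_le (M : Machine) (w : List ℤ) (t : ℕ) : (run M w t).pos ≤ t := by
  induction t with
  | zero => exact le_rfl
  | succ t ih =>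
    rcases h : step M w (run M w t) with _ | c
    · rw [run_add_of_none h 1]; omega
    · rw [run_succ_of_some h]
      obtain ⟨ins, c₁, -, h2, rfl⟩ := exec_of_step h
      have := exec_pos_le h2
      simp only
      omega

/-! ### Sizes of integers and costs of instructions -/

theorem one_le_intSize (z : ℤ) : 1 ≤ intSize z := le_max_left _ _

theorem abs_lt_two_pow_intSize (z : ℤ) : |z| < 2 ^ intSize z := by
  have h1 : z.natAbs < 2 ^ intSize z := Nat.size_le.1 (le_max_right _ _)
  rw [Int.abs_eq_natAbs]
  exact_mod_cast h1

theorem intSize_le {z : ℤ} {m : ℕ} (hm : 1 ≤ m) (h : |z| < 2 ^ m) : intSize z ≤ m := by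
  refine max_le hm (Nat.size_le.2 ?_)
  rw [Int.abs_eq_natAbs] at h
  exact_mod_cast h

theorem top_lt_space (c : Config) : c.top < c.space := by
  calc c.top < ∑ _r ∈ Finset.range (c.top + 1), 1 := by simp
    _ ≤ c.space := Finset.sum_le_sum fun r _ => one_le_intSize _

theorem abs_reg_lt (M : Machine) (w : List ℤ) (t r : ℕ) :
    |(run M w t).reg r| < 2 ^ (run M w t).space := by
  by_cases hr : (run M w t).top < r
  · rw [reg_eq_zero M w t hr]; positivity
  · refine (abs_lt_two_pow_intSize _).trans_le (pow_le_pow_right₀ (by norm_num) ?_)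
    exact Finset.single_le_sum (f := fun r => intSize ((run M w t).reg r))
      (fun _ _ => Nat.zero_le _) (Finset.mem_range.2 (by omega))

theorem one_le_arithCost (n : ℕ) (a b : ℤ) : 1 ≤ arithCost n a b := by
  have h1 := one_le_intSize a
  have h2 := one_le_intSize (n : ℤ)
  rw [arithCost, Nat.ceilDiv_eq_add_pred_div, Nat.one_le_div_iff (by omega)]
  omega

theorem arithCost_le (n : ℕ) (a b : ℤ) : arithCost n a b ≤ intSize a + intSize b := by
  have h2 := one_le_intSize (n : ℤ)
  rw [arithCost, ceilDiv_le_iff_le_mul (by omega)]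
  exact Nat.le_mul_of_pos_left _ (by omega)

theorem one_le_cost (n : ℕ) (reg : ℕ → ℤ) (ins : Instr) : 1 ≤ ins.cost n reg := by
  cases ins <;> simp [Instr.cost, one_le_arithCost]

theorem cost_le {n m : ℕ} {reg : ℕ → ℤ} (h : ∀ r, intSize (reg r) ≤ m) (ins : Instr) :
    ins.cost n reg ≤ 2 * m + 1 := by
  have h2 := fun i j => (arithCost_le n (reg i) (reg j)).trans (add_le_add (h i) (h j))
  cases ins <;> simp only [Instr.cost]
  case arith op d i j => have := h2 i j; omega
  case jumpLt i j l => have := h2 i j; omega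
  all_goals omega

/-- Turns a bound on time into one on the number of steps. Only steps outside the program are free,
and none of them precedes an output, since a stopped machine stays put. -/
theorem le_time_of_isOutputStep {t : ℕ} (h : IsOutputStep M w t) : t ≤ time M w t := by
  calc t = ∑ _s ∈ Finset.range t, 1 := by simp
    _ ≤ time M w t := Finset.sum_le_sum fun s hs => ?_
  rw [Finset.mem_range] at hs
  unfold stepCost
  split
  · rename_i hnone
    exfalso
    have h1 : step M w (run M w s) = none := by simp [step, hnone]
    have h2 := run_add_of_none h1 (t - s)
    rw [show s + (t - s) = t by omega] at h2
    have h3 := step_isSome_of_outOf (w := w) (show (outOf M (run M w t)).isSome from h)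
    rw [h2, h1] at h3
    simp at h3
  · exact one_le_cost _ _ _

end Run

/-! ## Simulation of one step

The memory above index `32` is divided into blocks of length `H`. -/

/-- The address of a cell of a block. -/
def addr (H J o : ℕ) : ℕ := 32 + J * H + o

section Addr

variable {H J o J' o' n : ℕ}

@[simp] theorem addr_inj_right : addr H J o = addr H J o' ↔ o = o' := by simp [addr]

theorem addr_ne_small (h : n < 32) : addr H J o ≠ n := by unfold addr; omega

@[simp] theorem addr_eq_small (h : n < 32) : (addr H J o = n) = False := by
  simp [addr_ne_small h]

@[simp] theorem small_eq_addr (h : n < 32) : (n = addr H J o) = False := by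
  simp [(addr_ne_small h).symm]

/-- Blocks are disjoint; every frame argument below rests on this. -/
theorem addr_ne_addr (hJ : J ≠ J') (ho : o < H) (ho' : o' < H) : addr H J o ≠ addr H J' o' := by
  unfold addr
  rcases Nat.lt_or_gt_of_ne hJ with h | h
  · have := Nat.mul_le_mul_right H (show J + 1 ≤ J' from h)
    rw [add_mul] at this
    omega
  · have := Nat.mul_le_mul_right H (show J' + 1 ≤ J from h)
    rw [add_mul] at this
    omega

theorem addr_le (hJ : J < H + 2) (ho : o < H) : addr H J o ≤ 32 + (H + 2) * H := by
  unfold addr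
  have := Nat.mul_le_mul_right H (show J + 1 ≤ H + 2 from hJ)
  rw [add_mul] at this
  omega

theorem addr_add (H J o : ℕ) : (addr H J o : ℤ) = addr H J 0 + o := by simp [addr]

end Addr

/-- `M` on input tape `w` stays within the limits given by `H`. -/
structure Fits (M : Machine) (w : List ℤ) (H : ℕ) : Prop where
  top_le : ∀ t, (run M w t).top + 6 ≤ H
  reg_lt : ∀ t r, |(run M w t).reg r| < 2 ^ H
  length_le : w.length + 6 ≤ H

/-- A bound on the constants of an instruction. -/
def Instr.bound : Instr → ℕ
  | .const d c => d + c.natAbs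
  | .arith _ d i j => d + i + j
  | .load d i => d + i
  | .store i j => i + j
  | .jump l => l
  | .jumpLt i j l => i + j + l
  | .read d => d
  | .output i j => i + j
  | .halt => 0

/-- The limits on values and addresses used by the simulation. -/
structure Limits (H : ℕ) (V : ℤ) (T : ℕ) : Prop where
  le_T : 32 + (H + 2) * H ≤ T
  le_V : (2 : ℤ) ^ H * (H + 1) + T + 10 ≤ V

namespace Limits

variable {H T : ℕ} {V : ℤ} (h : Limits H V T)
include h

theorem abs_nat {a : ℕ} (ha : a ≤ T) : |(a : ℤ)| ≤ V := by
  have := h.le_V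
  have : (0 : ℤ) ≤ 2 ^ H * (H + 1) := by positivity
  rw [abs_of_nonneg (by positivity)]
  omega

theorem abs_of_lt {z : ℤ} (hz : |z| < 2 ^ H) : |z| ≤ V := by
  have := h.le_V
  have : (2 : ℤ) ^ H ≤ 2 ^ H * (H + 1) := le_mul_of_one_le_right (by positivity) (by linarith)
  linarith

theorem abs_add_of_lt {z : ℤ} (hz : |z| < 2 ^ H) {a : ℕ} (ha : a ≤ T) : |z + a| ≤ V := by
  have := h.le_V
  have : (2 : ℤ) ^ H ≤ 2 ^ H * (H + 1) := le_mul_of_one_le_right (by positivity) (by linarith)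
  have h1 := abs_add_le z a
  rw [Nat.abs_cast] at h1
  have : (a : ℤ) ≤ T := by exact_mod_cast ha
  linarith

/-- Step counters and simulated input positions go up to `2 ^ H * H`, hence the exponential term in
`le_V`. Such numbers still have size polynomial in `H`. -/
theorem abs_count {t : ℕ} (ht : t ≤ 2 ^ H * H) : |(t : ℤ) + 1| ≤ V := by
  have := h.le_V
  have h1 : (t : ℤ) ≤ 2 ^ H * H := by exact_mod_cast ht
  have h2 : (0 : ℤ) ≤ 2 ^ H := by positivity
  rw [abs_of_nonneg (by positivity)]
  linarith

end Limits

/-- `R_d := ` cell `o` of the current block. -/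
def getCell (d o : ℕ) : Cmd := .const d o ;; .arith .add d d 23 ;; .load d d

/-- Cell `o` of the current block `:= R_j`. -/
def putCell (o j : ℕ) : Cmd := .const 0 o ;; .arith .add 0 0 23 ;; .store 0 j

section Rules

variable {w : List ℤ} {V : ℤ} {T L H J : ℕ} {Q : St → Prop} {s : St}

theorem wp_seq {a b : Cmd} :
    (a ;; b).wp w V T L Q s = a.wp w V T L (b.wp w V T L Q) s := rfl

theorem wp_skip : Cmd.skip.wp w V T L Q s = Q s := rfl

theorem wp_const {d : ℕ} {a : ℤ} (ha : |a| ≤ V) (h : Q (s.set d a)) :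
    (Cmd.const d a).wp w V T L Q s := ⟨ha, h⟩

theorem wp_const_nat {d a : ℕ} (hl : Limits H V T) (ha : a ≤ T) (h : Q (s.set d (a : ℤ))) :
    (Cmd.const d a).wp w V T L Q s := ⟨hl.abs_nat ha, h⟩

theorem wp_add {d i j : ℕ} {z : ℤ} (hz : s.reg i + s.reg j = z) (ha : |z| ≤ V)
    (h : Q (s.set d z)) : (Cmd.arith .add d i j).wp w V T L Q s := by
  subst hz; exact ⟨ha, h⟩

theorem wp_sub {d i j : ℕ} {z : ℤ} (hz : s.reg i - s.reg j = z) (ha : |z| ≤ V)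
    (h : Q (s.set d z)) : (Cmd.arith .sub d i j).wp w V T L Q s := by
  subst hz; exact ⟨ha, h⟩

theorem wp_mul {d i j : ℕ} {z : ℤ} (hz : s.reg i * s.reg j = z) (ha : |z| ≤ V)
    (h : Q (s.set d z)) : (Cmd.arith .mul d i j).wp w V T L Q s := by
  subst hz; exact ⟨ha, h⟩

theorem wp_load {d i a : ℕ} (ha : s.reg i = a) (haT : a ≤ T) (h : Q (s.set d (s.reg a))) :
    (Cmd.load d i).wp w V T L Q s := ⟨a, ha, haT, h⟩

theorem wp_store {i j a : ℕ} (ha : s.reg i = a) (haT : a ≤ T) (h : Q (s.set a (s.reg j))) :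
    (Cmd.store i j).wp w V T L Q s := ⟨a, ha, haT, h⟩

theorem wp_ite {i j : ℕ} {a b : Cmd} (h1 : s.reg i < s.reg j → a.wp w V T L Q s)
    (h2 : ¬ s.reg i < s.reg j → b.wp w V T L Q s) : (Cmd.ite i j a b).wp w V T L Q s := ⟨h1, h2⟩

theorem wp_getCell {d o : ℕ} (hl : Limits H V T) (h23 : s.reg 23 = addr H J 0)
    (hJ : J < H + 2) (ho : o < H) (hd : d ≠ 23) (h : Q (s.set d (s.reg (addr H J o))))
    (hd' : d < 32 := by norm_num) :
    (getCell d o).wp w V T L Q s := by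
  have h1 : addr H J o ≤ T := (addr_le hJ ho).trans hl.le_T
  have h2 : o ≤ addr H J o := by simp [addr]
  rw [getCell, wp_seq]
  refine wp_const_nat hl (h2.trans h1) ?_
  rw [wp_seq]
  refine wp_add (z := addr H J o) ?_ (hl.abs_nat h1) ?_
  · simp [St.set_reg, hd.symm, h23, addr_add H J o, add_comm]
  · refine wp_load (a := addr H J o) (by simp [St.set_reg]) h1 ?_
    simpa [St.set_reg, addr_ne_small hd'] using h

theorem wp_putCell {o j : ℕ} (hl : Limits H V T) (h23 : s.reg 23 = addr H J 0)
    (hJ : J < H + 2) (ho : o < H) (hj : j ≠ 0)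
    (h : Q ((s.set 0 (addr H J o)).set (addr H J o) (s.reg j))) :
    (putCell o j).wp w V T L Q s := by
  have h1 : addr H J o ≤ T := (addr_le hJ ho).trans hl.le_T
  have h2 : o ≤ addr H J o := by simp [addr]
  rw [putCell, wp_seq]
  refine wp_const_nat hl (h2.trans h1) ?_
  rw [wp_seq]
  refine wp_add (z := addr H J o) ?_ (hl.abs_nat h1) ?_
  · simp [St.set_reg, h23, addr_add H J o, add_comm]
  · refine wp_store (a := addr H J o) (by simp [St.set_reg]) h1 ?_
    simpa [St.set_reg, hj] using h

end Rules

/-- Set the simulated program counter. -/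
def setPc (m : ℕ) : Cmd := .const 1 m ;; putCell 0 1

/-- Assign the value of `R_j` to the simulated register `d`, and go to the next instruction. -/
def assign (l d j : ℕ) : Cmd := putCell (5 + d) j ;; setPc (l + 1)

/-- Simulation of the instruction `ins` with index `l`. -/
def simInstr (l : ℕ) : Instr → Cmd
  | .const d c => .const 1 c ;; assign l d 1
  | .arith op d i j => getCell 1 (5 + i) ;; getCell 2 (5 + j) ;; .arith op 1 1 2 ;; assign l d 1
  | .load d i =>
      getCell 1 (5 + i) ;; .ite 1 19 .skip (.const 2 (5 : ℕ) ;; .arith .add 2 2 23 ;;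
        .arith .add 1 1 2 ;; .load 1 1 ;; assign l d 1)
  | .store i j =>
      getCell 1 (5 + i) ;; .ite 1 19 .skip (.const 2 (5 : ℕ) ;; .arith .add 2 2 23 ;;
        .arith .add 1 1 2 ;; getCell 2 (5 + j) ;; .store 1 2 ;; setPc (l + 1))
  | .jump m => setPc m
  | .jumpLt i j m =>
      getCell 1 (5 + i) ;; getCell 2 (5 + j) ;; .ite 1 2 (setPc m) (setPc (l + 1))
  | .read d =>
      getCell 4 1 ;;
        .ite 4 10 (.const 2 (32 : ℕ) ;; .arith .add 2 2 4 ;; .load 2 2) (.const 2 (0 : ℕ)) ;;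
        .arith .add 4 4 18 ;; putCell 1 4 ;; assign l d 2
  | .output i j =>
      getCell 1 (5 + i) ;; getCell 2 (5 + j) ;; .ite 1 19 .skip (.ite 2 19 .skip
        (.const 3 (5 : ℕ) ;; .arith .add 3 3 23 ;; .arith .add 16 1 3 ;; .arith .add 17 2 3 ;;
          .const 24 (1 : ℕ) ;; setPc (l + 1)))
  | .halt => .skip

/-- Simulation of the instruction with index `R_1`, when this is at least `l` and the instructions
from `l` on are `M`. -/
def dispatch : List Instr → ℕ → Cmd
  | [], _ => .skip
  | ins :: M, l => .const 2 (l + 1 : ℕ) ;; .ite 1 2 (simInstr l ins) (dispatch M (l + 1))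

/-- Simulation of one step of `M` in the current block. -/
def simStep (M : Machine) : Cmd := getCell 1 0 ;; dispatch M 0

/-- Block `J` represents the configuration `c`. -/
structure Represents (H : ℕ) (reg : ℕ → ℤ) (J : ℕ) (c : Config) : Prop where
  pc : reg (addr H J 0) = c.pc
  pos : reg (addr H J 1) = c.pos
  reg : ∀ r, 5 + r < H → reg (addr H J (5 + r)) = c.reg r

/-- Registers `R_16` and `R_17` delimit the word `v` in block `J`. -/
def Delimits (H : ℕ) (reg : ℕ → ℤ) (J : ℕ) (v : List ℤ) : Prop :=
  ∃ a b : ℕ, a < 2 ^ H ∧ b < 2 ^ H ∧ reg 16 = addr H J (5 + a) ∧ reg 17 = addr H J (5 + b) ∧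
    (a ≤ b → 5 + b < H) ∧
    v = (List.range' a (b + 1 - a)).map fun r => reg (addr H J (5 + r))

/-- The effect of the simulation of a step from configuration `c` to configuration `c'`. -/
structure StepPost (M : Machine) (H J : ℕ) (c c' : Config) (s s' : St) : Prop where
  rep : Represents H s'.reg J c'
  frame : ∀ r, 5 ≤ r → r ≠ 16 → r ≠ 17 → r ≠ 24 →
    (∀ o, o < 2 ∨ 5 ≤ o → o < H → r ≠ addr H J o) → s'.reg r = s.reg r
  none : outOf M c = none → s'.reg 24 = s.reg 24
  some : ∀ v, outOf M c = some v → s'.reg 24 = 1 ∧ Delimits H s'.reg J v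

/-- What the simulation of a step needs. -/
structure StepPre (w : List ℤ) (H J : ℕ) (c : Config) (s : St) : Prop where
  rep : Represents H s.reg J c
  base : s.reg 23 = addr H J 0
  zero : s.reg 19 = 0
  one : s.reg 18 = 1
  len : s.reg 10 = w.length
  input : ∀ p, p < w.length → s.reg (addr H 0 p) = w.getD p 0

/-! ### Correctness of the simulated step -/

section Simulation

variable {M : Machine} {w w' : List ℤ} {H T L J : ℕ} {V : ℤ} {s : St}

/-- Common end of all instructions that move on: everything but the program counter is already in
place in `s₁`, and the last write touches only that cell and scratch registers. -/
theorem setPc_spec (hl : Limits H V T) (hJ : J < H + 2) {m : ℕ} (hm : m ≤ H) (h6 : 6 ≤ H)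
    {c c' : Config} {s₁ : St} (hbase : s₁.reg 23 = addr H J 0) (hpos : s₁.pos = s.pos)
    (hfr : ∀ r, 5 ≤ r → r ≠ 16 → r ≠ 17 → r ≠ 24 →
      (∀ o, o < 2 ∨ 5 ≤ o → o < H → r ≠ addr H J o) → s₁.reg r = s.reg r)
    (hpc : c'.pc = m) (hcpos : s₁.reg (addr H J 1) = c'.pos)
    (hreg : ∀ r, 5 + r < H → s₁.reg (addr H J (5 + r)) = c'.reg r)
    (hnone : outOf M c = none → s₁.reg 24 = s.reg 24)
    (hsome : ∀ v, outOf M c = some v → s₁.reg 24 = 1 ∧ Delimits H s₁.reg J v) :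
    (setPc m).wp w' V T L (fun s' => s'.pos = s.pos ∧ StepPost M H J c c' s s') s₁ := by
  have hHT : H ≤ T := by have := hl.le_T; nlinarith
  rw [setPc, wp_seq]
  refine wp_const_nat hl (by omega) ?_
  refine wp_putCell hl (by simp [St.set_reg, hbase]) hJ (by omega) (by norm_num) ?_
  refine ⟨by simp [hpos], ⟨?_, ?_, ?_⟩, ?_, ?_, ?_⟩
  · simp [St.set_reg, hpc]
  · simp [St.set_reg, hcpos]
  · intro r hr
    simp [St.set_reg, hreg r hr]
  · intro r h5 h16 h17 h24 hr
    have := hr 0 (by simp) (by omega)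
    simp [St.set_reg, this, hfr r h5 h16 h17 h24 hr, show r ≠ 0 by omega, show r ≠ 1 by omega]
  · intro h; simpa [St.set_reg] using hnone h
  · intro v h
    obtain ⟨h1, a, b, ha, hb, h2, h3, h4, h5⟩ := hsome v h
    exact ⟨by simpa [St.set_reg] using h1, a, b, ha, hb, by simpa [St.set_reg] using h2,
      by simpa [St.set_reg] using h3, h4, by simpa [St.set_reg] using h5⟩

theorem assign_spec (hl : Limits H V T) (hJ : J < H + 2) {l d j : ℕ} (hm : l + 6 ≤ H)
    (hd : d + 6 ≤ H) (hj : j ≠ 0)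
    {c c' : Config} {s₁ : St} (hbase : s₁.reg 23 = addr H J 0) (hpos : s₁.pos = s.pos)
    (hfr : ∀ r, 5 ≤ r → r ≠ addr H J 1 → s₁.reg r = s.reg r)
    (hpc : c'.pc = l + 1) (hcpos : s₁.reg (addr H J 1) = c'.pos)
    (hreg : ∀ r, 5 + r < H → s.reg (addr H J (5 + r)) = c.reg r)
    (hreg' : c'.reg = Function.update c.reg d (s₁.reg j))
    (hnone : outOf M c = none) :
    (assign l d j).wp w' V T L (fun s' => s'.pos = s.pos ∧ StepPost M H J c c' s s') s₁ := by
  rw [assign, wp_seq]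
  refine wp_putCell hl (by simp [hbase]) hJ (by omega) hj ?_
  refine setPc_spec hl hJ (by omega) (by omega) (by simp [St.set_reg, hbase]) (by simp [hpos]) ?_
    hpc (by simpa [St.set_reg, show 1 ≠ 5 + d by omega] using hcpos) ?_ ?_ ?_
  · intro r h5 h16 h17 h24 hr
    have := hr (5 + d) (by simp) (by omega)
    have h1 := hr 1 (by simp) (by omega)
    simp [St.set_reg, *, show r ≠ 0 by omega]
  · intro r hr
    have h1 := hfr (addr H J (5 + r)) (by unfold addr; omega) (by simp; omega)
    simp [St.set_reg, hreg', Function.update_apply, h1, hreg r hr]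
  · intro; simp [St.set_reg, hfr]
  · simp [hnone]

theorem StepPre.refl {c : Config} (hs : StepPre w H J c s) (hM : outOf M c = none) :
    StepPost M H J c c s s where
  rep := hs.rep
  frame _ _ _ _ _ _ := rfl
  none _ := rfl
  some v hv := by simp [hM] at hv

/-- The tape `w` of the simulated machine lives in block `0`; the tape `w'` of the simulating
machine is irrelevant, as no `read` is executed here. Where `M` stops, the simulation writes nothing
into the block, in accordance with the convention of `run`. -/
theorem simInstr_spec (hl : Limits H V T) (hM : Fits M w H) (hJ : J < H + 2)
    {t l : ℕ} (ht : t ≤ 2 ^ H * H) {ins : Instr} (hins : M[l]? = some ins)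
    (hb : ins.bound + 6 ≤ H) (hlM : l + 6 ≤ H)
    (hpc : (run M w t).pc = l) (hs : StepPre w H J (run M w t) s) :
    (simInstr l ins).wp w' V T L
      (fun s' => s'.pos = s.pos ∧ StepPost M H J (run M w t) (run M w (t + 1)) s s') s := by
  have hHT : H ≤ T := by have := hl.le_T; nlinarith
  have hval := hM.reg_lt t
  have hval' := hM.reg_lt (t + 1)
  have htop' := hM.top_le (t + 1)
  obtain ⟨hrpc, hrpos, hrreg⟩ := hs.rep
  have hout : (∀ i j, ins ≠ .output i j) → outOf M (run M w t) = none := by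
    intro hne
    by_contra h
    obtain ⟨i, j, h1, -⟩ := isSome_outOf (M := M) (c := run M w t) (by
      simpa [Option.isSome_iff_ne_none] using h)
    rw [hpc, hins] at h1
    exact absurd (Option.some.inj h1) (hne i j)
  have hstep : step M w (run M w t) = (ins.exec w (run M w t)).map
      fun c' => { c' with top := max (run M w t).top (ins.maxIndex (run M w t).reg) } := by
    rw [step, hpc, hins]
  have htop := hM.top_le t
  have hposle : (run M w t).pos ≤ 2 ^ H * H := (pos_le M w t).trans ht
  have hsucc : ∀ X, step M w (run M w t) = some X → run M w (t + 1) = X :=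
    fun X h => run_succ_of_some h
  have hstay : step M w (run M w t) = none → run M w (t + 1) = run M w t :=
    fun h => run_add_of_none h 1
  -- From here on the two configurations are linked only by `hsucc` and `hstay`.
  generalize run M w t = c at *
  generalize run M w (t + 1) = c' at *
  cases ins with
  | const d a =>
    simp only [Instr.bound] at hb
    obtain rfl := hsucc _ hstep
    rw [simInstr, wp_seq]
    refine wp_const (hl.abs_of_lt (by simpa using hval' d)) ?_
    exact assign_spec hl hJ hlM (by omega) (by norm_num) (by simp [St.set_reg, hs.base]) rfl
      (fun r h5 _ => by simp [St.set_reg, show r ≠ 1 by omega]) (by simp [hpc])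
      (by simp [St.set_reg, hrpos]) hrreg (by simp [St.set_reg]) (hout (by simp))
  | arith op d i j =>
    simp only [Instr.bound] at hb
    obtain rfl := hsucc _ hstep
    rw [simInstr, wp_seq]
    refine wp_getCell hl (by simp [hs.base]) hJ (by omega) (by norm_num) ?_
    rw [wp_seq]
    refine wp_getCell hl (by simp [St.set_reg, hs.base]) hJ (by omega) (by norm_num) ?_
    rw [wp_seq]
    have hv := hval' d
    simp only [Function.update_self] at hv
    have h1 : ∀ s : St, s.reg 1 = c.reg i → s.reg 2 = c.reg j → ∀ Q : St → Prop,
        Q (s.set 1 (op.eval (c.reg i) (c.reg j))) → (Cmd.arith op 1 1 2).wp w' V T L Q s := by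
      intro s h1 h2 Q hQ
      rw [← h1, ← h2] at hQ hv
      exact ⟨hl.abs_of_lt hv, hQ⟩
    refine h1 _ (by simp [St.set_reg, hrreg i (by omega)])
      (by simp [St.set_reg, hrreg j (by omega)]) _ ?_
    exact assign_spec hl hJ hlM (by omega) (by norm_num) (by simp [St.set_reg, hs.base]) rfl
      (fun r h5 _ => by simp [St.set_reg, show r ≠ 1 by omega, show r ≠ 2 by omega]) (by simp [hpc])
      (by simp [St.set_reg, hrpos]) hrreg (by simp [St.set_reg]) (hout (by simp))
  | load d i =>
    simp only [Instr.bound] at hb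
    rw [simInstr, wp_seq]
    refine wp_getCell hl (by simp [hs.base]) hJ (by omega) (by norm_num) ?_
    refine wp_ite (fun hlt => ?_) (fun hlt => ?_)
    · simp [St.set_reg, hs.zero, hrreg i (by omega : 5 + i < H)] at hlt
      obtain rfl := hstay (by simp [hstep, Instr.exec, hlt.not_ge])
      exact ⟨rfl, ⟨by simp [St.set_reg, hrpc], by simp [St.set_reg, hrpos],
        by simpa [St.set_reg] using hrreg⟩, fun r h5 _ _ _ _ => by
          simp [St.set_reg, show r ≠ 1 by omega], by simp [St.set_reg],
        by simp [hout]⟩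
    · simp [St.set_reg, hs.zero, hrreg i (by omega : 5 + i < H)] at hlt
      obtain ⟨a, ha⟩ := Int.eq_ofNat_of_zero_le hlt
      obtain rfl := hsucc { c with pc := c.pc + 1, reg := Function.update c.reg d (c.reg a), top := _ }
        (by rw [hstep]; simp [Instr.exec, ha]; rfl)
      -- The address accessed enters `top` of the next configuration, which `Fits` bounds.
      have haH : a + 6 ≤ H := by
        simp [Instr.maxIndex, ha] at htop'
        omega
      have haT : addr H J (5 + a) ≤ T := (addr_le hJ (by omega)).trans hl.le_T
      have h5T : addr H J 5 ≤ T := (addr_le hJ (by omega)).trans hl.le_T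
      rw [wp_seq]
      refine wp_const_nat hl (by omega) ?_
      rw [wp_seq]
      refine wp_add (z := addr H J 5) (by simp [St.set_reg, hs.base, addr]; ring) (hl.abs_nat h5T) ?_
      rw [wp_seq]
      refine wp_add (z := addr H J (5 + a)) (by
        simp [St.set_reg, hrreg i (by omega), ha]; simp [addr]; ring) (hl.abs_nat haT) ?_
      rw [wp_seq]
      refine wp_load (a := addr H J (5 + a)) (by simp [St.set_reg]) haT ?_
      exact assign_spec hl hJ hlM (by omega) (by norm_num) (by simp [St.set_reg, hs.base]) rfl
        (fun r h5 _ => by simp [St.set_reg, show r ≠ 1 by omega, show r ≠ 2 by omega])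
        (by simp [hpc]) (by simp [St.set_reg, hrpos]) hrreg
        (by simp [St.set_reg, hrreg a (by omega)]) (hout (by simp))
  | store i j =>
    simp only [Instr.bound] at hb
    rw [simInstr, wp_seq]
    refine wp_getCell hl (by simp [hs.base]) hJ (by omega) (by norm_num) ?_
    refine wp_ite (fun hlt => ?_) (fun hlt => ?_)
    · simp [St.set_reg, hs.zero, hrreg i (by omega : 5 + i < H)] at hlt
      obtain rfl := hstay (by simp [hstep, Instr.exec, hlt.not_ge])
      exact ⟨rfl, ⟨by simp [St.set_reg, hrpc], by simp [St.set_reg, hrpos],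
        by simpa [St.set_reg] using hrreg⟩, fun r h5 _ _ _ _ => by
          simp [St.set_reg, show r ≠ 1 by omega], by simp [St.set_reg],
        by simp [hout]⟩
    · simp [St.set_reg, hs.zero, hrreg i (by omega : 5 + i < H)] at hlt
      obtain ⟨a, ha⟩ := Int.eq_ofNat_of_zero_le hlt
      obtain rfl := hsucc { c with pc := c.pc + 1, reg := Function.update c.reg a (c.reg j), top := _ }
        (by rw [hstep]; simp [Instr.exec, ha]; rfl)
      have haH : a + 6 ≤ H := by
        simp [Instr.maxIndex, ha] at htop'
        omega
      have haT : addr H J (5 + a) ≤ T := (addr_le hJ (by omega)).trans hl.le_T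
      have h5T : addr H J 5 ≤ T := (addr_le hJ (by omega)).trans hl.le_T
      rw [wp_seq]
      refine wp_const_nat hl (by omega) ?_
      rw [wp_seq]
      refine wp_add (z := addr H J 5) (by simp [St.set_reg, hs.base, addr]; ring) (hl.abs_nat h5T) ?_
      rw [wp_seq]
      refine wp_add (z := addr H J (5 + a)) (by
        simp [St.set_reg, hrreg i (by omega), ha]; simp [addr]; ring) (hl.abs_nat haT) ?_
      rw [wp_seq]
      refine wp_getCell hl (by simp [St.set_reg, hs.base]) hJ (by omega) (by norm_num) ?_
      rw [wp_seq]
      refine wp_store (a := addr H J (5 + a)) (by simp [St.set_reg]) haT ?_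
      refine setPc_spec hl hJ (by omega) (by omega) (by simp [St.set_reg, hs.base]) (by simp) ?_
        (by simp [hpc]) (by simp [St.set_reg, hrpos, show 1 ≠ 5 + a by omega]) ?_ ?_ ?_
      · intro r h5 h16 h17 h24 hr
        have h1 := hr (5 + a) (by simp) (by omega)
        simp [St.set_reg, h1, show r ≠ 1 by omega, show r ≠ 2 by omega]
      · intro r hr
        simp [St.set_reg, hrreg r hr, hrreg j (by omega), Function.update_apply]
      · intro; simp [St.set_reg]
      · simp [hout]
  | jump m =>
    simp only [Instr.bound] at hb
    obtain rfl := hsucc _ hstep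
    exact setPc_spec hl hJ (by omega) (by omega) hs.base rfl (fun _ _ _ _ _ _ => rfl) rfl hrpos
      hrreg (fun _ => rfl) (by simp [hout])
  | jumpLt i j m =>
    simp only [Instr.bound] at hb
    obtain rfl := hsucc _ hstep
    rw [simInstr, wp_seq]
    refine wp_getCell hl (by simp [hs.base]) hJ (by omega) (by norm_num) ?_
    rw [wp_seq]
    refine wp_getCell hl (by simp [St.set_reg, hs.base]) hJ (by omega) (by norm_num) ?_
    refine wp_ite (fun hlt => ?_) (fun hlt => ?_)
    all_goals
      simp [St.set_reg, hrreg i (by omega : 5 + i < H), hrreg j (by omega : 5 + j < H)] at hlt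
      exact setPc_spec hl hJ (by omega) (by omega) (by simp [St.set_reg, hs.base]) rfl
        (fun r h5 _ _ _ _ => by simp [St.set_reg, show r ≠ 1 by omega, show r ≠ 2 by omega])
        (by simp [hpc, hlt]) (by simp [St.set_reg, hrpos])
        (fun r hr => by simp [St.set_reg, hrreg r hr]) (fun _ => by simp [St.set_reg]) (by simp [hout])
  | read d =>
    simp only [Instr.bound] at hb
    obtain rfl := hsucc _ hstep
    rw [simInstr, wp_seq]
    refine wp_getCell hl (by simp [hs.base]) hJ (by omega) (by norm_num) ?_
    rw [wp_seq]
    -- The position is compared with the length of the input, because block `0` is only meaningful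
    -- up to there; beyond it the value read is `0`.
    have hfinish : ∀ Q : St → Prop, Q ((s.set 4 c.pos).set 2 (w.getD c.pos 0)) →
        (Cmd.ite 4 10 (.const 2 (32 : ℕ) ;; .arith .add 2 2 4 ;; .load 2 2)
          (.const 2 (0 : ℕ))).wp w' V T L Q (s.set 4 c.pos) := by
      intro Q hQ
      refine wp_ite (fun hlt => ?_) (fun hlt => ?_)
      · simp only [St.set_reg, hs.len, if_true, if_false, show (10 : ℕ) ≠ 4 by norm_num,
          Nat.cast_lt] at hlt
        have hlen := hM.length_le
        have hT : addr H 0 c.pos ≤ T := (addr_le (by omega) (by omega)).trans hl.le_T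
        have h32 : 32 ≤ T := le_trans (by unfold addr; omega) hT
        rw [wp_seq]
        refine wp_const_nat hl h32 ?_
        rw [wp_seq]
        refine wp_add (z := addr H 0 c.pos) (by simp [St.set_reg, addr]) (hl.abs_nat hT) ?_
        refine wp_load (a := addr H 0 c.pos) (by simp [St.set_reg]) hT ?_
        simpa [St.set_reg, hs.input _ hlt] using hQ
      · simp only [St.set_reg, hs.len, if_true, if_false, show (10 : ℕ) ≠ 4 by norm_num,
          Nat.cast_lt] at hlt
        refine wp_const_nat hl (by omega) ?_
        rw [List.getD_eq_default _ _ (by omega)] at hQ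
        simpa using hQ
    rw [hrpos]
    refine hfinish _ ?_
    rw [wp_seq]
    refine wp_add (z := (c.pos : ℤ) + 1) (by simp [St.set_reg, hs.one]) (hl.abs_count hposle) ?_
    rw [wp_seq]
    refine wp_putCell hl (by simp [St.set_reg, hs.base]) hJ (by omega) (by norm_num) ?_
    exact assign_spec hl hJ hlM (by omega) (by norm_num) (by simp [St.set_reg, hs.base]) rfl
      (fun r h5 h => by
        simp [St.set_reg, h, show r ≠ 0 by omega, show r ≠ 2 by omega, show r ≠ 4 by omega])
      (by simp [hpc]) (by simp [St.set_reg]) hrreg (by simp [St.set_reg]) (hout (by simp))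
  | output i j =>
    simp only [Instr.bound] at hb
    have ho : outOf M c = if 0 ≤ c.reg i ∧ 0 ≤ c.reg j then
        some ((List.range' (c.reg i).toNat ((c.reg j).toNat + 1 - (c.reg i).toNat)).map c.reg)
        else none := by simp [outOf, hpc, hins]
    rw [simInstr, wp_seq]
    refine wp_getCell hl (by simp [hs.base]) hJ (by omega) (by norm_num) ?_
    rw [wp_seq]
    refine wp_getCell hl (by simp [St.set_reg, hs.base]) hJ (by omega) (by norm_num) ?_
    have hneg : ¬ (0 ≤ c.reg i ∧ 0 ≤ c.reg j) → Cmd.skip.wp w' V T L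
        (fun s' => s'.pos = s.pos ∧ StepPost M H J c c' s s')
        ((s.set 1 (s.reg (addr H J (5 + i)))).set 2
          ((s.set 1 (s.reg (addr H J (5 + i)))).reg (addr H J (5 + j)))) := by
      intro hneg
      obtain rfl := hstay (by rw [hstep]; simp only [Instr.exec, if_neg hneg]; rfl)
      rw [if_neg hneg] at ho
      exact ⟨rfl, ⟨by simp [St.set_reg, hrpc], by simp [St.set_reg, hrpos],
        by simpa [St.set_reg] using hrreg⟩, fun r h5 _ _ _ _ => by
          simp [St.set_reg, show r ≠ 1 by omega, show r ≠ 2 by omega], by simp [St.set_reg],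
        by simp [ho]⟩
    refine wp_ite (fun hlt => ?_) (fun hlt => wp_ite (fun hlt' => ?_) (fun hlt' => ?_))
    · simp [St.set_reg, hs.zero, hrreg i (by omega : 5 + i < H)] at hlt
      exact hneg (fun h => by omega)
    · simp [St.set_reg, hs.zero, hrreg j (by omega : 5 + j < H)] at hlt'
      exact hneg (fun h => by omega)
    · clear hneg
      simp [St.set_reg, hs.zero, hrreg i (by omega : 5 + i < H)] at hlt
      simp [St.set_reg, hs.zero, hrreg j (by omega : 5 + j < H)] at hlt'
      have hvi := hval i
      have hvj := hval j
      rw [if_pos ⟨hlt, hlt'⟩] at ho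
      obtain ⟨a, ha⟩ := Int.eq_ofNat_of_zero_le hlt
      obtain ⟨b, hb'⟩ := Int.eq_ofNat_of_zero_le hlt'
      obtain rfl := hsucc { c with pc := c.pc + 1, top := _ }
        (by rw [hstep]; simp [Instr.exec, ha, hb']; rfl)
      have h5T : addr H J 5 ≤ T := (addr_le hJ (by omega)).trans hl.le_T
      -- An output instruction accesses registers up to index `b` only if the range is nonempty;
      -- otherwise `a` and `b` are bounded merely by `2 ^ H`.
      have habH : a ≤ b → b + 6 ≤ H := by
        intro hab
        simp [Instr.maxIndex, ha, hb', hab] at htop'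
        omega
      rw [wp_seq]
      refine wp_const_nat hl (by omega) ?_
      rw [wp_seq]
      refine wp_add (z := addr H J 5) (by simp [St.set_reg, hs.base, addr]; ring) (hl.abs_nat h5T) ?_
      rw [wp_seq]
      refine wp_add (z := c.reg i + addr H J 5) (by simp [St.set_reg, hrreg i (by omega)])
        (hl.abs_add_of_lt hvi h5T) ?_
      rw [wp_seq]
      refine wp_add (z := c.reg j + addr H J 5) (by simp [St.set_reg, hrreg j (by omega)])
        (hl.abs_add_of_lt hvj h5T) ?_
      rw [wp_seq]
      refine wp_const_nat hl (by omega) ?_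
      refine setPc_spec hl hJ (by omega) (by omega) (by simp [St.set_reg, hs.base]) (by simp) ?_
        (by simp [hpc]) (by simp [St.set_reg, hrpos]) ?_ ?_ ?_
      · intro r h5 h16 h17 h24 hr
        simp [St.set_reg, h16, h17, h24, show r ≠ 1 by omega, show r ≠ 2 by omega,
          show r ≠ 3 by omega]
      · intro r hr
        simp [St.set_reg, hrreg r hr]
      · simp [ho]
      · intro v hv
        refine ⟨by simp [St.set_reg], a, b, ?_, ?_, ?_, ?_, fun hab => by have := habH hab; omega, ?_⟩
        · rw [ha, abs_of_nonneg (by positivity)] at hvi; exact_mod_cast hvi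
        · rw [hb', abs_of_nonneg (by positivity)] at hvj; exact_mod_cast hvj
        · simp [St.set_reg, ha, addr]; ring
        · simp [St.set_reg, hb', addr]; ring
        · rw [ho] at hv
          rw [← Option.some.inj hv, ha, hb']
          simp only [Int.toNat_natCast]
          refine List.map_congr_left fun r hr => ?_
          rw [List.mem_range'_1] at hr
          have := habH (by omega)
          simp [St.set_reg, hrreg r (by omega)]
  | halt =>
    obtain rfl := hstay (by simp [hstep, Instr.exec])
    exact ⟨rfl, hs.rep, fun _ _ _ _ _ _ => rfl, fun _ => rfl, by simp [hout]⟩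

/-- The chain of tests knows that the program counter is at least `l`, so `R_1 < l + 1` identifies
instruction `l`. Falling off the end means that `M` has left its program and stays put. -/
theorem dispatch_spec (hl : Limits H V T) (hM : Fits M w H) (hJ : J < H + 2)
    {t : ℕ} (ht : t ≤ 2 ^ H * H) (hb : ∀ ins ∈ M, ins.bound + 6 ≤ H) (hlen : M.length + 6 ≤ H)
    (P : List Instr) : ∀ (l : ℕ) (s₁ : St), P = M.drop l → l ≤ (run M w t).pc → l ≤ M.length →
      s₁.reg 1 = (run M w t).pc → StepPre w H J (run M w t) s₁ → s₁.pos = s.pos →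
      (∀ r, 5 ≤ r → s₁.reg r = s.reg r) →
    (dispatch P l).wp w' V T L
      (fun s' => s'.pos = s.pos ∧ StepPost M H J (run M w t) (run M w (t + 1)) s s') s₁ := by
  have hHT : H ≤ T := by have := hl.le_T; nlinarith
  induction P with
  | nil =>
    intro l s₁ hP hpc hlM h1 hs hpos hfr
    have hnone : M[(run M w t).pc]? = none := by
      rw [List.getElem?_eq_none_iff]
      exact (List.drop_eq_nil_iff.1 hP.symm).trans hpc
    have hstep : step M w (run M w t) = none := by simp [step, hnone]
    rw [run_add_of_none hstep 1]
    exact ⟨hpos, hs.rep, fun r h _ _ _ _ => hfr r h, fun _ => hfr 24 (by norm_num),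
      by simp [outOf, hnone]⟩
  | cons ins P ih =>
    intro l s₁ hP hpc hlM h1 hs hpos hfr
    have hlt : l < M.length := by
      by_contra hge
      simp [List.drop_eq_nil_of_le (not_lt.1 hge)] at hP
    have hins : M[l]? = some ins ∧ P = M.drop (l + 1) := by
      rw [List.drop_eq_getElem_cons hlt] at hP
      obtain ⟨rfl, rfl⟩ := List.cons.inj hP
      exact ⟨by simp [hlt], rfl⟩
    rw [dispatch, wp_seq]
    refine wp_const_nat hl (by omega) ?_
    have hs2 : StepPre w H J (run M w t) (s₁.set 2 (l + 1 : ℕ)) :=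
      ⟨⟨by simp [St.set_reg, hs.rep.pc], by simp [St.set_reg, hs.rep.pos],
        fun r hr => by simp [St.set_reg, hs.rep.reg r hr]⟩, by simp [St.set_reg, hs.base],
        by simp [St.set_reg, hs.zero], by simp [St.set_reg, hs.one], by simp [St.set_reg, hs.len],
        fun p hp => by simp [St.set_reg, hs.input p hp]⟩
    have hfr2 : ∀ r, 5 ≤ r → (s₁.set 2 (l + 1 : ℕ)).reg r = s.reg r := fun r hr => by
      simp [St.set_reg, hfr r hr, show r ≠ 2 by omega]
    refine wp_ite (fun hlt' => ?_) (fun hlt' => ?_)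
    · simp [St.set_reg, h1] at hlt'
      refine Cmd.wp_mono _ ?_ _ (simInstr_spec hl hM hJ ht hins.1
        (hb ins (List.mem_of_getElem? hins.1)) (by omega) (by omega) hs2)
      rintro s' ⟨h2, h3⟩
      refine ⟨h2.trans hpos, h3.rep, fun r h5 h16 h17 h24 hr => ?_, fun h => ?_, h3.some⟩
      · rw [h3.frame r h5 h16 h17 h24 hr, hfr2 r h5]
      · rw [h3.none h, hfr2 24 (by norm_num)]
    · simp [St.set_reg, h1] at hlt'
      exact ih (l + 1) _ hins.2 (by omega) hlt (by simp [St.set_reg, h1]) hs2 hpos hfr2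

theorem simStep_spec (hl : Limits H V T) (hM : Fits M w H) (hJ : J < H + 2)
    {t : ℕ} (ht : t ≤ 2 ^ H * H) (hb : ∀ ins ∈ M, ins.bound + 6 ≤ H) (hlen : M.length + 6 ≤ H)
    (hs : StepPre w H J (run M w t) s) :
    (simStep M).wp w' V T L
      (fun s' => s'.pos = s.pos ∧ StepPost M H J (run M w t) (run M w (t + 1)) s s') s := by
  rw [simStep, wp_seq]
  refine wp_getCell hl hs.base hJ (by omega) (by norm_num) ?_
  refine dispatch_spec hl hM hJ ht hb hlen M 0 _ (by simp) (by simp) (by simp)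
    (by simp [St.set_reg, hs.rep.pc]) ⟨⟨by simp [St.set_reg, hs.rep.pc],
      by simp [St.set_reg, hs.rep.pos], fun r hr => by simp [St.set_reg, hs.rep.reg r hr]⟩,
      by simp [St.set_reg, hs.base], by simp [St.set_reg, hs.zero], by simp [St.set_reg, hs.one],
      by simp [St.set_reg, hs.len], fun p hp => by simp [St.set_reg, hs.input p hp]⟩ rfl ?_
  intro r hr
  simp [St.set_reg, show r ≠ 1 by omega]

theorem simInstr_varsLt (l : ℕ) (ins : Instr) : (simInstr l ins).VarsLt 32 := by
  cases ins <;> simp [simInstr, getCell, putCell, assign, setPc, Cmd.VarsLt]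

theorem dispatch_varsLt (P : List Instr) (l : ℕ) : (dispatch P l).VarsLt 32 := by
  induction P generalizing l with
  | nil => trivial
  | cons ins P ih => simp [dispatch, Cmd.VarsLt, simInstr_varsLt, ih]

theorem simStep_varsLt (M : Machine) : (simStep M).VarsLt 32 := by
  simp [simStep, getCell, Cmd.VarsLt, dispatch_varsLt]

end Simulation

/-! ## Rounds -/

/-- The memory of the amortized machine: process `j` uses block `j + 2` and has simulated `cnt j`
steps. -/
structure Mem (M : Machine) (w : List ℤ) (H : ℕ) (cnt : ℕ → ℕ) (reg : ℕ → ℤ) : Prop where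
  len : reg 10 = w.length
  height : reg 11 = H
  base : reg 12 = addr H 1 0
  one : reg 18 = 1
  zero : reg 19 = 0
  twice : reg 22 = 2 * H
  input : ∀ p, p < w.length → reg (addr H 0 p) = w.getD p 0
  rep : ∀ j < H, Represents H reg (j + 2) (run M w (cnt j))
  cnt : ∀ j < H, reg (addr H (j + 2) 2) = cnt j
  lo : ∀ j < H, reg (addr H (j + 2) 3) = zoneLo H j
  hi : ∀ j < H, reg (addr H (j + 2) 4) = zoneHi H j

/-- A register that is neither scratch space of a round nor a cell of block `J` other than those
with the limits of a zone. -/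
def Stable (H J r : ℕ) : Prop :=
  8 ≤ r ∧ r ∉ [13, 14, 15, 16, 17, 23, 24] ∧ ∀ o, o ≠ 3 → o ≠ 4 → o < H → r ≠ addr H J o

theorem stable_small {H J r : ℕ} (h : r < 32) (h8 : 8 ≤ r)
    (hr : r ∉ [13, 14, 15, 16, 17, 23, 24]) : Stable H J r :=
  ⟨h8, hr, fun _ _ _ _ => (addr_ne_small h).symm⟩

theorem stable_addr {H J J' o : ℕ} (ho : o < H) (h : J' ≠ J ∨ o = 3 ∨ o = 4) :
    Stable H J (addr H J' o) := by
  refine ⟨by unfold addr; omega, ?_, fun o' h3 h4 ho' => ?_⟩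
  · simp
  · rcases h with h | h
    · exact addr_ne_addr h ho ho'
    · by_cases hJ : J' = J
      · subst hJ; rw [Ne, addr_inj_right]; omega
      · exact addr_ne_addr hJ ho ho'

section Mem

variable {M : Machine} {w w' : List ℤ} {H T L J : ℕ} {V : ℤ} {cnt : ℕ → ℕ} {reg reg' : ℕ → ℤ}

/-- A move of process `j` alters only scratch registers and block `j + 2`, and in that block the
zone limits are spared. -/
theorem Mem.advance (h : Mem M w H cnt reg) {j : ℕ} (hH : w.length + 6 ≤ H)
    (hfr : ∀ r, Stable H (j + 2) r → reg' r = reg r) {n : ℕ}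
    (hrep : Represents H reg' (j + 2) (run M w n)) (hcnt : reg' (addr H (j + 2) 2) = n) :
    Mem M w H (Function.update cnt j n) reg' where
  len := by rw [hfr _ (stable_small (by norm_num) (by norm_num) (by norm_num)), h.len]
  height := by rw [hfr _ (stable_small (by norm_num) (by norm_num) (by norm_num)), h.height]
  base := by rw [hfr _ (stable_small (by norm_num) (by norm_num) (by norm_num)), h.base]
  one := by rw [hfr _ (stable_small (by norm_num) (by norm_num) (by norm_num)), h.one]
  zero := by rw [hfr _ (stable_small (by norm_num) (by norm_num) (by norm_num)), h.zero]
  twice := by rw [hfr _ (stable_small (by norm_num) (by norm_num) (by norm_num)), h.twice]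
  input p hp := by rw [hfr _ (stable_addr (by omega) (.inl (by omega))), h.input p hp]
  rep i hi := by
    by_cases hij : i = j
    · subst hij; simpa using hrep
    · have h1 := h.rep i hi
      rw [Function.update_of_ne hij]
      exact ⟨by rw [hfr _ (stable_addr (by omega) (.inl (by omega))), h1.pc],
        by rw [hfr _ (stable_addr (by omega) (.inl (by omega))), h1.pos],
        fun r hr => by rw [hfr _ (stable_addr hr (.inl (by omega))), h1.reg r hr]⟩
  cnt i hi := by
    by_cases hij : i = j
    · subst hij; simpa using hcnt
    · rw [Function.update_of_ne hij, hfr _ (stable_addr (by omega) (.inl (by omega))), h.cnt i hi]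
  lo i hi := by rw [hfr _ (stable_addr (by omega) (.inr (.inl rfl))), h.lo i hi]
  hi i hi := by rw [hfr _ (stable_addr (by omega) (.inr (.inr rfl))), h.hi i hi]

/-- Block `1`, the output buffer, is not mentioned in `Mem`, so filling it is harmless. -/
theorem Mem.congr_of_buffer (h : Mem M w H cnt reg) (hH : w.length + 6 ≤ H)
    (hfr : ∀ r, 8 ≤ r → r ∉ [13, 14, 15, 16, 17, 21, 23, 24] → (∀ o < H, r ≠ addr H 1 o) →
      reg' r = reg r) : Mem M w H cnt reg' := by
  have hs : ∀ r, r < 32 → 8 ≤ r → r ∉ [13, 14, 15, 16, 17, 21, 23, 24] → reg' r = reg r :=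
    fun r h32 h8 hr => hfr r h8 hr fun _ _ => (addr_ne_small h32).symm
  have ha : ∀ J o, o < H → J ≠ 1 → reg' (addr H J o) = reg (addr H J o) := fun J o ho hJ =>
    hfr _ (by unfold addr; omega) (by simp) fun o' ho' => addr_ne_addr hJ ho ho'
  constructor
  · rw [hs 10, h.len] <;> norm_num
  · rw [hs 11, h.height] <;> norm_num
  · rw [hs 12, h.base] <;> norm_num
  · rw [hs 18, h.one] <;> norm_num
  · rw [hs 19, h.zero] <;> norm_num
  · rw [hs 22, h.twice] <;> norm_num
  · intro p hp
    rw [ha _ _ (by omega) (by omega), h.input p hp]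
  · intro j hj
    have h1 := h.rep j hj
    exact ⟨by rw [ha _ _ (by omega) (by omega), h1.pc],
      by rw [ha _ _ (by omega) (by omega), h1.pos],
      fun r hr => by rw [ha _ _ hr (by omega), h1.reg r hr]⟩
  · intro j hj
    rw [ha _ _ (by omega) (by omega), h.cnt j hj]
  · intro j hj
    rw [ha _ _ (by omega) (by omega), h.lo j hj]
  · intro j hj
    rw [ha _ _ (by omega) (by omega), h.hi j hj]

theorem Mem.congr (h : Mem M w H cnt reg) (hH : w.length + 6 ≤ H)
    (hfr : ∀ r, 8 ≤ r → r ∉ [13, 14, 15, 16, 17, 23, 24] → reg' r = reg r) :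
    Mem M w H cnt reg' :=
  h.congr_of_buffer hH fun r h8 hr _ => hfr r h8 fun h => hr (by
    simp only [List.mem_cons] at h ⊢; tauto)

end Mem

/-- Pass to the next process. -/
def nextProcess : Cmd := .arith .sub 13 13 18 ;; .arith .add 14 22 19

/-- Make one step of the current process. -/
def moveProcess (M : Machine) : Cmd :=
  getCell 5 3 ;; .const 24 (0 : ℕ) ;; simStep M ;; .arith .add 7 6 18 ;; putCell 2 7 ;;
    .ite 6 5 (.const 24 (0 : ℕ)) .skip ;;
    .ite 19 24 (.const 15 (1 : ℕ) ;; .const 13 (0 : ℕ)) (.arith .sub 14 14 18)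

/-- The body of the loop of a round. -/
def roundBody (M : Machine) : Cmd :=
  .arith .mul 23 13 11 ;; .arith .add 23 23 12 ;; getCell 6 2 ;; getCell 7 4 ;;
    .ite 19 14 (.ite 6 7 (moveProcess M) nextProcess) nextProcess

/-- A round: look for a solution. -/
def round (M : Machine) : Cmd :=
  .const 15 (0 : ℕ) ;; .arith .add 13 11 19 ;; .arith .add 14 22 19 ;; .loop 19 13 (roundBody M)

/-- The situation after a successful round. -/
def Found (M : Machine) (w : List ℤ) (H : ℕ) (es : List ℕ) (reg : ℕ → ℤ) : Prop :=
  ∃ (t : ℕ) (v : List ℤ) (cnt : ℕ → ℕ) (J : ℕ), outputAt M w t = some v ∧ Mem M w H cnt reg ∧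
    Amortized H (IsOutputStep M w) cnt H (2 * H) (t :: es) ∧ 2 ≤ J ∧ J < H + 2 ∧
    Delimits H reg J v

/-- Register `R_21` and the output buffer have not changed. -/
def BufferKept (H : ℕ) (s s' : St) : Prop :=
  s'.reg 21 = s.reg 21 ∧ ∀ o < H, s'.reg (addr H 1 o) = s.reg (addr H 1 o)

/-- The effect of a round. -/
def RoundPost (M : Machine) (w : List ℤ) (H : ℕ) (es : List ℕ) (s s' : St) : Prop :=
  BufferKept H s s' ∧ (s'.reg 15 = 1 ∧ Found M w H es s'.reg ∨
    s'.reg 15 = 0 ∧ ∃ cnt b, Mem M w H cnt s'.reg ∧ Amortized H (IsOutputStep M w) cnt 0 b es)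

/-- The state during a round, when the process to move is number `J - 1`. -/
structure Searching (M : Machine) (w : List ℤ) (H : ℕ) (es : List ℕ) (cnt : ℕ → ℕ) (J b : ℕ)
    (s₀ s : St) : Prop where
  mem : Mem M w H cnt s.reg
  amortized : Amortized H (IsOutputStep M w) cnt J b es
  kept : BufferKept H s₀ s
  found : s.reg 15 = 0
  process : s.reg 13 = J
  budget : s.reg 14 = b

section Round

variable {M : Machine} {w w' : List ℤ} {H T L : ℕ} {V : ℤ} {es : List ℕ} {s₀ : St}

theorem BufferKept.trans {s s' : St} (h : BufferKept H s₀ s)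
    (hfr : ∀ r, 8 ≤ r → r ∉ [13, 14, 15, 16, 17, 23, 24] → s'.reg r = s.reg r) :
    BufferKept H s₀ s' :=
  ⟨by rw [hfr 21 (by norm_num) (by norm_num), h.1],
    fun o ho => by rw [hfr _ (by unfold addr; omega) (by simp), h.2 o ho]⟩

theorem nextProcess_spec (hl : Limits H V T) (hH : w.length + 6 ≤ H) {cnt : ℕ → ℕ} {j b : ℕ}
    {s : St} (h : Searching M w H es cnt (j + 1) b s₀ s) (hb : b = 0 ∨ zoneHi H j ≤ cnt j)
    {Q : St → Prop} (hQ : ∀ s, Searching M w H es cnt j (2 * H) s₀ s → Q s) :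
    nextProcess.wp w' V T L Q s := by
  have hT : 2 * H ≤ T := by have := hl.le_T; nlinarith
  have hj := h.amortized.J_le
  rw [nextProcess, wp_seq]
  refine wp_sub (z := (j : ℕ)) (by simp [h.process, h.mem.one]) (hl.abs_nat (by omega)) ?_
  refine wp_add (z := (2 * H : ℕ)) (by simp [St.set_reg, h.mem.twice, h.mem.zero])
    (hl.abs_nat hT) ?_
  have hfr : ∀ r, 8 ≤ r → r ∉ [13, 14, 15, 16, 17, 23, 24] →
      ((s.set 13 (j : ℕ)).set 14 (2 * H : ℕ)).reg r = s.reg r := by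
    intro r h8 hr
    simp only [List.mem_cons, not_or] at hr
    simp [St.set_reg, hr]
  exact hQ _ ⟨h.mem.congr hH hfr, h.amortized.next hb, h.kept.trans hfr,
    by simp [St.set_reg, h.found], by simp [St.set_reg], by simp [St.set_reg]⟩

/-- Realizes `Amortized.advance` (`hQ₁`) or `Amortized.emit` (`hQ₂`), according to whether the
simulated step outputs a word inside the zone. -/
theorem moveProcess_spec (hl : Limits H V T) (hM : Fits M w H)
    (hb : ∀ ins ∈ M, ins.bound + 6 ≤ H) (hlen : M.length + 6 ≤ H) {cnt : ℕ → ℕ} {j b : ℕ}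
    {s : St} (h : Searching M w H es cnt (j + 1) (b + 1) s₀ s) (hlt : cnt j < zoneHi H j)
    (h23 : s.reg 23 = addr H (j + 2) 0) (h6 : s.reg 6 = cnt j)
    {Q : St → Prop}
    (hQ₁ : ∀ s, Searching M w H es (Function.update cnt j (cnt j + 1)) (j + 1) b s₀ s → Q s)
    (hQ₂ : ∀ s, s.reg 13 = 0 → s.reg 19 = 0 → s.reg 15 = 1 → BufferKept H s₀ s →
      Found M w H es s.reg → Q s) :
    (moveProcess M).wp w' V T L Q s := by
  have hT : 2 * H ≤ T := by have := hl.le_T; nlinarith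
  have hjH : j < H := h.amortized.J_le
  have hbH := h.amortized.b_le
  have hwl := hM.length_le
  have hJ : j + 2 < H + 2 := by omega
  -- Inside its zone a process has made fewer than `2 ^ H * H` steps, as `simStep_spec` requires.
  have ht : cnt j ≤ 2 ^ H * H := hlt.le.trans (Nat.mul_le_mul_right _
    (Nat.pow_le_pow_right (by norm_num) hjH.le))
  rw [moveProcess, wp_seq]
  refine wp_getCell hl h23 hJ (by omega) (by norm_num) ?_
  rw [wp_seq]
  refine wp_const_nat hl (by omega) ?_
  rw [wp_seq]
  have hrep := h.mem.rep j hjH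
  refine Cmd.wp_mono _ ?_ _ (simStep_spec hl hM hJ ht hb hlen
    ⟨⟨by simp [St.set_reg, hrep.pc], by simp [St.set_reg, hrep.pos],
      fun r hr => by simp [St.set_reg, hrep.reg r hr]⟩, by simp [St.set_reg, h23],
      by simp [St.set_reg, h.mem.zero], by simp [St.set_reg, h.mem.one],
      by simp [St.set_reg, h.mem.len], fun p hp => by simp [St.set_reg, h.mem.input p hp]⟩)
  rintro s' ⟨-, hpost⟩
  have hfr : ∀ r, Stable H (j + 2) r → s'.reg r = s.reg r := by
    intro r ⟨h8, hr, hra⟩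
    simp only [List.mem_cons, not_or] at hr
    rw [hpost.frame r (by omega) (by omega) (by omega) (by omega)
      (fun o ho hoH => hra o (by omega) (by omega) hoH)]
    simp [St.set_reg, show r ≠ 5 by omega, hr]
  have hsm : ∀ r, r < 32 → 6 ≤ r → r ≠ 16 → r ≠ 17 → r ≠ 24 → s'.reg r = s.reg r := by
    intro r h32 h5 h16 h17 h24
    rw [hpost.frame r (by omega) h16 h17 h24 (fun o ho hoH => (addr_ne_small h32).symm)]
    simp [St.set_reg, h24, show r ≠ 5 by omega]
  have h5' : s'.reg 5 = zoneLo H j := by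
    rw [hpost.frame 5 (by norm_num) (by norm_num) (by norm_num) (by norm_num)
      (fun o ho hoH => (addr_ne_small (by norm_num)).symm)]
    simp [St.set_reg, h.mem.lo j hjH]
  have h6' : s'.reg 6 = cnt j := by
    rw [hsm 6 (by norm_num) (by norm_num) (by norm_num) (by norm_num) (by norm_num), h6]
  have h18' : s'.reg 18 = 1 := by rw [hsm 18, h.mem.one] <;> norm_num
  have h19' : s'.reg 19 = 0 := by rw [hsm 19, h.mem.zero] <;> norm_num
  have h14' : s'.reg 14 = (b + 1 : ℕ) := by rw [hsm 14, h.budget] <;> norm_num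
  have h13' : s'.reg 13 = (j + 1 : ℕ) := by rw [hsm 13, h.process] <;> norm_num
  have h15' : s'.reg 15 = 0 := by rw [hsm 15, h.found] <;> norm_num
  have h23' : s'.reg 23 = addr H (j + 2) 0 := by rw [hsm 23, h23] <;> norm_num
  rw [wp_seq]
  refine wp_add (z := (cnt j : ℤ) + 1) (by simp [h6', h18']) (hl.abs_count ht) ?_
  rw [wp_seq]
  refine wp_putCell hl (by simp [St.set_reg, h23']) hJ (by omega) (by norm_num) ?_
  generalize hs2 : ((s'.set 7 (cnt j + 1)).set 0 (addr H (j + 2) 2)).set (addr H (j + 2) 2)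
    ((s'.set 7 (cnt j + 1)).reg 7) = s2
  have hreg2 : ∀ r, r ≠ 7 → r ≠ 0 → r ≠ addr H (j + 2) 2 → s2.reg r = s'.reg r := by
    intro r h7 h0 h2
    rw [← hs2]; simp [St.set_reg, h7, h0, h2]
  have hcell2 : s2.reg (addr H (j + 2) 2) = (cnt j + 1 : ℕ) := by
    rw [← hs2]; simp [St.set_reg]
  have hrep2 : Represents H s2.reg (j + 2) (run M w (cnt j + 1)) :=
    ⟨by rw [hreg2 _ (by simp) (by simp) (by simp), hpost.rep.pc],
      by rw [hreg2 _ (by simp) (by simp) (by simp), hpost.rep.pos],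
      fun r hr => by rw [hreg2 _ (by simp) (by simp) (by simp; omega), hpost.rep.reg r hr]⟩
  have hfr2 : ∀ r, Stable H (j + 2) r → s2.reg r = s.reg r := by
    intro r hr
    have h8 := hr.1
    rw [hreg2 r (by omega) (by omega) (hr.2.2 2 (by norm_num) (by norm_num) (by omega)), hfr r hr]
  have hkept2 : BufferKept H s₀ s2 :=
    ⟨by rw [hfr2 _ (stable_small (by norm_num) (by norm_num) (by norm_num)), h.kept.1],
      fun o ho => by rw [hfr2 _ (stable_addr ho (.inl (by omega))), h.kept.2 o ho]⟩
  have hmem2 := h.mem.advance hwl hfr2 hrep2 hcell2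
  have hdel2 : ∀ v, Delimits H s'.reg (j + 2) v → Delimits H s2.reg (j + 2) v := by
    rintro v ⟨a, b, ha, hb, h1, h2, h3, rfl⟩
    refine ⟨a, b, ha, hb, by rw [hreg2 _ (by simp) (by simp) (by simp), h1],
      by rw [hreg2 _ (by simp) (by simp) (by simp), h2], h3, ?_⟩
    refine List.map_congr_left fun r hr => ?_
    rw [hreg2 _ (by simp) (by simp) (by simp; omega)]
  rw [← hreg2 5 (by norm_num) (by norm_num) (by simp)] at h5'
  rw [← hreg2 6 (by norm_num) (by norm_num) (by simp)] at h6'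
  rw [← hreg2 18 (by norm_num) (by norm_num) (by simp)] at h18'
  rw [← hreg2 19 (by norm_num) (by norm_num) (by simp)] at h19'
  rw [← hreg2 14 (by norm_num) (by norm_num) (by simp)] at h14'
  rw [← hreg2 13 (by norm_num) (by norm_num) (by simp)] at h13'
  rw [← hreg2 15 (by norm_num) (by norm_num) (by simp)] at h15'
  have hnone := hpost.none
  have hsome := hpost.some
  rw [← hreg2 24 (by norm_num) (by norm_num) (by simp)] at hnone hsome
  have hnone' : outOf M (run M w (cnt j)) = none → s2.reg 24 = 0 := fun h => by
    rw [hnone h]; simp [St.set_reg]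
  clear hnone hs2 hreg2 hcell2 hrep2 hfr2 hfr hsm
  -- Serves both unsuccessful cases: the process is still before its zone, or the step outputs
  -- nothing.
  have hfail : ∀ s3 : St, (∀ r, r ≠ 24 → s3.reg r = s2.reg r) → s3.reg 24 = 0 →
      ¬ (IsOutputStep M w (cnt j) ∧ zoneLo H j ≤ cnt j) →
      (Cmd.ite 19 24 (.const 15 (1 : ℕ) ;; .const 13 (0 : ℕ)) (.arith .sub 14 14 18)).wp w' V T L Q
        s3 := by
    intro s3 hs3 h24 hno
    refine wp_ite (fun hlt' => ?_) (fun _ => ?_)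
    · rw [h24, hs3 19 (by norm_num), h19'] at hlt'
      exact absurd hlt' (lt_irrefl _)
    · refine wp_sub (z := (b : ℕ)) ?_ (hl.abs_nat (by omega)) ?_
      · rw [hs3 14 (by norm_num), hs3 18 (by norm_num), h14', h18']; simp
      · have hfr : ∀ r, 8 ≤ r → r ∉ [13, 14, 15, 16, 17, 23, 24] →
            (s3.set 14 (b : ℕ)).reg r = s2.reg r := by
          intro r h8 hr
          simp only [List.mem_cons, not_or] at hr
          simp [St.set_reg, hr, hs3]
        refine hQ₁ _ ⟨hmem2.congr hwl hfr, h.amortized.advance hlt hno, hkept2.trans hfr,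
          ?_, ?_, ?_⟩
        · simp [St.set_reg, hs3, h15']
        · simp [St.set_reg, hs3, h13']
        · simp [St.set_reg]
  rw [wp_seq]
  refine wp_ite (fun hlo => ?_) (fun hge => ?_)
  · rw [h5', h6'] at hlo
    -- Before its zone a process ignores outputs: they belong to lower processes.
    refine wp_const_nat hl (by omega) ?_
    refine hfail _ (fun r hr => by simp [St.set_reg, hr]) (by simp [St.set_reg]) ?_
    rintro ⟨-, hlo'⟩
    omega
  · rw [h5', h6'] at hge
    rw [wp_skip]
    rcases hout : outOf M (run M w (cnt j)) with _ | v
    · refine hfail _ (fun r hr => rfl) (hnone' hout) ?_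
      rintro ⟨hp, -⟩
      rw [IsOutputStep, outputAt_eq, hout] at hp
      simp at hp
    · obtain ⟨h24, hdel⟩ := hsome v hout
      refine wp_ite (fun _ => ?_) (fun hlt' => ?_)
      · rw [wp_seq]
        refine wp_const_nat hl (by omega) ?_
        refine wp_const_nat hl (by omega) ?_
        have hfr : ∀ r, r ≠ 13 → r ≠ 15 →
            ((s2.set 15 (1 : ℕ)).set 13 (0 : ℕ)).reg r = s2.reg r := by
          intro r h13 h15
          simp [St.set_reg, h13, h15]
        have hfr' : ∀ r, 8 ≤ r → r ∉ [13, 14, 15, 16, 17, 23, 24] →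
            ((s2.set 15 (1 : ℕ)).set 13 (0 : ℕ)).reg r = s2.reg r := by
          intro r h8 hr
          simp only [List.mem_cons, not_or] at hr
          exact hfr r hr.1 hr.2.2.1
        refine hQ₂ _ (by simp [St.set_reg]) (by simp [St.set_reg, h19']) (by simp [St.set_reg])
          (hkept2.trans hfr') ⟨cnt j, v, _, j + 2, hout, hmem2.congr hwl hfr',
          h.amortized.emit hlt ?_ (by omega), by omega, hJ, ?_⟩
        · rw [IsOutputStep, outputAt_eq, hout]; rfl
        · obtain ⟨a, b, ha, hb, h1, h2, h3, h4⟩ := hdel2 v hdel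
          exact ⟨a, b, ha, hb, by rw [hfr _ (by norm_num) (by norm_num), h1],
            by rw [hfr _ (by norm_num) (by norm_num), h2], h3, by
              rw [h4]
              exact List.map_congr_left fun r hr => by rw [hfr _ (by simp) (by simp)]⟩
      · rw [h19', h24] at hlt'
        norm_num at hlt'

/-- Each process uses at most `2 * H` simulated steps and one change of turn, which gives `H * (2 *
H + 1)` iterations up to a last budget term; hence the condition on `L`. -/
theorem round_spec (hl : Limits H V T) (hM : Fits M w H)
    (hb : ∀ ins ∈ M, ins.bound + 6 ≤ H) (hlen : M.length + 6 ≤ H)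
    (hL : (H + 1) * (2 * H + 1) ≤ L) {cnt : ℕ → ℕ} {s : St} (hmem : Mem M w H cnt s.reg)
    (ham : Amortized H (IsOutputStep M w) cnt H (2 * H) es) :
    (round M).wp w' V T L (RoundPost M w H es s) s := by
  have hT : 2 * H ≤ T := by have := hl.le_T; nlinarith
  have hwl := hM.length_le
  rw [round, wp_seq]
  refine wp_const_nat hl (by omega) ?_
  rw [wp_seq]
  refine wp_add (z := (H : ℕ)) (by simp [St.set_reg, hmem.height, hmem.zero])
    (hl.abs_nat (by omega)) ?_
  rw [wp_seq]
  refine wp_add (z := (2 * H : ℕ)) (by simp [St.set_reg, hmem.twice, hmem.zero])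
    (hl.abs_nat (by omega)) ?_
  -- The measure `J * (2 * H + 1) + b` drops with each step, and also when a fresh budget `2 * H` is
  -- handed to the next process. The second alternative is the exit after a success, forced by
  -- setting `R_13` to `0`.
  refine Cmd.wp_loop (fun m s' =>
    (∃ cnt J b, Searching M w H es cnt J b s s' ∧ J * (2 * H + 1) + b ≤ m) ∨
    (s'.reg 13 = 0 ∧ s'.reg 19 = 0 ∧ s'.reg 15 = 1 ∧ BufferKept H s s' ∧ Found M w H es s'.reg))
    ?_ (m := H * (2 * H + 1) + 2 * H) (by linarith) ?_
  · rintro m s' (⟨cnt, J, b, h, hm⟩ | ⟨h13, h19, h15, hk, hf⟩)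
    · refine ⟨fun hlt => ?_, fun hlt => ?_⟩
      · rw [h.mem.zero, h.process] at hlt
        obtain ⟨j, rfl⟩ : ∃ j, J = j + 1 := ⟨J - 1, by omega⟩
        have hjH : j < H := h.amortized.J_le
        have hmpos : 0 < m := lt_of_lt_of_le (by positivity) hm
        refine ⟨m - 1, by omega, ?_⟩
        have hjH2 : (j + 1) * H ≤ T :=
          (Nat.mul_le_mul_right H (show j + 1 ≤ H + 2 by omega)).trans
            (by have := hl.le_T; omega)
        have haT : addr H (j + 2) 0 ≤ T := (addr_le (by omega) (by omega)).trans hl.le_T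
        rw [roundBody, wp_seq]
        refine wp_mul (z := ((j + 1) * H : ℕ)) (by simp [h.process, h.mem.height])
          (hl.abs_nat hjH2) ?_
        rw [wp_seq]
        refine wp_add (z := addr H (j + 2) 0)
          (by simp [St.set_reg, h.mem.base, addr]; ring) (hl.abs_nat haT) ?_
        rw [wp_seq]
        refine wp_getCell hl (by simp [St.set_reg]) (by omega : j + 2 < H + 2) (by omega)
          (by norm_num) ?_
        rw [wp_seq]
        refine wp_getCell hl (by simp [St.set_reg]) (by omega : j + 2 < H + 2) (by omega)
          (by norm_num) ?_
        simp only [St.set_reg, St.set_set, addr_eq_small,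
          show (6 : ℕ) < 32 by norm_num, show (23 : ℕ) < 32 by norm_num, if_false,
          h.mem.cnt j hjH, h.mem.hi j hjH]
        generalize hs2 : ((s'.set 23 (addr H (j + 2) 0)).set 6 (cnt j)).set 7 (zoneHi H j) = s2
        have hfr : ∀ r, 8 ≤ r → r ≠ 23 → s2.reg r = s'.reg r := by
          intro r h8 hr
          rw [← hs2]
          simp [St.set_reg, hr, show r ≠ 6 by omega, show r ≠ 7 by omega]
        have hfr' : ∀ r, 8 ≤ r → r ∉ [13, 14, 15, 16, 17, 23, 24] → s2.reg r = s'.reg r := by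
          intro r h8 hr
          simp only [List.mem_cons, not_or] at hr
          exact hfr r h8 hr.2.2.2.2.2.1
        have h' : Searching M w H es cnt (j + 1) b s s2 := ⟨h.mem.congr hwl hfr', h.amortized,
          h.kept.trans hfr', by rw [hfr 15 (by norm_num) (by norm_num), h.found],
          by rw [hfr 13 (by norm_num) (by norm_num), h.process],
          by rw [hfr 14 (by norm_num) (by norm_num), h.budget]⟩
        have h6 : s2.reg 6 = cnt j := by rw [← hs2]; simp [St.set_reg]
        have h7 : s2.reg 7 = zoneHi H j := by rw [← hs2]; simp [St.set_reg]
        have h23 : s2.reg 23 = addr H (j + 2) 0 := by rw [← hs2]; simp [St.set_reg]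
        have hbH := h.amortized.b_le
        have hm' : j * (2 * H + 1) + 2 * H ≤ m - 1 := by rw [add_mul] at hm; omega
        refine wp_ite (fun hlt1 => wp_ite (fun hlt2 => ?_) (fun hlt2 => ?_)) (fun hlt1 => ?_)
        · rw [h'.mem.zero, h'.budget] at hlt1
          rw [h6, h7] at hlt2
          obtain ⟨b, rfl⟩ : ∃ c, b = c + 1 := ⟨b - 1, by omega⟩
          refine moveProcess_spec hl hM hb hlen h' (by omega) h23 h6 (fun s3 h3 => ?_)
            (fun s3 h13 h19 h15 hk hf => .inr ⟨h13, h19, h15, hk, hf⟩)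
          exact .inl ⟨_, _, _, h3, by omega⟩
        · rw [h6, h7] at hlt2
          exact nextProcess_spec hl hwl h' (.inr (by omega)) fun s3 h3 => .inl ⟨_, _, _, h3, hm'⟩
        · rw [h'.mem.zero, h'.budget] at hlt1
          exact nextProcess_spec hl hwl h' (.inl (by omega)) fun s3 h3 => .inl ⟨_, _, _, h3, hm'⟩
      · rw [h.mem.zero, h.process] at hlt
        obtain rfl : J = 0 := by omega
        exact ⟨h.kept, .inr ⟨h.found, cnt, b, h.mem, h.amortized⟩⟩
    · refine ⟨fun hlt => ?_, fun _ => ⟨hk, .inl ⟨h15, hf⟩⟩⟩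
      rw [h13, h19] at hlt
      exact absurd hlt (lt_irrefl _)
  · left
    have hfr : ∀ r, 8 ≤ r → r ∉ [13, 14, 15, 16, 17, 23, 24] →
        (((s.set 15 (0 : ℕ)).set 13 (H : ℕ)).set 14 (2 * H : ℕ)).reg r = s.reg r := by
      intro r h8 hr
      simp only [List.mem_cons, not_or] at hr
      simp [St.set_reg, hr]
    exact ⟨cnt, H, 2 * H, ⟨hmem.congr hwl hfr, ham,
      BufferKept.trans (s := s) ⟨rfl, fun _ _ => rfl⟩ hfr, by simp [St.set_reg],
      by simp [St.set_reg], by simp [St.set_reg]⟩, le_rfl⟩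

end Round

/-! ## The output buffer -/

/-- Copy the word delimited by `R_16` and `R_17` into the output buffer, and its last address there
into `R_21`. -/
def copyWord : Cmd :=
  .arith .add 1 16 19 ;; .arith .add 2 12 19 ;; .arith .add 3 17 18 ;;
    .loop 1 3 (.load 4 1 ;; .store 2 4 ;; .arith .add 1 1 18 ;; .arith .add 2 2 18) ;;
    .arith .sub 21 2 18

/-- The output buffer contains the word `v`. -/
structure Buffered (H : ℕ) (reg : ℕ → ℤ) (v : List ℤ) : Prop where
  last : reg 21 = addr H 1 0 + v.length - 1
  length_le : v.length ≤ H
  cells : ∀ o, o < v.length → reg (addr H 1 o) = v.getD o 0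

/-- The word waits in the buffer during the following round, whence the clause `BufferKept` in
`RoundPost`. -/
theorem Buffered.congr {H : ℕ} {s s' : St} {v : List ℤ} (h : Buffered H s.reg v)
    (hk : BufferKept H s s') : Buffered H s'.reg v :=
  ⟨by rw [hk.1, h.last], h.length_le, fun o ho => by
    rw [hk.2 o (ho.trans_le h.length_le), h.cells o ho]⟩

section Copy

variable {M : Machine} {w w' : List ℤ} {H T L J : ℕ} {V : ℤ} {cnt : ℕ → ℕ} {s : St}

/-- If the range is empty, its ends may be far outside the block; they are then compared but never
used as addresses. -/
theorem copyWord_spec (hl : Limits H V T) (hH : w.length + 6 ≤ H)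
    (hL : (H + 1) * (2 * H + 1) ≤ L) (hmem : Mem M w H cnt s.reg)
    (hJ : 2 ≤ J) (hJH : J < H + 2) {v : List ℤ} (hv : Delimits H s.reg J v) :
    copyWord.wp w' V T L (fun s' => Mem M w H cnt s'.reg ∧ Buffered H s'.reg v) s := by
  have hHT : H ≤ T := by have := hl.le_T; nlinarith
  obtain ⟨a, b, ha, hb, h16, h17, hab, hv⟩ := hv
  have hlen : v.length = b + 1 - a := by simp [hv]
  have hbig : ∀ x, x < 2 ^ H → ∀ y : ℕ, y ≤ 1 → |(addr H J (5 + x) : ℤ) + y| ≤ V := by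
    intro x hx y hy
    have h1 : addr H J 5 ≤ T := (addr_le hJH (by omega)).trans hl.le_T
    have h2 : addr H J (5 + x) = addr H J 5 + x := by simp [addr, add_assoc]
    have h3 : ((addr H J 5 : ℕ) : ℤ) ≤ T := by exact_mod_cast h1
    have h4 : (x : ℤ) < 2 ^ H := by exact_mod_cast hx
    have h5 : (y : ℤ) ≤ 1 := by exact_mod_cast hy
    have h6 := hl.le_V
    have h7 : (2 : ℤ) ^ H ≤ 2 ^ H * (H + 1) := le_mul_of_one_le_right (by positivity) (by linarith)
    rw [abs_of_nonneg (by positivity), h2]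
    push_cast
    linarith
  -- The value `o = H` is included because the writing pointer ends one cell past the word.
  have hbuf : ∀ o, o ≤ H → addr H 1 o ≤ T := fun o ho =>
    le_trans (by unfold addr; nlinarith) hl.le_T
  rw [copyWord, wp_seq]
  refine wp_add (z := addr H J (5 + a)) (by simp [h16, hmem.zero])
    (by simpa using hbig a ha 0 (by norm_num)) ?_
  rw [wp_seq]
  refine wp_add (z := addr H 1 0) (by simp [St.set_reg, hmem.base, hmem.zero])
    (hl.abs_nat (hbuf 0 (by omega))) ?_
  rw [wp_seq]
  refine wp_add (z := addr H J (5 + b) + 1) (by simp [St.set_reg, h17, hmem.one])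
    (by simpa using hbig b hb 1 le_rfl) ?_
  rw [wp_seq]
  -- After `o` letters the reading pointer is at offset `a + o` and the writing pointer at `o`. The
  -- source block differs from block `1`, so the letters still to be copied are intact.
  refine Cmd.wp_loop (fun m s' => ∃ o, o ≤ v.length ∧ v.length - o ≤ m ∧
    s'.reg 1 = addr H J (5 + (a + o)) ∧ s'.reg 2 = addr H 1 o ∧ s'.reg 3 = addr H J (5 + b) + 1 ∧
    (∀ i < o, s'.reg (addr H 1 i) = v.getD i 0) ∧
    ∀ r, 5 ≤ r → (∀ o < H, r ≠ addr H 1 o) → s'.reg r = s.reg r) ?_ (m := H) (by nlinarith) ?_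
  · rintro m s' ⟨o, ho, hm, h1, h2, h3, hcells, hfr⟩
    have hs : ∀ r, r < 32 → 5 ≤ r → s'.reg r = s.reg r := fun r h32 h5 =>
      hfr r h5 fun _ _ => (addr_ne_small h32).symm
    have h18 : s'.reg 18 = 1 := by rw [hs 18, hmem.one] <;> norm_num
    refine ⟨fun hlt => ?_, fun hlt => ?_⟩
    · have hob : a + o ≤ b := by
        rw [h1, h3] at hlt
        simp only [addr] at hlt
        push_cast at hlt
        omega
      have hbH := hab (by omega)
      refine ⟨m - 1, by omega, ?_⟩
      -- The reading pointer may end on the first cell after block `J`, still within the address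
      -- limit.
      have haT : ∀ i, i ≤ 5 + b + 1 → addr H J i ≤ T := fun i hi => by
        have := addr_le hJH hbH
        have h5 : addr H J i ≤ addr H J (5 + b) + 1 := by unfold addr; omega
        by_cases hi' : i < H
        · exact (addr_le hJH hi').trans hl.le_T
        · have hH2 : (J + 1) * H ≤ (H + 2) * H := Nat.mul_le_mul_right H (by omega)
          refine le_trans ?_ hl.le_T
          unfold addr
          rw [add_mul] at hH2
          omega
      rw [wp_seq]
      refine wp_load h1 (haT _ (by omega)) ?_
      rw [wp_seq]
      refine wp_store (a := addr H 1 o) (by simp [St.set_reg, h2]) (hbuf o (by omega)) ?_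
      rw [wp_seq]
      refine wp_add (z := addr H J (5 + (a + (o + 1)))) (by
        simp [St.set_reg, h1, h18]; simp [addr]; ring) (hl.abs_nat (haT _ (by omega))) ?_
      refine wp_add (z := addr H 1 (o + 1)) (by
        simp [St.set_reg, h2, h18]; simp [addr]; ring) (hl.abs_nat (hbuf _ (by omega))) ?_
      refine ⟨o + 1, by omega, by omega, by simp [St.set_reg], by simp [St.set_reg],
        by simp [St.set_reg, h3], fun i hi => ?_, fun r h5 hr => ?_⟩
      · by_cases hio : i = o
        · subst hio
          have h6 : s'.reg (addr H J (5 + (a + i))) = s.reg (addr H J (5 + (a + i))) :=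
            hfr _ (by unfold addr; omega) fun o' ho' => addr_ne_addr (by omega) (by omega) ho'
          rw [hv, List.getD_eq_getElem _ _ (by simp; omega)]
          simp [St.set_reg, h6]
        · simp [St.set_reg, hio, hcells i (by omega)]
      · simp [St.set_reg, hr o (by omega), hfr r h5 hr, show r ≠ 1 by omega, show r ≠ 2 by omega,
          show r ≠ 4 by omega]
    · have hob : o = v.length := by
        rw [h1, h3] at hlt
        simp only [addr] at hlt
        push_cast at hlt
        omega
      have hoH : o ≤ H := by
        by_cases h : a ≤ b
        · have := hab h; omega
        · omega
      have hz : |(addr H 1 0 : ℤ) + v.length - 1| ≤ V := by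
        have h5 := hl.abs_nat (hbuf o hoH)
        rw [addr_add] at h5
        have h6 : (1 : ℤ) ≤ addr H 1 0 := by unfold addr; push_cast; omega
        rw [abs_of_nonneg (by omega)] at h5 ⊢
        omega
      refine wp_sub (z := (addr H 1 0 : ℤ) + v.length - 1) (by rw [h2, h18, hob, addr_add]) hz ?_
      refine ⟨hmem.congr_of_buffer hH fun r h8 hr hrb => ?_, by simp [St.set_reg], by omega,
        fun i hi => ?_⟩
      · simp only [List.mem_cons, not_or] at hr
        simp [St.set_reg, hr, hfr r (by omega) hrb]
      · simp [St.set_reg, hcells i (by omega)]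
  · refine ⟨0, by simp, ?_, by simp [St.set_reg], by simp [St.set_reg], by simp [St.set_reg],
      by simp, fun r h5 _ => by
        simp [St.set_reg, show r ≠ 1 by omega, show r ≠ 2 by omega, show r ≠ 3 by omega]⟩
    by_cases h : a ≤ b
    · have := hab h; omega
    · omega

theorem copyWord_varsLt : copyWord.VarsLt 32 := by simp [copyWord, Cmd.VarsLt]

theorem round_varsLt (M : Machine) : (round M).VarsLt 32 := by
  simp [round, roundBody, moveProcess, nextProcess, getCell, putCell, Cmd.VarsLt, simStep_varsLt]

end Copy

/-! ## Initialization -/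

/-- Copy the input into block `0`. -/
def readInput : Cmd :=
  .const 18 (1 : ℕ) ;; .const 19 (0 : ℕ) ;; .const 3 (32 : ℕ) ;; .read 1 ;;
    .loop 19 1 (.store 3 1 ;; .arith .add 3 3 18 ;; .read 1)

/-- Multiply `R_11` by the `m`-th power of `R_1`. -/
def mulPow : ℕ → Cmd
  | 0 => .skip
  | m + 1 => .arith .mul 11 11 1 ;; mulPow m

/-- Compute the parameters from the length of the input. -/
def setParams (c : ℕ) : Cmd :=
  .const 2 (32 : ℕ) ;; .arith .sub 10 3 2 ;; .const 1 c ;; .arith .add 1 1 10 ;;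
    .const 11 (1 : ℕ) ;; mulPow c ;; .arith .add 12 2 11 ;; .arith .add 22 11 11

/-- Write down the limits of the zones. -/
def setZones : Cmd :=
  .const 3 (0 : ℕ) ;; .arith .add 4 11 19 ;; .arith .add 13 18 19 ;; .arith .add 5 11 18 ;;
    .loop 13 5 (.arith .mul 23 13 11 ;; .arith .add 23 23 12 ;; putCell 3 3 ;; putCell 4 4 ;;
      .arith .add 3 4 19 ;; .arith .add 4 4 4 ;; .arith .add 13 13 18)

/-- Initialization. -/
def initMemory (c : ℕ) : Cmd := readInput ;; setParams c ;; setZones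

section Init

variable {M : Machine} {w : List ℤ} {H T L c : ℕ} {V : ℤ} {s : St}

theorem wp_read {d : ℕ} {Q : St → Prop} (h : |w.getD s.pos 0| ≤ V)
    (hQ : Q ⟨(s.set d (w.getD s.pos 0)).reg, s.pos + 1⟩) : (Cmd.read d).wp w V T L Q s := ⟨h, hQ⟩

/-- Letters are represented by positive integers, so the first `0` read marks the end of the input.
The memory behind the input is left zero. -/
theorem readInput_spec (hl : Limits H V T) (hH : w.length + 6 ≤ H) (hL : H ≤ L)
    (hw : ∀ a ∈ w, 0 < a ∧ |a| < 2 ^ H) (h0 : ∀ r, s.reg r = 0) (hpos : s.pos = 0)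
    {Q : St → Prop}
    (hQ : ∀ s : St, s.reg 18 = 1 → s.reg 19 = 0 → s.reg 3 = (32 + w.length : ℕ) →
      (∀ p, p < w.length → s.reg (32 + p) = w.getD p 0) →
      (∀ r, 32 + w.length ≤ r → s.reg r = 0) → Q s) :
    readInput.wp w V T L Q s := by
  have hT : 32 + 2 * H ≤ T := le_trans (by nlinarith) hl.le_T
  have hgetD : ∀ p, |w.getD p 0| ≤ V := by
    intro p
    by_cases hp : p < w.length
    · rw [List.getD_eq_getElem _ _ hp]
      exact hl.abs_of_lt (hw _ (List.getElem_mem hp)).2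
    · rw [List.getD_eq_default _ _ (by omega)]
      exact hl.abs_nat (Nat.zero_le T)
  rw [readInput, wp_seq]
  refine wp_const_nat hl (by omega) ?_
  rw [wp_seq]
  refine wp_const_nat hl (by omega) ?_
  rw [wp_seq]
  refine wp_const_nat hl (by omega) ?_
  rw [wp_seq]
  refine wp_read (hgetD _) ?_
  -- `R_1` holds a letter read ahead, so the tape position is `p + 1` when `p` letters are stored.
  refine Cmd.wp_loop (fun m s' => ∃ p, p ≤ w.length ∧ w.length - p ≤ m ∧ s'.reg 18 = 1 ∧
    s'.reg 19 = 0 ∧ s'.reg 3 = (32 + p : ℕ) ∧ s'.reg 1 = w.getD p 0 ∧ s'.pos = p + 1 ∧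
    (∀ i, i < p → s'.reg (32 + i) = w.getD i 0) ∧ ∀ r, 32 + p ≤ r → s'.reg r = 0) ?_
    (m := H) hL ?_
  · rintro m s' ⟨p, hp, hm, h18, h19, h3, h1, hpos', hin, hz⟩
    refine ⟨fun hlt => ?_, fun hlt => ?_⟩
    · have hpl : p < w.length := by
        by_contra hge
        rw [h19, h1, List.getD_eq_default _ _ (by omega)] at hlt
        exact lt_irrefl _ hlt
      refine ⟨m - 1, by omega, ?_⟩
      rw [wp_seq]
      refine wp_store h3 (by omega) ?_
      rw [wp_seq]
      refine wp_add (z := (32 + (p + 1) : ℕ)) (by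
        simp [St.set_reg, h3, h18, show 3 ≠ 32 + p by omega, show 18 ≠ 32 + p by omega]
        ring) (hl.abs_nat (by omega)) ?_
      refine wp_read (hgetD _) ?_
      refine ⟨p + 1, by omega, by omega, ?_, ?_, ?_, ?_, ?_, fun i hi => ?_, fun r hr => ?_⟩
      · simp [St.set_reg, h18, show 18 ≠ 32 + p by omega]
      · simp [St.set_reg, h19, show 19 ≠ 32 + p by omega]
      · simp [St.set_reg]
      · simp [St.set_reg, hpos']
      · simp [hpos']
      · by_cases hip : i = p
        · subst hip
          simp [St.set_reg, h1, show 32 + i ≠ 1 by omega, show 32 + i ≠ 3 by omega]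
        · simp [St.set_reg, hip, hin i (by omega), show 32 + i ≠ 1 by omega,
            show 32 + i ≠ 3 by omega]
      · simp [St.set_reg, hz r (by omega), show r ≠ 1 by omega, show r ≠ 3 by omega,
          show r ≠ 32 + p by omega]
    · have hpl : p = w.length := by
        by_contra hne
        have hplt : p < w.length := by omega
        rw [h19, h1, List.getD_eq_getElem _ _ hplt] at hlt
        exact hlt (hw _ (List.getElem_mem hplt)).1
      subst hpl
      exact hQ s' h18 h19 h3 hin hz
  · refine ⟨0, by simp, by omega, ?_, ?_, ?_, ?_, ?_, by simp, fun r hr => ?_⟩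
    · simp [St.set_reg]
    · simp [St.set_reg]
    · simp [St.set_reg]
    · simp [St.set_reg, hpos]
    · simp [hpos]
    · simp [St.set_reg, h0, show r ≠ 1 by omega, show r ≠ 3 by omega, show r ≠ 18 by omega,
        show r ≠ 19 by omega]

/-- The exponent is a constant of the machine, so the power is computed by unrolled multiplications;
all intermediate powers are at most the last one since `x ≥ 1`. -/
theorem mulPow_spec (hl : Limits H V T) {x : ℕ} (hx : 1 ≤ x) (m : ℕ) : ∀ (i : ℕ) (s : St),
    x ^ (i + m) ≤ T → s.reg 1 = x → s.reg 11 = (x ^ i : ℕ) → ∀ Q : St → Prop,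
    Q (s.set 11 (x ^ (i + m) : ℕ)) → (mulPow m).wp w V T L Q s := by
  induction m with
  | zero =>
    intro i s hT h1 h11 Q hQ
    have : s.set 11 (x ^ (i + 0) : ℕ) = s := by
      ext r
      · rw [St.set_reg]; split_ifs with h
        · rw [h, h11]; rfl
        · rfl
      · rfl
    rwa [this] at hQ
  | succ m ih =>
    intro i s hT h1 h11 Q hQ
    have h2 : x ^ (i + 1) ≤ x ^ (i + (m + 1)) := Nat.pow_le_pow_right hx (by omega)
    rw [mulPow, wp_seq]
    refine wp_mul (z := (x ^ (i + 1) : ℕ)) (by rw [h1, h11]; push_cast; ring)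
      (hl.abs_nat (h2.trans hT)) ?_
    refine ih (i + 1) _ (by rwa [add_right_comm, add_assoc]) (by simp [St.set_reg, h1])
      (by simp [St.set_reg]) Q ?_
    rw [St.set_set, add_right_comm, add_assoc]
    exact hQ

theorem setParams_spec (hl : Limits H V T) (hH : w.length + 6 ≤ H) (hc : 1 ≤ c)
    (hHc : H = (w.length + c) ^ c) (h18 : s.reg 18 = 1) (h19 : s.reg 19 = 0)
    (h3 : s.reg 3 = (32 + w.length : ℕ)) {Q : St → Prop}
    (hQ : ∀ s' : St, s'.reg 10 = w.length → s'.reg 11 = H → s'.reg 12 = addr H 1 0 →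
      s'.reg 18 = 1 → s'.reg 19 = 0 → s'.reg 22 = 2 * H → (∀ r, 32 ≤ r → s'.reg r = s.reg r) →
      Q s') :
    (setParams c).wp w V T L Q s := by
  have hT : 32 + 2 * H ≤ T := le_trans (by nlinarith) hl.le_T
  have hcH : w.length + c ≤ H := by
    rw [hHc]; exact Nat.le_self_pow (by omega) _
  rw [setParams, wp_seq]
  refine wp_const_nat hl (by omega) ?_
  rw [wp_seq]
  refine wp_sub (z := w.length) (by simp [St.set_reg, h3]) (hl.abs_nat (by omega)) ?_
  rw [wp_seq]
  refine wp_const_nat hl (by omega) ?_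
  rw [wp_seq]
  refine wp_add (z := (w.length + c : ℕ)) (by simp [St.set_reg, add_comm]) (hl.abs_nat (by omega)) ?_
  rw [wp_seq]
  refine wp_const_nat hl (by omega) ?_
  rw [wp_seq]
  refine mulPow_spec hl (x := w.length + c) (by omega) c 0 _ (by rw [zero_add, ← hHc]; omega)
    (by simp [St.set_reg]) (by simp [St.set_reg]) _ ?_
  rw [zero_add, ← hHc, wp_seq]
  refine wp_add (z := addr H 1 0) (by simp [St.set_reg, addr])
    (hl.abs_nat (by unfold addr; omega)) ?_
  refine wp_add (z := (2 * H : ℕ)) (by simp [St.set_reg]; ring) (hl.abs_nat (by omega)) ?_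
  refine hQ _ ?_ ?_ ?_ ?_ ?_ ?_ fun r hr => ?_
  · simp [St.set_reg]
  · simp [St.set_reg]
  · simp [St.set_reg]
  · simp [St.set_reg, h18]
  · simp [St.set_reg, h19]
  · simp [St.set_reg]
  · simp [St.set_reg, show r ≠ 1 by omega, show r ≠ 2 by omega, show r ≠ 10 by omega,
      show r ≠ 11 by omega, show r ≠ 12 by omega, show r ≠ 22 by omega]

theorem Limits.abs_zoneHi (hl : Limits H V T) {j : ℕ} (hj : j ≤ H) : |(zoneHi H j : ℤ)| ≤ V := by
  have h1 : zoneHi H j ≤ 2 ^ H * H := zoneHi_mono H hj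
  have h2 := hl.abs_count h1
  rw [abs_of_nonneg (by positivity)] at h2 ⊢
  linarith

theorem setZones_spec (hl : Limits H V T) (hH : w.length + 6 ≤ H) (hL : H ≤ L)
    (h10 : s.reg 10 = w.length) (h11 : s.reg 11 = H) (h12 : s.reg 12 = addr H 1 0)
    (h18 : s.reg 18 = 1) (h19 : s.reg 19 = 0) (h22 : s.reg 22 = 2 * H)
    (hin : ∀ p, p < w.length → s.reg (addr H 0 p) = w.getD p 0)
    (hz : ∀ j o, j < H → o < H → s.reg (addr H (j + 2) o) = 0) :
    setZones.wp w V T L (fun s' => Mem M w H (fun _ => 0) s'.reg) s := by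
  have hT : 32 + 2 * H ≤ T := le_trans (by nlinarith) hl.le_T
  rw [setZones, wp_seq]
  refine wp_const_nat hl (by omega) ?_
  rw [wp_seq]
  refine wp_add (z := (H : ℕ)) (by simp [St.set_reg, h11, h19]) (hl.abs_nat (by omega)) ?_
  rw [wp_seq]
  refine wp_add (z := (1 : ℕ)) (by simp [St.set_reg, h18, h19]) (hl.abs_nat (by omega)) ?_
  rw [wp_seq]
  refine wp_add (z := (H + 1 : ℕ)) (by simp [St.set_reg, h11, h18]) (hl.abs_nat (by omega)) ?_
  -- `R_13` runs over `k + 1` because block `k + 2` starts at `(k + 1) * H` after block `1`, the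
  -- same address computation as in a round.
  refine Cmd.wp_loop (fun m s' => ∃ k, k ≤ H ∧ H - k ≤ m ∧ s'.reg 3 = zoneLo H k ∧
    s'.reg 4 = zoneHi H k ∧ s'.reg 13 = (k + 1 : ℕ) ∧ s'.reg 5 = (H + 1 : ℕ) ∧
    (∀ j < k, s'.reg (addr H (j + 2) 3) = zoneLo H j ∧ s'.reg (addr H (j + 2) 4) = zoneHi H j) ∧
    ∀ r, 8 ≤ r → r ≠ 13 → r ≠ 23 →
      (∀ j, j < H → r ≠ addr H (j + 2) 3 ∧ r ≠ addr H (j + 2) 4) → s'.reg r = s.reg r) ?_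
    (m := H) hL ?_
  · rintro m s' ⟨k, hk, hm, h3, h4, h13, h5, hzone, hfr⟩
    have hs : ∀ r, r < 32 → 8 ≤ r → r ≠ 13 → r ≠ 23 → s'.reg r = s.reg r := fun r h32 h8 ha hb =>
      hfr r h8 ha hb fun _ _ => ⟨(addr_ne_small h32).symm, (addr_ne_small h32).symm⟩
    have h11' : s'.reg 11 = H := by rw [hs 11, h11] <;> norm_num
    have h12' : s'.reg 12 = addr H 1 0 := by rw [hs 12, h12] <;> norm_num
    have h18' : s'.reg 18 = 1 := by rw [hs 18, h18] <;> norm_num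
    have h19' : s'.reg 19 = 0 := by rw [hs 19, h19] <;> norm_num
    refine ⟨fun hlt => ?_, fun hlt => ?_⟩
    · have hkH : k < H := by rw [h13, h5] at hlt; omega
      refine ⟨m - 1, by omega, ?_⟩
      have hkH2 : (k + 1) * H ≤ T :=
        (Nat.mul_le_mul_right H (show k + 1 ≤ H + 2 by omega)).trans
          (by have := hl.le_T; omega)
      have haT : addr H (k + 2) 0 ≤ T := (addr_le (by omega) (by omega)).trans hl.le_T
      rw [wp_seq]
      refine wp_mul (z := ((k + 1) * H : ℕ)) (by simp [h13, h11']) (hl.abs_nat hkH2) ?_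
      rw [wp_seq]
      refine wp_add (z := addr H (k + 2) 0)
        (by simp [St.set_reg, h12', addr]; ring) (hl.abs_nat haT) ?_
      rw [wp_seq]
      refine wp_putCell hl (by simp [St.set_reg]) (by omega : k + 2 < H + 2) (by omega)
        (by norm_num) ?_
      rw [wp_seq]
      refine wp_putCell hl (by simp [St.set_reg]) (by omega : k + 2 < H + 2) (by omega)
        (by norm_num) ?_
      rw [wp_seq]
      refine wp_add (z := zoneHi H k) (by simp [St.set_reg, h4, h19'])
        (hl.abs_zoneHi hk) ?_
      rw [wp_seq]
      -- The last doubling produces `2 ^ H * H`, which is never stored but must respect the value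
      -- limit.
      refine wp_add (z := zoneHi H (k + 1)) (by simp [St.set_reg, h4, zoneHi]; ring)
        (hl.abs_zoneHi hkH) ?_
      refine wp_add (z := (k + 1 + 1 : ℕ)) (by simp [St.set_reg, h13, h18'])
        (hl.abs_nat (by omega)) ?_
      refine ⟨k + 1, hkH, by omega, ?_, ?_, ?_, ?_, fun j hj => ?_, fun r h8 hr13 hr23 hr => ?_⟩
      · simp [St.set_reg, zoneLo]
      · simp [St.set_reg]
      · simp [St.set_reg]
      · simp [St.set_reg, h5]
      · by_cases hjk : j = k
        · subst hjk
          simp [St.set_reg, h3, h4]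
        · have ha : ∀ o o', o < H → o' < H → addr H (j + 2) o ≠ addr H (k + 2) o' :=
            fun o o' ho ho' => addr_ne_addr (by omega) ho ho'
          simp [St.set_reg, hzone j (by omega), ha 3 3 (by omega) (by omega),
            ha 3 4 (by omega) (by omega), ha 4 3 (by omega) (by omega),
            ha 4 4 (by omega) (by omega)]
      · simp [St.set_reg, hr13, hr23, (hr k hkH).1, (hr k hkH).2, hfr r h8 hr13 hr23 hr,
          show r ≠ 0 by omega, show r ≠ 3 by omega, show r ≠ 4 by omega]
    · have hkH : k = H := by rw [h13, h5] at hlt; omega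
      subst hkH
      -- Untouched cells are zero, and a block of zeros already represents the initial configuration
      -- with step counter `0`.
      have ha : ∀ j o, j < k → o < k → o ≠ 3 → o ≠ 4 → s'.reg (addr k (j + 2) o) = 0 := by
        intro j o hj ho ho3 ho4
        rw [hfr _ (by unfold addr; omega) (by simp) (by simp), hz j o hj ho]
        intro i hi
        by_cases hij : i = j
        · subst hij; simp [ho3, ho4]
        · exact ⟨addr_ne_addr (by omega) ho (by omega), addr_ne_addr (by omega) ho (by omega)⟩
      constructor
      · rw [hs 10, h10] <;> norm_num
      · exact h11'
      · exact h12'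
      · exact h18'
      · exact h19'
      · rw [hs 22, h22] <;> norm_num
      · intro p hp
        rw [hfr _ (by unfold addr; omega) (by simp) (by simp), hin p hp]
        exact fun i hi => ⟨addr_ne_addr (by omega) (by omega) (by omega),
          addr_ne_addr (by omega) (by omega) (by omega)⟩
      · intro j hj
        exact ⟨by rw [ha j 0 hj (by omega) (by norm_num) (by norm_num)]; rfl,
          by rw [ha j 1 hj (by omega) (by norm_num) (by norm_num)]; rfl,
          fun r hr => by rw [ha j (5 + r) hj hr (by omega) (by omega)]; rfl⟩
      · intro j hj
        rw [ha j 2 hj (by omega) (by norm_num) (by norm_num)]; rfl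
      · exact fun j hj => (hzone j hj).1
      · exact fun j hj => (hzone j hj).2
  · refine ⟨0, by simp, by omega, ?_, ?_, ?_, ?_, by simp, fun r h8 h13 h23 _ => ?_⟩
    · simp [St.set_reg, zoneLo]
    · simp [St.set_reg, zoneHi]
    · simp [St.set_reg]
    · simp [St.set_reg]
    · simp [St.set_reg, h13, show r ≠ 3 by omega, show r ≠ 4 by omega, show r ≠ 5 by omega]

theorem initMemory_spec (hl : Limits H V T) (hH : w.length + 6 ≤ H) (hL : H ≤ L)
    (hw : ∀ a ∈ w, 0 < a ∧ |a| < 2 ^ H) (hc : 1 ≤ c) (hHc : H = (w.length + c) ^ c) :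
    (initMemory c).wp w V T L (fun s' => Mem M w H (fun _ => 0) s'.reg) Config.init.st := by
  rw [initMemory, wp_seq]
  refine readInput_spec hl hH hL hw (fun _ => rfl) rfl fun s h18 h19 h3 hin hz => ?_
  rw [wp_seq]
  refine setParams_spec hl hH hc hHc h18 h19 h3 fun s' h10' h11' h12' h18' h19' h22' hfr => ?_
  refine setZones_spec hl hH hL h10' h11' h12' h18' h19' h22' (fun p hp => ?_)
    fun j o hj ho => ?_
  · rw [hfr _ (by unfold addr; omega), ← hin p hp]; simp [addr]
  · rw [hfr _ (by unfold addr; omega), hz]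
    unfold addr
    nlinarith

theorem mulPow_varsLt (m : ℕ) : (mulPow m).VarsLt 32 := by
  induction m with
  | zero => trivial
  | succ m ih => simp [mulPow, Cmd.VarsLt, ih]

theorem initMemory_varsLt (c : ℕ) : (initMemory c).VarsLt 32 := by
  simp [initMemory, readInput, setParams, setZones, putCell, Cmd.VarsLt, mulPow_varsLt]

end Init

/-! ## Runs with outputs -/

/-- From configuration `c`, the machine outputs the words `vs`, with at most `K` steps before the
first output and between outputs, and stops right after the last one. -/
inductive Emits (P : Machine) (w : List ℤ) (V : ℤ) (T K : ℕ) : Config → List (List ℤ) → Prop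
  | halt {n : ℕ} {c c' : Config} : n ≤ K → Silent P w V T n c c' → c'.Bounded V T →
      outOf P c' = none → step P w c' = none → Emits P w V T K c []
  | last {n : ℕ} {c c' c'' : Config} {v : List ℤ} : n ≤ K → Silent P w V T n c c' →
      c'.Bounded V T → outOf P c' = some v → step P w c' = some c'' → c''.Bounded V T →
      outOf P c'' = none → step P w c'' = none → Emits P w V T K c [v]
  | cons {n : ℕ} {c c' c'' : Config} {v : List ℤ} {vs : List (List ℤ)} : n ≤ K →
      Silent P w V T n c c' → c'.Bounded V T → outOf P c' = some v → step P w c' = some c'' →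
      vs ≠ [] → Emits P w V T K c'' vs → Emits P w V T K c (v :: vs)

/-- The properties of a run that outputs the words `vs` from time `t₀` on. -/
structure Behaves (P : Machine) (w : List ℤ) (V : ℤ) (T K t₀ : ℕ) (vs : List (List ℤ)) : Prop where
  bounded : ∀ t, t₀ ≤ t → (run P w t).Bounded V T
  mem_iff : ∀ v, (∃ t, t₀ ≤ t ∧ outputAt P w t = some v) ↔ v ∈ vs
  unique : vs.Nodup → ∀ v s t, t₀ ≤ s → t₀ ≤ t → outputAt P w s = some v →
    outputAt P w t = some v → s = t
  halts : ∃ t, Halted P w t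
  halted_of_last : ∀ t, t₀ ≤ t → IsOutputStep P w t → (∀ s, t < s → ¬ IsOutputStep P w s) →
    Halted P w (t + 1)
  first : vs ≠ [] → ∃ t, t₀ ≤ t ∧ t ≤ t₀ + K ∧ IsOutputStep P w t
  next : ∀ t, t₀ ≤ t → IsOutputStep P w t → (∃ s, t < s ∧ IsOutputStep P w s) →
    ∃ s, t < s ∧ s ≤ t + 1 + K ∧ IsOutputStep P w s
  halts_of_nil : vs = [] → ∃ t, t ≤ t₀ + K ∧ Halted P w t

section Behaves

variable {P : Machine} {w : List ℤ} {V : ℤ} {T K : ℕ}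

/-- Transfers a relational run to the time axis, where outputs and costs are defined. -/
theorem Silent.run {n t₀ : ℕ} {c c' : Config} (h : Silent P w V T n c c')
    (hc : EnumRAM.run P w t₀ = c) : EnumRAM.run P w (t₀ + n) = c' ∧
      ∀ t, t₀ ≤ t → t < t₀ + n →
        (EnumRAM.run P w t).Bounded V T ∧ outputAt P w t = none := by
  induction h generalizing t₀ with
  | refl => exact ⟨hc, fun t _ _ => by omega⟩
  | @step n c c₁ c' hb ho hs _ ih =>
    subst hc
    obtain ⟨h1, h2⟩ := ih (run_succ_of_some hs)
    refine ⟨by rw [← h1]; congr 1; omega, fun t h3 h4 => ?_⟩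
    rcases h3.eq_or_lt with rfl | h3
    · exact ⟨hb, ho⟩
    · exact h2 t h3 (by omega)

theorem run_of_stopped {t : ℕ} (hb : (run P w t).Bounded V T) (ho : outOf P (run P w t) = none)
    (hs : step P w (run P w t) = none) {s : ℕ} (h : t ≤ s) :
    (run P w s).Bounded V T ∧ outputAt P w s = none := by
  obtain ⟨k, rfl⟩ := Nat.exists_eq_add_of_le h
  rw [outputAt_eq, run_add_of_none hs]
  exact ⟨hb, ho⟩

theorem isOutputStep_of_some {t : ℕ} {v : List ℤ} (h : outputAt P w t = some v) :
    IsOutputStep P w t := by simp [IsOutputStep, h]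

theorem not_isOutputStep_of_none {t : ℕ} (h : outputAt P w t = none) :
    ¬ IsOutputStep P w t := by simp [IsOutputStep, h]

/-- Every segment of the run takes at most `K` silent steps, and the run stops after the segment
that follows the last word. The requirement `vs ≠ []` in `Emits.cons` makes the stop immediate after
the last output. -/
theorem Emits.behaves {c : Config} {vs : List (List ℤ)} (h : Emits P w V T K c vs) :
    ∀ t₀, run P w t₀ = c → Behaves P w V T K t₀ vs := by
  induction h with
  | @halt n c c' hn hsil hb ho hs =>
    intro t₀ hc
    obtain ⟨rfl, h1⟩ := hsil.run hc
    have hall : ∀ t, t₀ ≤ t → (run P w t).Bounded V T ∧ outputAt P w t = none := fun t ht => by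
      by_cases hlt : t < t₀ + n
      · exact h1 t ht hlt
      · exact run_of_stopped hb ho hs (not_lt.1 hlt)
    exact {
      bounded := fun t ht => (hall t ht).1
      mem_iff := fun v => by
        simp only [List.not_mem_nil, iff_false]
        rintro ⟨t, ht, h⟩
        simp [(hall t ht).2] at h
      unique := fun _ v s t hs' _ h _ => by simp [(hall s hs').2] at h
      halts := ⟨_, hs⟩
      halted_of_last := fun t ht h => absurd h (not_isOutputStep_of_none (hall t ht).2)
      first := fun h => absurd rfl h
      next := fun t ht h => absurd h (not_isOutputStep_of_none (hall t ht).2)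
      halts_of_nil := fun _ => ⟨t₀ + n, by omega, hs⟩ }
  | @last n c c' c'' v hn hsil hb ho hs hb' ho' hs' =>
    intro t₀ hc
    obtain ⟨rfl, h1⟩ := hsil.run hc
    obtain rfl := run_succ_of_some hs
    have hall : ∀ t, t₀ ≤ t → (run P w t).Bounded V T ∧
        (t ≠ t₀ + n → outputAt P w t = none) := fun t ht => by
      rcases lt_trichotomy t (t₀ + n) with hlt | rfl | hlt
      · exact ⟨(h1 t ht hlt).1, fun _ => (h1 t ht hlt).2⟩
      · exact ⟨hb, fun h => absurd rfl h⟩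
      · have := run_of_stopped hb' ho' hs' hlt
        exact ⟨this.1, fun _ => this.2⟩
    have honly : ∀ t, t₀ ≤ t → IsOutputStep P w t → t = t₀ + n := fun t ht h => by
      by_contra hne
      exact not_isOutputStep_of_none ((hall t ht).2 hne) h
    exact {
      bounded := fun t ht => (hall t ht).1
      mem_iff := fun u => by
        rw [List.mem_singleton]
        constructor
        · rintro ⟨t, ht, h⟩
          obtain rfl := honly t ht (isOutputStep_of_some h)
          rw [outputAt_eq, ho] at h
          exact (Option.some.inj h).symm
        · rintro rfl
          exact ⟨_, by omega, ho⟩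
      unique := fun _ v s t hs' ht h h' => by
        rw [honly s hs' (isOutputStep_of_some h), honly t ht (isOutputStep_of_some h')]
      halts := ⟨_, hs'⟩
      halted_of_last := fun t ht h _ => by rw [honly t ht h]; exact hs'
      first := fun _ => ⟨t₀ + n, by omega, by omega, isOutputStep_of_some ho⟩
      next := fun t ht h ⟨s, hs1, hs2⟩ => by
        have := honly t ht h
        have := honly s (by omega) hs2
        omega
      halts_of_nil := fun h => by simp at h }
  | @cons n c c' c'' v vs hn hsil hb ho hs hvs _ ih =>
    intro t₀ hc
    obtain ⟨rfl, h1⟩ := hsil.run hc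
    have h2 := ih _ (run_succ_of_some hs)
    have hcase : ∀ t, t₀ ≤ t → (outputAt P w t = none ∧ t < t₀ + n) ∨ t = t₀ + n ∨
        t₀ + n + 1 ≤ t := fun t ht => by
      rcases lt_trichotomy t (t₀ + n) with hlt | h | hlt
      · exact .inl ⟨(h1 t ht hlt).2, hlt⟩
      · exact .inr (.inl h)
      · exact .inr (.inr hlt)
    have ho' : ∀ u, outputAt P w (t₀ + n) = some u → u = v := fun u h => by
      rw [outputAt_eq, ho] at h
      exact (Option.some.inj h).symm
    exact {
      bounded := fun t ht => by
        rcases lt_trichotomy t (t₀ + n) with hlt | rfl | hlt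
        · exact (h1 t ht hlt).1
        · exact hb
        · exact h2.bounded t hlt
      mem_iff := fun u => by
        rw [List.mem_cons, ← h2.mem_iff]
        constructor
        · rintro ⟨t, ht, h⟩
          rcases hcase t ht with ⟨h', -⟩ | rfl | h'
          · simp [h'] at h
          · exact .inl (ho' u h)
          · exact .inr ⟨t, h', h⟩
        · rintro (rfl | ⟨t, ht, h⟩)
          · exact ⟨_, by omega, ho⟩
          · exact ⟨t, by omega, h⟩
      unique := fun hnd u s t hs' ht h h' => by
        rw [List.nodup_cons] at hnd
        rcases hcase s hs' with ⟨h3, -⟩ | h3 | h3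
        · simp [h3] at h
        · rcases hcase t ht with ⟨h4, -⟩ | h4 | h4
          · simp [h4] at h'
          · omega
          · subst h3
            exact absurd ((h2.mem_iff v).1 ⟨t, h4, ho' u h ▸ h'⟩) hnd.1
        · rcases hcase t ht with ⟨h4, -⟩ | h4 | h4
          · simp [h4] at h'
          · subst h4
            exact absurd ((h2.mem_iff v).1 ⟨s, h3, ho' u h' ▸ h⟩) hnd.1
          · exact h2.unique hnd.2 u s t h3 h4 h h'
      halts := h2.halts
      halted_of_last := fun t ht h hlast => by
        rcases hcase t ht with ⟨h3, -⟩ | rfl | h3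
        · exact absurd h (not_isOutputStep_of_none h3)
        · obtain ⟨s, hs1, -, hs2⟩ := h2.first hvs
          exact absurd hs2 (hlast s (by omega))
        · exact h2.halted_of_last t h3 h hlast
      first := fun _ => ⟨t₀ + n, by omega, by omega, isOutputStep_of_some ho⟩
      next := fun t ht h hex => by
        rcases hcase t ht with ⟨h3, -⟩ | rfl | h3
        · exact absurd h (not_isOutputStep_of_none h3)
        · obtain ⟨s, hs1, hs3, hs2⟩ := h2.first hvs
          exact ⟨s, by omega, hs3, hs2⟩
        · exact h2.next t h3 h hex
      halts_of_nil := fun h => by simp at h }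

end Behaves

/-! ## The amortized machine -/

/-- The first part of the amortized machine. -/
def startCmd (M : Machine) (c : ℕ) : Cmd := initMemory c ;; round M

/-- The part of the amortized machine that is repeated after each solution found. -/
def loopCmd (M : Machine) : Cmd := copyWord ;; round M

/-- The machine that regularizes the delay of `M`. A solution is output only when the next one has
been found or when it is known to be the last one. -/
def amortize (M : Machine) (c : ℕ) : Machine :=
  (startCmd M c).compile 0 ++
    (.jumpLt 19 15 ((startCmd M c).size + 2) :: .halt ::
      ((loopCmd M).compile ((startCmd M c).size + 2) ++
        [.jumpLt 19 15 ((startCmd M c).size + 2 + (loopCmd M).size + 3), .output 12 21, .halt,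
          .output 12 21, .jump ((startCmd M c).size + 2)]))

/-- What is needed to amortize the machine `M` on input tape `w`, which outputs `m` words. -/
structure Amortizable (M : Machine) (w : List ℤ) (c H m : ℕ) : Prop where
  fits : Fits M w H
  bound : ∀ ins ∈ M, ins.bound + 6 ≤ H
  length_le : M.length + 6 ≤ H
  tape : ∀ a ∈ w, 0 < a ∧ |a| < 2 ^ H
  one_le : 1 ≤ c
  height : H = (w.length + c) ^ c
  finite : (Set.ofPred (IsOutputStep M w)).Finite
  card : m = (Set.ofPred (IsOutputStep M w)).ncard
  le_two_pow : m ≤ 2 ^ (H - 1)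
  nth_lt : ∀ i, 1 ≤ i → i ≤ m → Nat.nth (IsOutputStep M w) (i - 1) < i * H

section Amortize

variable {M : Machine} {w : List ℤ} {c H m T L : ℕ} {V : ℤ}

/-- Translates the bound on the time of the `i`-th output into the count of outputs among the first
`i * H` steps that the combinatorial lemma needs. -/
theorem Amortizable.complete (h : Amortizable M w c H m) {cnt : ℕ → ℕ} {b : ℕ} {es : List ℕ}
    (ha : Amortized H (IsOutputStep M w) cnt 0 b es) : ∀ t, IsOutputStep M w t → t ∈ es := by
  classical
  have hcard : ∀ hf : (Set.ofPred (IsOutputStep M w)).Finite, m = hf.toFinset.card := fun hf =>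
    h.card.trans (Set.ncard_eq_toFinset_card _ hf)
  refine ha.complete (m := m) (fun i hi => ?_) (fun t ht => ?_) h.le_two_pow
  · rcases Nat.eq_zero_or_pos i with rfl | hpos
    · simp
    · have h1 := h.nth_lt i hpos hi
      have h2 : IsOutputStep M w (Nat.nth (IsOutputStep M w) (i - 1)) :=
        Nat.nth_mem _ fun hf => by have := hcard hf; omega
      have h3 := Nat.count_nth (p := IsOutputStep M w) (n := i - 1)
        (fun hf => by have := hcard hf; omega)
      have h4 := Nat.count_monotone (IsOutputStep M w) (Nat.succ_le_of_lt h1)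
      rw [Nat.succ_eq_add_one, Nat.count_succ, h3, if_pos h2] at h4
      omega
  · rw [hcard h.finite]
    exact Nat.count_lt_card h.finite ht

/-- For the empty word `R_21` is one less than `R_12`; it is still nonnegative, so the instruction
outputs the empty word instead of stopping the machine. -/
theorem Buffered.outOf {P : Machine} {cfg : Config} {v : List ℤ} (h : Buffered H cfg.reg v)
    (h12 : cfg.reg 12 = addr H 1 0) (hP : P[cfg.pc]? = some (.output 12 21)) :
    outOf P cfg = some v := by
  have h1 : 32 ≤ addr H 1 0 := by unfold addr; omega
  have h21 := h.last
  unfold EnumRAM.outOf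
  rw [hP]
  simp only
  rw [if_pos ⟨by rw [h12]; positivity, by rw [h21]; omega⟩, h12, h21,
    show ((addr H 1 0 : ℤ) + v.length - 1).toNat + 1 - (addr H 1 0 : ℤ).toNat = v.length by omega]
  congr 1
  refine List.ext_getElem (by simp) fun i h2 h3 => ?_
  have h4 := h.cells i h3
  rw [List.getD_eq_getElem _ _ h3] at h4
  simp only [List.getElem_map, List.getElem_range', Int.toNat_natCast, one_mul]
  rw [← h4]
  simp [addr]

/-- The situation when the repeated part of the amortized machine is entered. -/
theorem emits_loop (hl : Limits H V T) (hL : (H + 1) * (2 * H + 1) ≤ L)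
    (h : Amortizable M w c H m) {K₀ : ℕ} (hK₀ : 1 ≤ K₀) (d : ℕ) : ∀ (es : List ℕ) (c₀ c₁ : Config)
    (n : ℕ), m ≤ es.length + d → n ≤ K₀ →
      Silent (amortize M c) w V T n c₀ c₁ → c₁.Bounded V T → c₁.pc = (startCmd M c).size + 2 →
      Found M w H es c₁.reg →
      ∃ ts vs, Emits (amortize M c) w V T (K₀ + (loopCmd M).timeBound.eval L + 1) c₀ vs ∧
        vs ≠ [] ∧ List.Forall₂ (fun t v => outputAt M w t = some v) ts vs ∧
        (es.reverse ++ ts).Nodup ∧ ∀ t, IsOutputStep M w t → t ∈ es.reverse ++ ts := by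
  induction d with
  | zero =>
    rintro es c₀ c₁ n hm - - - - ⟨t, v, cnt, J, ht, hmem, ham, hJ, hJH, hdel⟩
    -- `Found` provides `es.length + 1` distinct output steps of `M`, more than the `m` that exist.
    exfalso
    have h1 : (t :: es).toFinset ⊆ h.finite.toFinset := fun s hs => by
      rw [Set.Finite.mem_toFinset]
      exact ((ham.mem_iff s).1 (List.mem_toFinset.1 hs)).1
    have h2 := Finset.card_le_card h1
    rw [List.toFinset_card_of_nodup ham.nodup, ← Set.ncard_eq_toFinset_card _ h.finite, ← h.card,
      List.length_cons] at h2
    omega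
  | succ d ih =>
    rintro es c₀ c₁ n hm hn hsil hb hpc ⟨t, v, cnt, J, ht, hmem, ham, hJ, hJH, hdel⟩
    have hwl := h.fits.length_le
    have hT32 : 32 + 2 * H ≤ T := le_trans (by nlinarith) hl.le_T
    have hcode : CodeAt (amortize M c) ((startCmd M c).size + 2)
        ((loopCmd M).compile ((startCmd M c).size + 2) ++
        [.jumpLt 19 15 ((startCmd M c).size + 2 + (loopCmd M).size + 3), .output 12 21, .halt,
          .output 12 21, .jump ((startCmd M c).size + 2)]) := by
      have h0 : CodeAt (amortize M c) 0 (amortize M c) := ⟨[], [], by simp, rfl⟩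
      have h1 := CodeAt.right h0
      rw [Cmd.length_compile, zero_add] at h1
      exact h1.tail.tail
    have hwp : (loopCmd M).wp w V T L (fun s' => Buffered H s'.reg v ∧
        (s'.reg 15 = 1 ∧ Found M w H (t :: es) s'.reg ∨
        s'.reg 15 = 0 ∧ ∃ cnt b, Mem M w H cnt s'.reg ∧
          Amortized H (IsOutputStep M w) cnt 0 b (t :: es))) c₁.st := by
      rw [loopCmd, wp_seq]
      refine Cmd.wp_mono _ ?_ _ (copyWord_spec (w := w) hl hwl hL (s := c₁.st) hmem hJ hJH hdel)
      rintro s ⟨hmem', hbuf⟩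
      refine Cmd.wp_mono _ ?_ _ (round_spec hl h.fits h.bound h.length_le hL hmem' ham)
      exact fun s' hs' => ⟨hbuf.congr hs'.1, hs'.2⟩
    obtain ⟨n₂, hn₂, c₂, hsil₂, hpc₂, hb₂, hbuf, hpost⟩ := Cmd.sound (P := amortize M c) (K := 32)
      (T := T) (by omega) (loopCmd M) _ _ c₁ ⟨copyWord_varsLt, round_varsLt M⟩ hcode.left hb hpc hwp
    have hcode₂ := hcode.right
    rw [Cmd.length_compile] at hcode₂
    generalize (startCmd M c).size + 2 = o at *
    generalize o + (loopCmd M).size = e at *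
    have hbuf : Buffered H c₂.reg v := hbuf
    have h21T : (c₂.reg 21).toNat ≤ T := by
      rw [hbuf.last]
      have := hbuf.length_le
      unfold addr
      push_cast
      omega
    have h12 : c₂.reg 12 = addr H 1 0 := by
      rcases hpost with ⟨-, _, _, _, _, _, h1, _⟩ | ⟨-, _, _, h1, _⟩ <;> exact h1.base
    have h19 : c₂.reg 19 = 0 := by
      rcases hpost with ⟨-, _, _, _, _, _, h1, _⟩ | ⟨-, _, _, h1, _⟩ <;> exact h1.zero
    have hstep₂ := Silent.single (w := w) hb₂ (hpc₂ ▸ hcode₂.head) (by simp) rfl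
    have hmax : max 19 15 ≤ T := by norm_num; omega
    have houtstep : ∀ c' : Config, (amortize M c)[c'.pc]? = some (.output 12 21) →
        c'.reg = c₂.reg → c'.Bounded V T → ∃ c'' : Config, step (amortize M c) w c' = some c'' ∧
          c''.pc = c'.pc + 1 ∧ c''.reg = c₂.reg ∧ c''.Bounded V T := by
      intro c' hP hreg hb'
      have h1 : 0 ≤ c'.reg 12 ∧ 0 ≤ c'.reg 21 := by
        rw [hreg, h12, hbuf.last]
        unfold addr
        push_cast
        omega
      refine ⟨{ c' with pc := c'.pc + 1,
                        top := max c'.top ((Instr.output 12 21).maxIndex c'.reg) },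
        by simp [step, hP, Instr.exec, h1], rfl, hreg, hb'.goto _ _ ?_⟩
      simp only [Instr.maxIndex, hreg]
      split_ifs <;> simp <;> omega
    rcases hpost with ⟨h15, hfound⟩ | ⟨h15, cnt', b', hmem', ham'⟩
    · have hlt : c₂.reg 19 < c₂.reg 15 := by
        rw [h19, show c₂.reg 15 = 1 from h15]; norm_num
      simp only [hlt, if_true] at hstep₂
      rw [hpc₂] at hstep₂
      have hb₃ := hb₂.goto (e + 3) c₂.pos hmax
      have hP₃ := hcode₂.tail.tail.tail.head
      obtain ⟨c₄, hstep₄, hpc₄, hreg₄, hb₄⟩ := houtstep ⟨e + 3, c₂.reg, c₂.pos, _⟩ hP₃ rfl hb₃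
      simp only at hpc₄
      have hP₄ := hcode₂.tail.tail.tail.tail.head
      have hstep₅ := Silent.single (w := w) hb₄
        (show (amortize M c)[c₄.pc]? = _ by rw [hpc₄]; exact hP₄) (by simp) rfl
      -- The next segment starts after the output instruction, with the single jump back as its
      -- silent prefix; hence `n = 1` and the assumption `1 ≤ K₀`.
      obtain ⟨ts, vs, hem, hvs, hf, hnd, hall⟩ := ih (t :: es) c₄ _ 1 (by simp; omega) hK₀ hstep₅
        (hb₄.goto o _ (by simp [Instr.maxIndex])) rfl 
        (by change Found M w H (t :: es) c₄.reg; rw [hreg₄]; exact hfound)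
      refine ⟨t :: ts, v :: vs, ?_, by simp, .cons ht hf, by simpa using hnd, by simpa using hall⟩
      exact .cons (n := n + n₂ + 1) (by omega) ((hsil.trans hsil₂).trans hstep₂) hb₃
        (Buffered.outOf hbuf h12 hP₃) hstep₄ hvs hem
    · have hlt : ¬ c₂.reg 19 < c₂.reg 15 := by
        rw [h19, show c₂.reg 15 = 0 from h15]; norm_num
      simp only [hlt, if_false] at hstep₂
      rw [hpc₂] at hstep₂
      have hb₃ := hb₂.goto (e + 1) c₂.pos hmax
      have hP₃ := hcode₂.tail.head
      obtain ⟨c₄, hstep₄, hpc₄, hreg₄, hb₄⟩ := houtstep ⟨e + 1, c₂.reg, c₂.pos, _⟩ hP₃ rfl hb₃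
      simp only at hpc₄
      have hP₄ := hcode₂.tail.tail.head
      rw [← hpc₄] at hP₄
      -- The round has failed, so `t` was the last solution: it is output and the program halts.
      refine ⟨[t], [v], ?_, by simp, .cons ht .nil, by
        rw [← List.nodup_reverse]; simpa using ham'.nodup,
        fun s hs => by simpa [or_comm] using h.complete ham' s hs⟩
      exact .last (n := n + n₂ + 1) (by omega) ((hsil.trans hsil₂).trans hstep₂) hb₃
        (Buffered.outOf hbuf h12 hP₃) hstep₄ hb₄ (by simp [EnumRAM.outOf, hP₄])
        (by simp [step, hP₄, Instr.exec])

/-- Two program parts enter the delay before the first output: initialization with a first round,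
then a copy with a second round, as the first word is held back. -/
theorem emits_amortize (hl : Limits H V T) (hL : (H + 1) * (2 * H + 1) ≤ L)
    (h : Amortizable M w c H m) :
    ∃ ts vs, Emits (amortize M c) w V T
        ((startCmd M c).timeBound.eval L + 1 + (loopCmd M).timeBound.eval L + 1) Config.init vs ∧
      List.Forall₂ (fun t v => outputAt M w t = some v) ts vs ∧
        ts.Nodup ∧ ∀ t, IsOutputStep M w t → t ∈ ts := by
  have hwl := h.fits.length_le
  have hT32 : 32 + 2 * H ≤ T := le_trans (by nlinarith) hl.le_T
  have hcode : CodeAt (amortize M c) 0 (amortize M c) := ⟨[], [], by simp, rfl⟩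
  have hwp : (startCmd M c).wp w V T L (fun s' =>
      (s'.reg 15 = 1 ∧ Found M w H [] s'.reg ∨
      s'.reg 15 = 0 ∧ ∃ cnt b, Mem M w H cnt s'.reg ∧
        Amortized H (IsOutputStep M w) cnt 0 b [])) Config.init.st := by
    rw [startCmd, wp_seq]
    refine Cmd.wp_mono _ ?_ _ (initMemory_spec (M := M) hl hwl (by nlinarith) h.tape h.one_le
      h.height)
    intro s hmem
    refine Cmd.wp_mono _ ?_ _ (round_spec hl h.fits h.bound h.length_le hL hmem (.init _ _))
    exact fun s' hs' => hs'.2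
  have hb₀ : Config.init.Bounded V T := by
    refine ⟨fun r => ?_, Nat.zero_le _⟩
    simpa [Config.init] using hl.abs_nat (Nat.zero_le T)
  obtain ⟨n, hn, c₁, hsil, hpc, hb, hpost⟩ := Cmd.sound (P := amortize M c) (K := 32)
    (T := T) (by omega) (startCmd M c) 0 _ Config.init ⟨initMemory_varsLt c, round_varsLt M⟩
    hcode.left hb₀ rfl hwp
  have hcode₁ := CodeAt.right hcode
  rw [Cmd.length_compile] at hcode₁
  have h19 : c₁.reg 19 = 0 := by
    rcases hpost with ⟨-, _, _, _, _, _, h1, _⟩ | ⟨-, _, _, h1, _⟩ <;> exact h1.zero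
  have hstep := Silent.single (w := w) hb (hpc ▸ hcode₁.head) (by simp) rfl
  have hmax : max 19 15 ≤ T := by norm_num; omega
  rcases hpost with ⟨h15, hfound⟩ | ⟨h15, cnt', b', hmem', ham'⟩
  · have hlt : c₁.reg 19 < c₁.reg 15 := by
      rw [h19, show c₁.reg 15 = 1 from h15]; norm_num
    simp only [hlt, if_true] at hstep
    obtain ⟨ts, vs, hem, -, hf, hnd, hall⟩ := emits_loop hl hL h
      (K₀ := (startCmd M c).timeBound.eval L + 1) (by omega) m [] Config.init _ (n + 1) (by simp)
      (by omega) (hsil.trans hstep) (hb.goto _ _ hmax) rfl hfound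
    exact ⟨ts, vs, hem, hf, by simpa using hnd, by simpa using hall⟩
  · have hlt : ¬ c₁.reg 19 < c₁.reg 15 := by
      rw [h19, show c₁.reg 15 = 0 from h15]; norm_num
    simp only [hlt, if_false] at hstep
    rw [hpc] at hstep
    have hP := hcode₁.tail.head
    refine ⟨[], [], ?_, .nil, .nil, h.complete ham'⟩
    exact .halt (n := n + 1) (by omega) (hsil.trans hstep) (hb.goto _ _ hmax)
      (by simp only [EnumRAM.outOf]; rw [hP]) (by simp only [step]; rw [hP]; rfl)

end Amortize

/-! ## Polynomial bounds -/

theorem exists_eval_le_mul_pow (p : Polynomial ℕ) :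
    ∃ C b : ℕ, ∀ n, p.eval n ≤ C * (n + 1) ^ b := by
  induction p using Polynomial.induction_on' with
  | add p q hp hq =>
    obtain ⟨C, b, h1⟩ := hp
    obtain ⟨D, d, h2⟩ := hq
    refine ⟨C + D, b + d, fun n => ?_⟩
    rw [Polynomial.eval_add, add_mul]
    have h3 : (n + 1) ^ b ≤ (n + 1) ^ (b + d) := Nat.pow_le_pow_right (by omega) (by omega)
    have h4 : (n + 1) ^ d ≤ (n + 1) ^ (b + d) := Nat.pow_le_pow_right (by omega) (by omega)
    exact add_le_add ((h1 n).trans (Nat.mul_le_mul_left _ h3))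
      ((h2 n).trans (Nat.mul_le_mul_left _ h4))
  | monomial b a =>
    refine ⟨a, b, fun n => ?_⟩
    rw [Polynomial.eval_monomial]
    exact Nat.mul_le_mul_left _ (Nat.pow_le_pow_left (by omega) _)

theorem exists_eval_le_pow (p : Polynomial ℕ) :
    ∃ c : ℕ, 1 ≤ c ∧ ∀ n, p.eval n ≤ (n + c) ^ c := by
  obtain ⟨C, b, h⟩ := exists_eval_le_mul_pow p
  refine ⟨C + b + 1, by omega, fun n => (h n).trans ?_⟩
  calc C * (n + 1) ^ b ≤ (n + (C + b + 1)) * (n + (C + b + 1)) ^ b :=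
        Nat.mul_le_mul (by omega) (Nat.pow_le_pow_left (by omega) _)
    _ = (n + (C + b + 1)) ^ (b + 1) := by rw [pow_succ]; ring
    _ ≤ (n + (C + b + 1)) ^ (C + b + 1) := Nat.pow_le_pow_right (by omega) (by omega)

/-! ## Solutions and output steps -/

section Solutions

variable {k : ℕ} {A : EnumProblem k} {M : Machine}

theorem code_eq (x : Word k) : code x = x.map fun a : Fin k => (a.val : ℤ) + 1 := by
  simp only [code, List.bind_eq_flatMap, List.pure_def]
  induction x with
  | nil => rfl
  | cons a x ih => simpa using ih

theorem code_injective : Function.Injective (code : Word k → List ℤ) := fun x y h => by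
  rw [code_eq, code_eq] at h
  exact List.map_injective_iff.2 (fun a b h => Fin.ext (by simpa using h)) h

theorem length_code (x : Word k) : (code x).length = x.length := by simp [code_eq]

/-- A word of length at most `q` is determined by its first `q` entries in `Option (Fin k)`. A bound
exponential in a polynomial suffices, because `H` zones reach up to `2 ^ (H - 1) * H`. -/
theorem ncard_le_of_length_le {S : Set (Word k)} {q : ℕ} (h : ∀ y ∈ S, y.length ≤ q) :
    S.ncard ≤ 2 ^ ((k + 1) * q) := by
  have hinj : Set.InjOn (fun (y : Word k) (i : Fin q) => y[(i : ℕ)]?) S := by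
    intro y hy z hz hyz
    refine List.ext_getElem? fun i => ?_
    by_cases hi : i < q
    · exact congrFun hyz ⟨i, hi⟩
    · have := h y hy
      have := h z hz
      rw [List.getElem?_eq_none (by omega), List.getElem?_eq_none (by omega)]
  have h1 := Set.ncard_le_ncard_of_injOn (t := Set.univ) _ (fun _ _ => Set.mem_univ _) hinj
    Set.finite_univ
  rw [Set.ncard_univ, Nat.card_eq_fintype_card] at h1
  simp only [Fintype.card_pi, Fintype.card_option, Fintype.card_fin, Finset.prod_const,
    Finset.card_univ] at h1
  calc S.ncard ≤ (k + 1) ^ q := h1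
    _ ≤ (2 ^ (k + 1)) ^ q := Nat.pow_le_pow_left Nat.lt_two_pow_self.le _
    _ = 2 ^ ((k + 1) * q) := by rw [pow_mul]

theorem Solves.finite (h : Solves M A) (x : Word k) :
    (Set.ofPred (IsOutputStep M (code x))).Finite := by
  obtain ⟨t, ht⟩ := h.halts x
  refine (Set.finite_lt_nat (t + 1)).subset fun s (hs : IsOutputStep M (code x) s) => ?_
  by_contra hts
  obtain ⟨d, rfl⟩ := Nat.exists_eq_add_of_le (show t ≤ s by simp at hts; omega)
  have h1 := step_isSome_of_outOf (w := code x) (show (outOf M (run M (code x) (t + d))).isSome from hs)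
  rw [run_add_of_none ht, show step M (code x) (run M (code x) t) = none from ht] at h1
  simp at h1

/-- Output steps and solutions correspond bijectively, by the absence of repetitions and injectivity
of `code`. -/
theorem Solves.ncard_eq (h : Solves M A) (x : Word k) :
    (A x).ncard = (Set.ofPred (IsOutputStep M (code x))).ncard := by
  have hinj : Set.InjOn (fun t => (outputAt M (code x) t).getD [])
      (Set.ofPred (IsOutputStep M (code x))) := by
    intro s (hs : IsOutputStep M (code x) s) t (ht : IsOutputStep M (code x) t) hst
    obtain ⟨v, hv⟩ := Option.isSome_iff_exists.1 hs
    obtain ⟨u, hu⟩ := Option.isSome_iff_exists.1 ht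
    simp only [hv, hu, Option.getD_some] at hst
    exact h.no_repetition x v s t hv (hst ▸ hu)
  rw [← Set.ncard_image_of_injective _ code_injective, ← hinj.ncard_image]
  congr 1
  ext v
  simp only [Set.mem_image]
  rw [← h.outputs x v]
  constructor
  · rintro ⟨t, ht⟩
    exact ⟨t, isOutputStep_of_some ht, by simp [ht]⟩
  · rintro ⟨t, ht, hv⟩
    obtain ⟨u, hu⟩ := Option.isSome_iff_exists.1 (show (outputAt M (code x) t).isSome from ht)
    exact ⟨t, by rw [← hv, hu]; rfl⟩

theorem Solves.nth_mem (h : Solves M A) {x : Word k} {i : ℕ} (hi : i < (A x).ncard) :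
    IsOutputStep M (code x) (Nat.nth (IsOutputStep M (code x)) i) :=
  Nat.nth_mem _ fun hf => by rwa [← Set.ncard_eq_toFinset_card _ hf, ← h.ncard_eq x]

end Solutions

theorem delayPPoly_subset (k : ℕ) : DelayPPoly k ⊆ IncPPoly k 1 := by
  rintro A ⟨hA, M, ⟨hS, p, hp⟩, hM⟩
  refine ⟨hA, M, ⟨hS, ?_⟩, hM⟩
  obtain ⟨C, b, hC⟩ := exists_eval_le_mul_pow p
  refine ⟨C, b, fun x i hi1 hi => ?_⟩
  suffices h : outputTime M (code x) i ≤ i * p.eval x.length by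
    calc outputTime M (code x) i ≤ i * p.eval x.length := h
      _ ≤ i * (C * (x.length + 1) ^ b) := Nat.mul_le_mul_left _ (hC _)
      _ = C * i ^ 1 * (x.length + 1) ^ b := by ring
  induction i, hi1 using Nat.le_induction with
  | base => simpa using ((hp x).1 (Set.nonempty_of_ncard_ne_zero (by omega))).le
  | succ i hi1 ih =>
    have h1 := (hp x).2.2 (i + 1) (by omega) hi
    have h2 := ih (by omega)
    rw [Nat.add_sub_cancel] at h1
    rw [add_mul]
    omega

/-! ## Regular delay from incremental time -/

section Regularize

variable {k : ℕ} {A : EnumProblem k} {M : Machine}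

/-- A single `c` serves all instances because each requirement on `H` is polynomial in the length of
`x`. -/
theorem exists_amortizable (hA : A ∈ EnumP k) (hM : IsIncEnumerator 1 M A)
    (hspace : UsesPolySpace k M) :
    ∃ c, ∀ x : Word k,
      Amortizable M (code x) c ((x.length + c) ^ c) (A x).ncard := by
  obtain ⟨⟨q₁, hq₁⟩, -⟩ := hA
  obtain ⟨hS, C, b, hC⟩ := hM
  obtain ⟨q, hq⟩ := hspace
  obtain ⟨c, hc, hpow⟩ := exists_eval_le_pow
    -- In order: space of `M`, its incremental time factor, the logarithm of the number of
    -- solutions, length of the input, and constants; the `7` leaves room for the `6` in the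
    -- requirements and for strict inequalities.
    (q + Polynomial.C C * (Polynomial.X + 1) ^ b + Polynomial.C (k + 1) * q₁ + Polynomial.X +
      Polynomial.C ((M.map Instr.bound).sum + M.length + k + 7))
  refine ⟨c, fun x => ?_⟩
  have h := hpow x.length
  simp only [Polynomial.eval_add, Polynomial.eval_mul, Polynomial.eval_C, Polynomial.eval_pow,
    Polynomial.eval_X, Polynomial.eval_one] at h
  generalize hH : (x.length + c) ^ c = H at *
  refine ⟨⟨fun t => ?_, fun t r => ?_, by rw [length_code]; omega⟩, fun ins hins => ?_, by omega,
    fun a ha => ?_, hc, by rw [length_code, hH], hS.finite x, hS.ncard_eq x, ?_, fun i hi1 hi => ?_⟩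
  · have := top_lt_space (run M (code x) t)
    have := hq x t
    omega
  · refine (abs_reg_lt M (code x) t r).trans_le (pow_le_pow_right₀ (by norm_num) ?_)
    have := hq x t
    omega
  · have := List.single_le_sum (fun _ _ => Nat.zero_le _) _ (List.mem_map_of_mem (f := Instr.bound) hins)
    omega
  · rw [code_eq, List.mem_map] at ha
    obtain ⟨a, -, rfl⟩ := ha
    have hak := a.isLt
    have hak := a.isLt
    have h1 : (a : ℕ) + 1 < 2 ^ H := lt_of_le_of_lt (by omega : (a : ℕ) + 1 ≤ H) Nat.lt_two_pow_self
    refine ⟨by omega, ?_⟩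
    rw [abs_of_nonneg (by omega)]
    exact_mod_cast h1
  · exact (ncard_le_of_length_le (hq₁ x)).trans (Nat.pow_le_pow_right (by norm_num) (by omega))
  · have h1 := le_time_of_isOutputStep (hS.nth_mem (x := x) (i := i - 1) (by omega))
    have h2 : time M (code x) (Nat.nth (IsOutputStep M (code x)) (i - 1)) ≤
      C * i ^ 1 * (x.length + 1) ^ b := hC x i hi1 hi
    have h3 : C * i ^ 1 * (x.length + 1) ^ b = i * (C * (x.length + 1) ^ b) := by ring
    have h4 : i * (C * (x.length + 1) ^ b) < i * H :=
      Nat.mul_lt_mul_of_pos_left (by omega) (by omega)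
    omega

/-- The bound on the addresses used by the amortized machine. -/
def maxAddr (H : ℕ) : ℕ := 32 + (H + 2) * H

/-- The bound on the values computed by the amortized machine. -/
def maxValue (H : ℕ) : ℤ := 2 ^ H * (H + 1) + maxAddr H + 10

theorem limits (H : ℕ) : Limits H (maxValue H) (maxAddr H) := ⟨le_rfl, le_rfl⟩

/-- All values have linear size in `H`, although they are exponential; this bounds both the cost of
a step and the space per register. -/
theorem maxValue_lt (H : ℕ) : maxValue H < 2 ^ (2 * H + 7) := by
  have h1 : (H : ℤ) < 2 ^ H := by exact_mod_cast Nat.lt_two_pow_self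
  have h2 : (1 : ℤ) ≤ 2 ^ H := one_le_pow₀ (by norm_num)
  have h3 : (2 : ℤ) ^ (2 * H + 7) = 128 * (2 ^ H * 2 ^ H) := by ring
  rw [h3]
  unfold maxValue maxAddr
  push_cast
  generalize (2 : ℤ) ^ H = E at *
  nlinarith

theorem intSize_reg_le {H : ℕ} {c : Config} (h : c.Bounded (maxValue H) (maxAddr H)) (r : ℕ) :
    intSize (c.reg r) ≤ 2 * H + 7 :=
  intSize_le (by omega) ((h.1 r).trans_lt (maxValue_lt H))

/-- The properties of the run of an amortized machine. -/
theorem amortize_behaves {x : Word k} {c H : ℕ} (hS : Solves M A)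
    (h : Amortizable M (code x) c H (A x).ncard) :
    ∃ vs : List (List ℤ), vs.Nodup ∧ (∀ v, v ∈ vs ↔ ∃ y ∈ A x, code y = v) ∧
      Behaves (amortize M c) (code x) (maxValue H) (maxAddr H)
        ((startCmd M c).timeBound.eval ((H + 1) * (2 * H + 1)) + 1 +
          (loopCmd M).timeBound.eval ((H + 1) * (2 * H + 1)) + 1) 0 vs := by
  obtain ⟨ts, vs, hem, hf, hnd, hall⟩ := emits_amortize (limits H) le_rfl h
  refine ⟨vs, ?_, fun v => ?_, hem.behaves 0 rfl⟩
  · clear hem hall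
    induction hf with
    | nil => exact List.nodup_nil
    | @cons t v ts vs htv hf ih =>
      rw [List.nodup_cons] at hnd ⊢
      refine ⟨fun hv => hnd.1 ?_, ih hnd.2⟩
      obtain ⟨i, hi, rfl⟩ := List.getElem_of_mem hv
      have hi' : i < ts.length := by rw [hf.length_eq]; exact hi
      have h1 := (List.forall₂_iff_get.1 hf).2 i hi' hi
      rw [hS.no_repetition x _ _ _ htv h1]
      exact List.get_mem _ _
  · rw [← hS.outputs x v]
    constructor
    · intro hv
      obtain ⟨i, hi, rfl⟩ := List.getElem_of_mem hv
      exact ⟨_, (List.forall₂_iff_get.1 hf).2 i (by rw [hf.length_eq]; exact hi) hi⟩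
    · rintro ⟨t, ht⟩
      obtain ⟨i, hi, rfl⟩ := List.getElem_of_mem (hall t (isOutputStep_of_some ht))
      have hi' : i < vs.length := by rw [← hf.length_eq]; exact hi
      have h1 := (List.forall₂_iff_get.1 hf).2 i hi hi'
      simp only [List.get_eq_getElem] at h1
      rw [h1] at ht
      rw [← Option.some.inj ht]
      exact List.getElem_mem _

theorem amortize_solves {c : ℕ} (hS : Solves M A)
    (h : ∀ x : Word k, Amortizable M (code x) c ((x.length + c) ^ c) (A x).ncard) :
    Solves (amortize M c) A where
  outputs x v := by
    obtain ⟨vs, -, hmem, hB⟩ := amortize_behaves hS (h x)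
    rw [← hmem, ← hB.mem_iff]
    simp
  no_repetition x v s t h1 h2 := by
    obtain ⟨vs, hnd, -, hB⟩ := amortize_behaves hS (h x)
    exact hB.unique hnd v s t (Nat.zero_le _) (Nat.zero_le _) h1 h2
  halts x := by
    obtain ⟨vs, -, -, hB⟩ := amortize_behaves hS (h x)
    exact hB.halts
  no_postprocessing x t h1 h2 := by
    obtain ⟨vs, -, -, hB⟩ := amortize_behaves hS (h x)
    exact hB.halted_of_last t (Nat.zero_le _) h1 h2

theorem time_add_le {w : List ℤ} {D : ℕ} (h : ∀ t, stepCost M w t ≤ D) (t d : ℕ) :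
    time M w (t + d) ≤ time M w t + d * D := by
  induction d with
  | zero => simp
  | succ d ih =>
    have h1 : time M w (t + (d + 1)) = time M w (t + d) + stepCost M w (t + d) :=
      Finset.sum_range_succ _ _
    have := h (t + d)
    rw [add_mul]
    omega

theorem stepCost_le {w : List ℤ} {H t : ℕ}
    (h : (run M w t).Bounded (maxValue H) (maxAddr H)) : stepCost M w t ≤ 2 * (2 * H + 7) + 1 := by
  unfold stepCost
  split
  · omega
  · exact cost_le (intSize_reg_le h) _

theorem outputTime_one_le {w : List ℤ} {V : ℤ} {T K D : ℕ} {vs : List (List ℤ)}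
    (hB : Behaves M w V T K 0 vs) (hD : ∀ t, stepCost M w t ≤ D) (hvs : vs ≠ []) :
    outputTime M w 1 ≤ K * D := by
  classical
  obtain ⟨t, -, ht, hout⟩ := hB.first hvs
  have h1 : Nat.nth (IsOutputStep M w) 0 < t + 1 := Nat.nth_lt_of_lt_count (by
    rw [Nat.count_succ, if_pos hout]; omega)
  have h2 := time_add_le hD 0 (Nat.nth (IsOutputStep M w) 0)
  rw [zero_add, show time M w 0 = 0 from rfl, zero_add] at h2
  exact h2.trans (Nat.mul_le_mul_right _ (by omega))

/-- Between two outputs there are at most `K` silent steps; the `+ 1` pays for the earlier output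
instruction itself. -/
theorem outputTime_le {w : List ℤ} {V : ℤ} {T K D i : ℕ} {vs : List (List ℤ)}
    (hB : Behaves M w V T K 0 vs) (hD : ∀ t, stepCost M w t ≤ D) (hi : 1 < i)
    (hcard : i ≤ (Set.ofPred (IsOutputStep M w)).ncard) :
    outputTime M w i ≤ outputTime M w (i - 1) + (K + 1) * D := by
  classical
  have hcard' : ∀ hf : (Set.ofPred (IsOutputStep M w)).Finite, i ≤ hf.toFinset.card := fun hf => by
    rwa [← Set.ncard_eq_toFinset_card _ hf]
  obtain ⟨j, rfl⟩ : ∃ j, i = j + 2 := ⟨i - 2, by omega⟩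
  unfold outputTime
  rw [show j + 2 - 1 = j + 1 by omega, show j + 1 - 1 = j by omega]
  have h1 : IsOutputStep M w (Nat.nth (IsOutputStep M w) j) :=
    Nat.nth_mem _ fun hf => by have := hcard' hf; omega
  have h2 : IsOutputStep M w (Nat.nth (IsOutputStep M w) (j + 1)) :=
    Nat.nth_mem _ fun hf => by have := hcard' hf; omega
  have h3 : Nat.nth (IsOutputStep M w) j < Nat.nth (IsOutputStep M w) (j + 1) :=
    Nat.nth_lt_nth' (Nat.lt_succ_self j) fun hf => by have := hcard' hf; omega
  obtain ⟨s, hs1, hs2, hs3⟩ := hB.next _ (Nat.zero_le _) h1 ⟨_, h3, h2⟩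
  have h4 := Nat.count_nth (p := IsOutputStep M w) (n := j) fun hf => by
    have := hcard' hf; omega
  have h5 := Nat.count_monotone (IsOutputStep M w) (Nat.succ_le_of_lt hs1)
  rw [Nat.succ_eq_add_one, Nat.count_succ, if_pos h1, h4] at h5
  have h6 : Nat.nth (IsOutputStep M w) (j + 1) < s + 1 := Nat.nth_lt_of_lt_count (by
    rw [Nat.count_succ, if_pos hs3]; omega)
  have h7 := time_add_le hD (Nat.nth (IsOutputStep M w) j)
    (Nat.nth (IsOutputStep M w) (j + 1) - Nat.nth (IsOutputStep M w) j)
  rw [Nat.add_sub_cancel' h3.le] at h7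
  exact h7.trans (Nat.add_le_add_left (Nat.mul_le_mul_right _ (by omega)) _)

end Regularize

theorem incPPoly_one_subset (k : ℕ) : IncPPoly k 1 ⊆ DelayPPoly k := by
  rintro A ⟨hA, M, hM, hspace⟩
  obtain ⟨c, h⟩ := exists_amortizable hA hM hspace
  have hS := hM.1
  have hS' := amortize_solves hS h
  let pH : Polynomial ℕ := (Polynomial.X + Polynomial.C c) ^ c
  let pL : Polynomial ℕ := (pH + 1) * (2 * pH + 1)
  let pK : Polynomial ℕ := (startCmd M c).timeBound.comp pL + 1 + (loopCmd M).timeBound.comp pL + 1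
  have hpH : ∀ n, pH.eval n = (n + c) ^ c := fun n => by simp [pH]
  have hpL : ∀ n, pL.eval n = (pH.eval n + 1) * (2 * pH.eval n + 1) := fun n => by simp [pL]
  have hpK : ∀ n, pK.eval n = (startCmd M c).timeBound.eval (pL.eval n) + 1 +
      (loopCmd M).timeBound.eval (pL.eval n) + 1 := fun n => by simp [pK]
  have hbeh : ∀ x : Word k, ∃ vs : List (List ℤ), (vs = [] ↔ A x = ∅) ∧
      Behaves (amortize M c) (code x) (maxValue (pH.eval x.length)) (maxAddr (pH.eval x.length))
        (pK.eval x.length) 0 vs := by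
    intro x
    obtain ⟨vs, -, hmem, hB⟩ := amortize_behaves hS (h x)
    refine ⟨vs, ?_, by rwa [hpK, hpL, hpH]⟩
    rw [List.eq_nil_iff_forall_not_mem, Set.eq_empty_iff_forall_notMem]
    simp only [hmem]
    exact ⟨fun h y hy => h _ ⟨y, hy, rfl⟩, fun h v ⟨y, hy, _⟩ => h y hy⟩
  -- The final `+ 1` of the delay makes the inequalities strict. In the space bound, `H * (H + 2) +
  -- 33` is the number of registers up to the largest address and `2 * H + 7` the size of each.
  refine ⟨hA, amortize M c, ⟨hS', (pK + 1) * (2 * (2 * pH + 7) + 1) + 1, fun x => ?_⟩,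
    (pH * (pH + 2) + 33) * (2 * pH + 7), fun x t => ?_⟩
  · obtain ⟨vs, hvs, hB⟩ := hbeh x
    have hD : ∀ t, stepCost (amortize M c) (code x) t ≤ 2 * (2 * pH.eval x.length + 7) + 1 :=
      fun t => stepCost_le (hB.bounded t (Nat.zero_le t))
    simp only [Polynomial.eval_add, Polynomial.eval_mul, Polynomial.eval_one,
      Polynomial.eval_ofNat]
    generalize 2 * (2 * pH.eval x.length + 7) + 1 = D at *
    have hKD : pK.eval x.length * D ≤ (pK.eval x.length + 1) * D :=
      Nat.mul_le_mul_right _ (by omega)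
    refine ⟨fun hne => ?_, fun hempty => ?_, fun i hi1 hi => ?_⟩
    · have := outputTime_one_le hB hD (fun h0 => hne.ne_empty (hvs.1 h0))
      omega
    · obtain ⟨t, ht, hhalt⟩ := hB.halts_of_nil (hvs.2 hempty)
      refine ⟨t, hhalt, ?_⟩
      have h1 := time_add_le hD 0 t
      rw [zero_add, show time (amortize M c) (code x) 0 = 0 from rfl, zero_add] at h1
      have h2 : t * D ≤ pK.eval x.length * D := Nat.mul_le_mul_right _ (by omega)
      omega
    · have := outputTime_le hB hD hi1 (by rwa [← hS'.ncard_eq x])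
      omega
  · obtain ⟨vs, -, hB⟩ := hbeh x
    have hb := hB.bounded t (Nat.zero_le t)
    simp only [Polynomial.eval_add, Polynomial.eval_mul, Polynomial.eval_ofNat]
    calc (run (amortize M c) (code x) t).space
        ≤ ∑ _r ∈ Finset.range ((run (amortize M c) (code x) t).top + 1),
            (2 * pH.eval x.length + 7) := Finset.sum_le_sum fun r _ => intSize_reg_le hb r
      _ = ((run (amortize M c) (code x) t).top + 1) * (2 * pH.eval x.length + 7) := by simp
      _ ≤ _ := by
        refine Nat.mul_le_mul_right _ ?_
        have := hb.2
        unfold maxAddr at this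
        rw [mul_comm] at this
        omega

end EnumRAM

theorem mainTheorem2 (k : ℕ) : EnumRAM.IncPPoly k 1 = EnumRAM.DelayPPoly k :=
  Set.Subset.antisymm (EnumRAM.incPPoly_one_subset k) (EnumRAM.delayPPoly_subset k)
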